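/- Let $m\ge 0$ be an integer and let $\Sigma$ be a simplicial complex on $[m]=\{1,\dots,m\}$, that is, a set of subsets of $[m]$ that contains $\emptyset$ and is closed under passing to subsets (ghost vertices $\{i\}\notin\Sigma$ are allowed). Let $$\mathcal Z(\Sigma)=\bigcup_{\sigma\in\Sigma}\{(z_1,\dots,z_m)\in (D^2)^m \mid z_i\in S^1 \text{ for all } i\notin\sigma\}$$ be the moment-angle complex of $\Sigma$, where $D^2\subset\mathbb C$ is the closed unit disc and $S^1$ its boundary. Let $C^*(\mathcal Z(\Sigma))$ be its normalized singular cochain algebra with integral coefficients: cochains vanish on degenerate simplices, the differential is $(d\gamma)(x)=-(-1)^{\deg\gamma}\gamma(dx)$, and the product is the cup product dual to the diagonal $\Delta x=\sum_k x(0\dots k)\otimes x(k\dots n)$ (with the Koszul sign $(\alpha\otimes\beta)(x\otimes y)=(-1)^{\deg\beta\,\deg x}\alpha(x)\beta(y)$). Let $\mathbb Z[\Sigma]=\mathbb Z[t_1,\dots,t_m]/(t_{i_1}\cdots t_{i_k} \mid \{i_1,\dots,i_k\}\notin\Sigma,\ i_1,\dots,i_k \text{ distinct})$ be the Stanley–Reisner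 ring, with $\deg t_i=2$. Let $\mathbf A(\Sigma)$ be the commutative differential graded algebra $$\mathbf A(\Sigma)=\mathbb Z[\Sigma]\otimes\bigwedge(s_1,\dots,s_m),\qquad \deg s_i=1,\quad d s_i=t_i,\quad d t_i=0,$$ and let $\mathbf B(\Sigma)$ be the quotient of $\mathbf A(\Sigma)$ by the ideal generated by all $t_i^2$ and all $s_it_i$, $i\in[m]$. For a subcomplex $\Sigma'\subset\Sigma$, the inclusion $\mathcal Z(\Sigma')\subset\mathcal Z(\Sigma)$ induces a dga map $C^*(\mathcal Z(\Sigma))\to C^*(\mathcal Z(\Sigma'))$, and there are dga maps $\mathbf A(\Sigma)\to\mathbf A(\Sigma')$ and $\mathbf B(\Sigma)\to\mathbf B(\Sigma')$ sending each $s_i$ to $s_i$ and each $t_i$ to $t_i$. In this way $C^*(\mathcal Z(-))$, $\mathbf A$ and $\mathbf B$ are contravariant functors from the poset of simplicial complexes on $[m]$, ordered by inclusion, to dgas over $\mathbb Z$. **Theorem.** The functor $C^*(\mathcal Z(-))$ is connected to $\mathbf A$, and also to $\mathbf B$, by a finite zigzag of natural transformations of functors with values in dgas, each of whose components is a dga quasi-isomorphism.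 In particular, for every $\Sigma$ the singular cochain algebra $C^*(\mathcal Z(\Sigma))$ is quasi-isomorphic to the dgas $\mathbf A(\Sigma)$ and $\mathbf B(\Sigma)$, naturally with respect to inclusions of subcomplexes. -/

import Mathlib

open CategoryTheory Opposite Simplicial
open scoped TensorProduct


/-- A differential graded algebra over `R`, graded by the natural numbers: a cochain complex of
`R`-modules with a unit in degree `0` and an associative bilinear product of degree `0`, such that the
differential (of degree `1`) satisfies the graded Leibniz rule
`d (a b) = (d a) b + (-1) ^ p a (d b)` for `a` of degree `p`. The product of elements of degrees `p`
and `q` lands in degree `n` for any `n` with a proof of `p + q = n`. -/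
structure DGA (R : Type) [CommRing R] where
  cx : CochainComplex (ModuleCat.{0} R) ℕ
  one : cx.X 0
  mul : ∀ {p q n : ℕ}, p + q = n → (cx.X p →ₗ[R] cx.X q →ₗ[R] cx.X n)
  one_mul : ∀ {n : ℕ} (a : cx.X n), mul (Nat.zero_add n) one a = a
  mul_one : ∀ {n : ℕ} (a : cx.X n), mul (Nat.add_zero n) a one = a
  mul_assoc : ∀ {p q r k l n : ℕ} (h₁ : p + q = k) (h₂ : k + r = n) (h₃ : q + r = l)
    (h₄ : p + l = n) (a : cx.X p) (b : cx.X q) (c : cx.X r),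
    mul h₂ (mul h₁ a b) c = mul h₄ a (mul h₃ b c)
  leibniz : ∀ {p q n : ℕ} (h : p + q = n) (h₁ : (p + 1) + q = n + 1) (h₂ : p + (q + 1) = n + 1)
    (a : cx.X p) (b : cx.X q),
    cx.d n (n + 1) (mul h a b) =
      mul h₁ (cx.d p (p + 1) a) b + (-1 : R) ^ p • mul h₂ a (cx.d q (q + 1) b)

namespace DGA

/-- Morphisms of dgas: cochain maps preserving the unit and the product. -/
@[ext]
structure Hom {R : Type} [CommRing R] (A B : DGA R) where
  toHom : A.cx ⟶ B.cx
  map_one : toHom.f 0 A.one = B.one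
  map_mul : ∀ {p q n : ℕ} (h : p + q = n) (a : A.cx.X p) (b : A.cx.X q),
    toHom.f n (A.mul h a b) = B.mul h (toHom.f p a) (toHom.f q b)

instance (R : Type) [CommRing R] : Category (DGA R) where
  Hom := Hom
  id A := { toHom := 𝟙 _, map_one := by simp, map_mul := by simp }
  comp f g :=
    { toHom := f.toHom ≫ g.toHom
      map_one := by simp [f.map_one, g.map_one]
      map_mul := by simp [f.map_mul, g.map_mul] }

variable {R : Type} [CommRing R]

theorem hom_ext {A B : DGA R} {f g : A ⟶ B}
    (h : ∀ (n : ℕ) (a : A.cx.X n), f.toHom.f n a = g.toHom.f n a) : f = g :=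
  Hom.ext (HomologicalComplex.hom_ext _ _ fun n => ModuleCat.hom_ext (LinearMap.ext (h n)))

/-- A dga quasi-isomorphism: a morphism of dgas inducing isomorphisms on cohomology. -/
def IsQuasiIso {A B : DGA R} (f : A ⟶ B) : Prop := QuasiIso f.toHom

/-- Two functors with values in dgas are naturally quasi-isomorphic if they are connected by a finite
zigzag of natural transformations of dga-valued functors (pointing in either direction), all of whose
components are dga quasi-isomorphisms. -/
def NaturallyQuasiIsomorphic {C : Type} [Category.{0} C] (F G : C ⥤ DGA R) : Prop :=
  Relation.EqvGen (fun F' G' : C ⥤ DGA R => ∃ φ : F' ⟶ G', ∀ X : C, IsQuasiIso (φ.app X)) F G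

section OfRing

variable {A B : Type} [Ring A] [Algebra R A] [Ring B] [Algebra R B]

/-- The dga given by an `R`-algebra `A` with submodules `𝒜 n` of elements of degree `n` and a
differential `d`: its degree `n` part is `𝒜 n`. -/
noncomputable def ofRing (𝒜 : ℕ → Submodule R A) (d : A →ₗ[R] A) (h_one : 1 ∈ 𝒜 0)
    (h_mul : ∀ {p q : ℕ} {a b : A}, a ∈ 𝒜 p → b ∈ 𝒜 q → a * b ∈ 𝒜 (p + q))
    (h_d : ∀ {n : ℕ} {a : A}, a ∈ 𝒜 n → d a ∈ 𝒜 (n + 1)) (h_dd : ∀ a : A, d (d a) = 0)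
    (h_leibniz : ∀ {p : ℕ} {a : A}, a ∈ 𝒜 p → ∀ b : A,
      d (a * b) = d a * b + (-1 : R) ^ p • (a * d b)) : DGA R where
  cx := CochainComplex.of (fun n => ModuleCat.of R (𝒜 n))
    (fun n => ModuleCat.ofHom (d.restrict fun _ h => h_d h))
    (fun n => ModuleCat.hom_ext (LinearMap.ext fun a => Subtype.ext (h_dd (a : A))))
  one := ⟨1, h_one⟩
  mul {p q n} h := LinearMap.mk₂ R
    (fun (a : 𝒜 p) (b : 𝒜 q) => (⟨a * b, h ▸ h_mul a.2 b.2⟩ : 𝒜 n))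
    (fun a a' b => Subtype.ext (add_mul _ _ _)) (fun c a b => Subtype.ext (smul_mul_assoc _ _ _))
    (fun a b b' => Subtype.ext (mul_add _ _ _)) (fun c a b => Subtype.ext (mul_smul_comm _ _ _))
  one_mul a := Subtype.ext (_root_.one_mul _)
  mul_one a := Subtype.ext (_root_.mul_one _)
  mul_assoc _ _ _ _ a b c := Subtype.ext (_root_.mul_assoc _ _ _)
  leibniz h h₁ h₂ a b := by
    simp only [CochainComplex.of_d]
    exact Subtype.ext (h_leibniz a.2 _)

/-- The dga morphism given by an algebra homomorphism compatible with gradings and differentials. -/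
noncomputable def ofRingHom {𝒜 : ℕ → Submodule R A} {d : A →ₗ[R] A} {h_one h_mul h_d h_dd h_leibniz}
    {ℬ : ℕ → Submodule R B} {d' : B →ₗ[R] B} {h_one' h_mul' h_d' h_dd' h_leibniz'}
    (f : A →ₐ[R] B) (hf : ∀ {n : ℕ} {a : A}, a ∈ 𝒜 n → f a ∈ ℬ n)
    (hfd : ∀ a : A, f (d a) = d' (f a)) :
    ofRing 𝒜 d h_one h_mul h_d h_dd h_leibniz ⟶ ofRing ℬ d' h_one' h_mul' h_d' h_dd' h_leibniz' where
  toHom := CochainComplex.ofHom (fun n => ModuleCat.ofHom (f.toLinearMap.restrict fun _ h => hf h))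
    (fun n => by
      ext a
      simp only [ofRing, CochainComplex.of_d]
      exact Subtype.ext (hfd _).symm)
  map_one := Subtype.ext (_root_.map_one f)
  map_mul _ a b := Subtype.ext (_root_.map_mul f _ _)

end OfRing

end DGA

namespace SingularCochains

variable {R : Type} [CommRing R]

theorem _root_.SSet.map_mem_degenerate_of_not_injective (S : SSet.{0}) {p : ℕ} {m : SimplexCategory}
    (g : ⦋p⦌ ⟶ m) (hg : ¬ Function.Injective g.toOrderHom) (y : S.obj (op m)) :
    S.map g.op y ∈ S.degenerate p := by
  obtain _ | p := p
  · exact absurd (fun a b _ => Subsingleton.elim (α := Fin 1) a b) hg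
  · obtain ⟨i, g', rfl⟩ := SimplexCategory.eq_σ_comp_of_not_injective g hg
    rw [op_comp, S.map_comp]
    exact S.σ_mem_degenerate i _

/-- The normalized `n`-cochains of a simplicial set with coefficients in `R`: the `R`-valued functions
on `n`-simplices that vanish on all degenerate simplices, that is, the dual of the module of
normalized `n`-chains (free on all `n`-simplices, modulo the degenerate ones). -/
def normalizedCochains (R : Type) [CommRing R] (S : SSet.{0}) (n : ℕ) : Submodule R (S _⦋n⦌ → R) where
  carrier := {γ | ∀ x ∈ S.degenerate n, γ x = 0}
  zero_mem' _ _ := rfl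
  add_mem' ha hb x hx := by simp [ha x hx, hb x hx]
  smul_mem' c a ha x hx := by simp [ha x hx]

/-- The inclusion of the first `p + 1` vertices; it induces `x ↦ x(0…p)`. -/
def frontFace {p q n : ℕ} (h : p + q = n) : ⦋p⦌ ⟶ ⦋n⦌ :=
  SimplexCategory.mkHom (n := p) (m := n)
    ⟨fun i => Fin.castLE (by omega) i, fun i j hij => hij⟩

/-- The inclusion of the last `q + 1` vertices; it induces `x ↦ x(p…n)`. -/
def backFace {p q n : ℕ} (h : p + q = n) : ⦋q⦌ ⟶ ⦋n⦌ :=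
  SimplexCategory.mkHom (n := q) (m := n)
    ⟨fun j => ⟨p + j.val, by omega⟩, fun _ _ hij => Nat.add_le_add_left hij p⟩

theorem frontFace_apply {p q n : ℕ} (h : p + q = n) (i : Fin (p + 1)) :
    ((frontFace h).toOrderHom i).val = i.val := rfl
theorem backFace_apply {p q n : ℕ} (h : p + q = n) (i : Fin (q + 1)) :
    ((backFace h).toOrderHom i).val = p + i.val := rfl

theorem SimplexCategory.hom_ext_val {a b : ℕ} {f g : ⦋a⦌ ⟶ ⦋b⦌}
    (h : ∀ i : Fin (a + 1), (f.toOrderHom i).val = (g.toOrderHom i).val) : f = g := by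
  ext i
  exact h i

theorem δ_val {n : ℕ} (i : Fin (n + 2)) (j : Fin (n + 1)) :
    ((SimplexCategory.δ i).toOrderHom j).val = if j.val < i.val then j.val else j.val + 1 := by
  change (i.succAbove j).val = _
  simp only [Fin.succAbove, Fin.lt_def]
  split_ifs <;> simp_all

theorem σ_val {n : ℕ} (i : Fin (n + 1)) (j : Fin (n + 2)) :
    ((SimplexCategory.σ i).toOrderHom j).val = if j.val ≤ i.val then j.val else j.val - 1 := by
  change (i.predAbove j).val = _
  simp only [Fin.predAbove, Fin.lt_def]
  split_ifs with h1 h2 h2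
  · rw [Fin.val_castSucc] at h1; omega
  · rfl
  · rfl
  · rw [Fin.val_castSucc] at h1; omega

theorem comp_val {a b c : ℕ} (f : ⦋a⦌ ⟶ ⦋b⦌) (g : ⦋b⦌ ⟶ ⦋c⦌) (i : Fin (a + 1)) :
  ((f ≫ g).toOrderHom i) = g.toOrderHom (f.toOrderHom i) := rfl

/-- The coboundary `(d γ)(x) = -(-1) ^ (deg γ) γ(d x)`, where `d x` is the alternating sum of the faces
of the simplex `x`. -/
def coboundaryFun (R : Type) [CommRing R] (S : SSet.{0}) (n : ℕ) : (S _⦋n⦌ → R) →ₗ[R] (S _⦋n + 1⦌ → R) where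
  toFun γ x := -(-1) ^ n * ∑ i : Fin (n + 2), (-1) ^ (i : ℕ) * γ (S.δ i x)
  map_add' a b := by
    ext x; simp [mul_add, Finset.sum_add_distrib]
  map_smul' c a := by
    ext x; simp only [Pi.smul_apply, smul_eq_mul, Finset.mul_sum, RingHom.id_apply]
    exact Finset.sum_congr rfl fun i _ => by ring

theorem coboundaryFun_apply (S : SSet.{0}) (n : ℕ) (γ : S _⦋n⦌ → R) (x : S _⦋n + 1⦌) :
    coboundaryFun R S n γ x = -(-1) ^ n * ∑ i : Fin (n + 2), (-1) ^ (i : ℕ) * γ (S.δ i x) := rfl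

theorem coboundaryFun_mem (S : SSet.{0}) (n : ℕ) {γ : S _⦋n⦌ → R}
    (hγ : γ ∈ normalizedCochains R S n) : coboundaryFun R S n γ ∈ normalizedCochains R S (n + 1) := by
  intro x hx
  rw [SSet.degenerate_eq_iUnion_range_σ] at hx
  obtain ⟨j, y, rfl⟩ := Set.mem_iUnion.1 hx
  rw [coboundaryFun_apply, Finset.sum_eq_add j.castSucc j.succ (Fin.castSucc_lt_succ).ne]
  · rw [S.δ_comp_σ_self_apply, S.δ_comp_σ_succ_apply]
    simp [pow_succ]
  · rintro i - ⟨h1, h2⟩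
    rw [hγ, mul_zero]
    change S.map (SimplexCategory.δ i).op (S.map (SimplexCategory.σ j).op y) ∈ _
    rw [← comp_apply, ← S.map_comp, ← op_comp]
    apply SSet.map_mem_degenerate_of_not_injective
    intro hinj
    have := SimplexCategory.mono_iff_injective.2 hinj
    have h := SimplexCategory.eq_id_of_mono (SimplexCategory.δ i ≫ SimplexCategory.σ j)
    have hv : ∀ k : Fin (n + 1), ((SimplexCategory.σ j).toOrderHom
        ((SimplexCategory.δ i).toOrderHom k)).val = k.val := fun k => by
      rw [← comp_val, h]; rfl
    simp only [σ_val, δ_val] at hv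
    rw [Ne, Fin.ext_iff] at h1 h2
    simp only [Fin.val_castSucc, Fin.val_succ] at h1 h2
    by_cases hij : i.val < j.val
    · have := hv ⟨i, by omega⟩
      simp at this
      omega
    · have := hv ⟨i - 1, by omega⟩
      simp only at this
      split_ifs at this <;> omega
  · simp
  · simp

theorem coboundaryFun_comp (S : SSet.{0}) (n : ℕ) (γ : S _⦋n⦌ → R) :
    coboundaryFun R S (n + 1) (coboundaryFun R S n γ) = 0 := by
  ext x
  simp only [coboundaryFun_apply, Pi.zero_apply, Finset.mul_sum, ← Finset.sum_product']
  let P := Fin (n + 3) × Fin (n + 2)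
  let T : Finset P := Finset.univ.filter fun ij => (ij.1 : ℕ) ≤ (ij.2 : ℕ)
  rw [Finset.univ_product_univ, ← Finset.sum_add_sum_compl T, ← eq_neg_iff_add_eq_zero,
    ← Finset.sum_neg_distrib]
  let φ : ∀ ij : P, ij ∈ T → P := fun ij hij =>
    (ij.2.succ, Fin.castLT ij.1 (lt_of_le_of_lt (Finset.mem_filter.mp hij).right (Fin.is_lt ij.2)))
  apply Finset.sum_bij φ
  · intro ij hij
    simp_rw [T, φ, Finset.compl_filter, Finset.mem_filter_univ, Fin.val_succ,
      Fin.val_castLT] at hij ⊢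
    lia
  · rintro ⟨i, j⟩ hij ⟨i', j'⟩ hij' h
    exact Prod.ext_iff.2 ⟨by simpa [φ, Fin.ext_iff] using! congr_arg Prod.snd h,
      by simpa [φ] using! congr_arg Prod.fst h⟩
  · rintro ⟨i', j'⟩ hij'
    simp_rw [T, Finset.compl_filter, Finset.mem_filter_univ, not_le] at hij'
    refine ⟨(Fin.castSucc j', i'.pred <| ?_), ?_, ?_⟩
    · rintro rfl
      simp only [Fin.val_zero, not_lt_zero] at hij'
    · simpa [T] using! Nat.le_sub_one_of_lt hij'
    · simp only [φ, Fin.castLT_castSucc, Fin.succ_pred]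
  · rintro ⟨i, j⟩ hij
    have h : i ≤ j.castSucc := by simpa [T] using! hij
    simp only [φ, Fin.val_succ, Fin.val_castLT]
    rw [S.δ_comp_δ''_apply h]
    ring

/-- The differential of the normalized cochain complex. -/
def normalizedCoboundary (R : Type) [CommRing R] (S : SSet.{0}) (n : ℕ) :
    normalizedCochains R S n →ₗ[R] normalizedCochains R S (n + 1) :=
  (coboundaryFun R S n).restrict fun _ h => coboundaryFun_mem S n h

theorem cupFun_mem (S : SSet.{0}) {p q n : ℕ} (h : p + q = n) {a : S _⦋p⦌ → R} {b : S _⦋q⦌ → R}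
    (ha : a ∈ normalizedCochains R S p) (hb : b ∈ normalizedCochains R S q) :
    (fun x : S _⦋n⦌ => (-1 : R) ^ (p * q) *
      (a (S.map (frontFace h).op x) * b (S.map (backFace h).op x))) ∈ normalizedCochains R S n := by
  rintro x ⟨m, hm, f, y, rfl⟩
  simp only [← comp_apply, ← S.map_comp, ← op_comp]
  by_cases h1 : Function.Injective (frontFace h ≫ f).toOrderHom
  · by_cases h2 : Function.Injective (backFace h ≫ f).toOrderHom
    · exfalso
      have : Function.Injective f.toOrderHom := by
        apply StrictMono.injective
        apply Fin.strictMono_iff_lt_succ.2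
        intro i
        have hin : i.val < n := i.isLt
        apply lt_of_le_of_ne (f.toOrderHom.monotone (Fin.castSucc_lt_succ).le)
        intro heq
        by_cases hi : i.val < p
        · have := @h1 ⟨i, by simp; omega⟩ ⟨i + 1, by simp; omega⟩ heq
          simp at this
        · have := @h2 ⟨i - p, by simp; omega⟩ ⟨i + 1 - p, by simp; omega⟩ (by
            rw [comp_val, comp_val]
            convert heq using 2 <;> ext <;> simp [backFace_apply] <;> omega)
          simp at this
          omega
      have := SimplexCategory.mono_iff_injective.2 this
      have := SimplexCategory.le_of_mono f
      omega
    · rw [hb _ (SSet.map_mem_degenerate_of_not_injective S _ h2 y), mul_zero, mul_zero]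
  · rw [ha _ (SSet.map_mem_degenerate_of_not_injective S _ h1 y), zero_mul, mul_zero]

/-- The product on the dual of the normalized chains, that is, the composition of `a ⊗ b` with the
Alexander-Whitney diagonal `Δ x = ∑ x(0…p) ⊗ x(p…n)`. The sign `(-1) ^ (p q)` is the Koszul sign in
`(a ⊗ b)(x ⊗ y) = (-1) ^ (deg b deg x) a(x) b(y)`; it is the one for which the differential above is a
derivation. -/
def normalizedCup (R : Type) [CommRing R] (S : SSet.{0}) {p q n : ℕ} (h : p + q = n) :
    normalizedCochains R S p →ₗ[R] normalizedCochains R S q →ₗ[R] normalizedCochains R S n :=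
  LinearMap.mk₂ R (fun a b => ⟨_, cupFun_mem S h a.2 b.2⟩)
    (fun a a' b => by ext; simp; ring) (fun c a b => by ext; simp; ring)
    (fun a b b' => by ext; simp; ring) (fun c a b => by ext; simp; ring)

theorem normalizedCup_apply (S : SSet.{0}) {p q n : ℕ} (h : p + q = n)
    (a : normalizedCochains R S p) (b : normalizedCochains R S q) (x : S _⦋n⦌) :
    (normalizedCup R S h a b).1 x = (-1 : R) ^ (p * q) *
      (a.1 (S.map (frontFace h).op x) * b.1 (S.map (backFace h).op x)) := rfl

theorem normalizedCup_assoc (S : SSet.{0})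
    {p q r k l n : ℕ} (h₁ : p + q = k) (h₂ : k + r = n) (h₃ : q + r = l)
    (h₄ : p + l = n) (a : normalizedCochains R S p) (b : normalizedCochains R S q)
    (c : normalizedCochains R S r) :
    normalizedCup R S h₂ (normalizedCup R S h₁ a b) c =
      normalizedCup R S h₄ a (normalizedCup R S h₃ b c) := by
  ext x
  have e1 : frontFace h₁ ≫ frontFace h₂ = frontFace h₄ :=
    SimplexCategory.hom_ext_val fun i => rfl
  have e2 : backFace h₁ ≫ frontFace h₂ = frontFace h₃ ≫ backFace h₄ :=
    SimplexCategory.hom_ext_val fun i => rfl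
  have e3 : backFace h₃ ≫ backFace h₄ = backFace h₂ :=
    SimplexCategory.hom_ext_val fun i => by
      simp only [comp_val, backFace_apply]; omega
  simp only [normalizedCup_apply, ← comp_apply, ← S.map_comp, ← op_comp, e1, e2, e3]
  subst h₁ h₃
  ring

theorem normalizedCup_leibniz (S : SSet.{0}) {p q n : ℕ} (h : p + q = n)
    (h₁ : (p + 1) + q = n + 1) (h₂ : p + (q + 1) = n + 1)
    (a : normalizedCochains R S p) (b : normalizedCochains R S q) :
    normalizedCoboundary R S n (normalizedCup R S h a b) =
      normalizedCup R S h₁ (normalizedCoboundary R S p a) b +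
        (-1 : R) ^ p • normalizedCup R S h₂ a (normalizedCoboundary R S q b) := by
  ext x
  have hδ : ∀ (k : ℕ) (i : Fin (k + 2)) (z : S _⦋k + 1⦌),
    S.δ i z = S.map (SimplexCategory.δ i).op z := fun _ _ _ => rfl
  change coboundaryFun R S n (normalizedCup R S h a b).1 x = (-1) ^ ((p + 1) * q) * (coboundaryFun R S p a.1 _ * b.1 _) +
      (-1) ^ p * ((-1) ^ (p * (q + 1)) * (a.1 _ * coboundaryFun R S q b.1 _))
  simp only [coboundaryFun_apply, normalizedCup_apply, hδ, ← comp_apply, ← S.map_comp, ← op_comp]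
  rw [← (finCongr (show p + 1 + (q + 1) = n + 2 by omega)).sum_comp, Fin.sum_univ_add,
    Fin.sum_univ_castSucc (n := p + 1), Fin.sum_univ_succ (n := q + 1)]
  have e1 : ∀ i : Fin (p + 1), frontFace h ≫ SimplexCategory.δ
      (finCongr (show p + 1 + (q + 1) = n + 2 by omega) (Fin.castAdd (q + 1) i)) =
      SimplexCategory.δ i.castSucc ≫ frontFace h₁ := fun i =>
    SimplexCategory.hom_ext_val fun j => by
      simp only [comp_val, frontFace_apply, δ_val]; simp; try omega
  have e2 : ∀ i : Fin (p + 1), backFace h ≫ SimplexCategory.δ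
      (finCongr (show p + 1 + (q + 1) = n + 2 by omega) (Fin.castAdd (q + 1) i)) =
      backFace h₁ := fun i =>
    SimplexCategory.hom_ext_val fun j => by
      simp only [comp_val, backFace_apply, δ_val]; simp; split_ifs <;> omega
  have e3 : ∀ i : Fin (q + 1), frontFace h ≫ SimplexCategory.δ
      (finCongr (show p + 1 + (q + 1) = n + 2 by omega) (Fin.natAdd (p + 1) i)) =
      frontFace h₂ := fun i =>
    SimplexCategory.hom_ext_val fun j => by
      simp only [comp_val, frontFace_apply, δ_val]; simp; try omega
  have e4 : ∀ i : Fin (q + 1), backFace h ≫ SimplexCategory.δ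
      (finCongr (show p + 1 + (q + 1) = n + 2 by omega) (Fin.natAdd (p + 1) i)) =
      SimplexCategory.δ i.succ ≫ backFace h₂ := fun i =>
    SimplexCategory.hom_ext_val fun j => by
      simp only [comp_val, backFace_apply, δ_val]; simp; split_ifs <;> omega
  have e5 : SimplexCategory.δ (Fin.last (p + 1)) ≫ frontFace h₁ = frontFace h₂ :=
    SimplexCategory.hom_ext_val fun j => by
      simp only [comp_val, frontFace_apply, δ_val]; simp; try omega
  have e6 : SimplexCategory.δ (0 : Fin (q + 2)) ≫ backFace h₂ = backFace h₁ :=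
    SimplexCategory.hom_ext_val fun j => by
      simp only [comp_val, backFace_apply, δ_val]; simp; try omega
  simp only [e1, e2, e3, e4, e5, e6]
  simp only [finCongr_apply, Fin.val_cast, Fin.val_castAdd, Fin.val_natAdd, Fin.val_castSucc,
    Fin.val_last, Fin.val_succ, Fin.val_zero, mul_add, add_mul, Finset.mul_sum, Finset.sum_mul]
  subst h
  have key : ∀ A B A' M M' B' : R, A = A' → B = B' → M + M' = 0 →
      A + B = (A' + M) + (M' + B') := by
    intro A B A' M M' B' h1 h2 h3
    rw [h1, h2]
    linear_combination (-1 : R) * h3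
  refine key _ _ _ _ _ _ (Finset.sum_congr rfl fun i _ => ?_)
    (Finset.sum_congr rfl fun i _ => ?_) ?_ <;>
  rcases neg_one_pow_eq_or R p with hp | hp <;> rcases neg_one_pow_eq_or R q with hq | hq <;>
  simp only [pow_add, pow_one, pow_zero, mul_one, one_mul, hp, hq] <;> ring

theorem one_mem (R : Type) [CommRing R] (S : SSet.{0}) :
    (fun _ => 1) ∈ normalizedCochains R S 0 := by
  intro x hx
  simp at hx

theorem normalizedCup_one_left (S : SSet.{0}) {n : ℕ} (a : normalizedCochains R S n) :
    normalizedCup R S (Nat.zero_add n) ⟨_, one_mem R S⟩ a = a := by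
  ext x
  have e : backFace (Nat.zero_add n) = 𝟙 ⦋n⦌ :=
    SimplexCategory.hom_ext_val fun i => by
      rw [backFace_apply, zero_add]; rfl
  rw [normalizedCup_apply, e]
  simp

theorem normalizedCup_one_right (S : SSet.{0}) {n : ℕ} (a : normalizedCochains R S n) :
    normalizedCup R S (Nat.add_zero n) a ⟨_, one_mem R S⟩ = a := by
  ext x
  have e : frontFace (Nat.add_zero n) = 𝟙 ⦋n⦌ :=
    SimplexCategory.hom_ext_val fun i => rfl
  rw [normalizedCup_apply, e]
  simp

/-- The normalized cochain algebra of a simplicial set. -/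
noncomputable def dga (R : Type) [CommRing R] (S : SSet.{0}) : DGA R where
  cx := CochainComplex.of (fun n => ModuleCat.of R (normalizedCochains R S n))
    (fun n => ModuleCat.ofHom (normalizedCoboundary R S n))
    (fun n => ModuleCat.hom_ext (LinearMap.ext fun γ =>
      Subtype.ext (coboundaryFun_comp S n γ.1)))
  one := ⟨_, one_mem R S⟩
  mul h := normalizedCup R S h
  one_mul a := normalizedCup_one_left S a
  mul_one a := normalizedCup_one_right S a
  mul_assoc h₁ h₂ h₃ h₄ a b c := normalizedCup_assoc S h₁ h₂ h₃ h₄ a b c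
  leibniz h h₁ h₂ a b := by
    simp only [CochainComplex.of_d]
    exact normalizedCup_leibniz S h h₁ h₂ a b

/-- Pullback of normalized cochains along a map of simplicial sets. -/
def pullback (R : Type) [CommRing R] {S T : SSet.{0}} (f : S ⟶ T) (n : ℕ) :
    normalizedCochains R T n →ₗ[R] normalizedCochains R S n where
  toFun γ := ⟨fun x => γ.1 (f.app _ x), fun _ hx => γ.2 _ (SSet.degenerate_app_apply hx f)⟩
  map_add' _ _ := rfl
  map_smul' _ _ := rfl

theorem pullback_apply {S T : SSet.{0}} (f : S ⟶ T) {n : ℕ} (γ : normalizedCochains R T n)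
    (x : S _⦋n⦌) : (pullback R f n γ).1 x = γ.1 (f.app _ x) := rfl

theorem pullback_coboundary {S T : SSet.{0}} (f : S ⟶ T) {n : ℕ}
    (γ : normalizedCochains R T n) :
    normalizedCoboundary R S n (pullback R f n γ) =
      pullback R f (n + 1) (normalizedCoboundary R T n γ) := by
  ext x
  change coboundaryFun R S n (pullback R f n γ).1 x = coboundaryFun R T n γ.1 (f.app _ x)
  simp only [coboundaryFun_apply, pullback_apply, SSet.δ_naturality_apply]

theorem pullback_cup {S T : SSet.{0}} (f : S ⟶ T) {p q n : ℕ} (h : p + q = n)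
    (a : normalizedCochains R T p) (b : normalizedCochains R T q) :
    pullback R f n (normalizedCup R T h a b) =
      normalizedCup R S h (pullback R f p a) (pullback R f q b) := by
  ext x
  simp only [normalizedCup_apply, pullback_apply, NatTrans.naturality_apply]

/-- The normalized cochain algebra as a contravariant functor. -/
noncomputable def functor (R : Type) [CommRing R] : SSet.{0}ᵒᵖ ⥤ DGA R where
  obj S := dga R S.unop
  map f :=
    { toHom := CochainComplex.ofHom (fun n => ModuleCat.ofHom (pullback R f.unop n))
        (fun n => by
          ext γ
          simp only [dga, CochainComplex.of_d]
          exact pullback_coboundary f.unop γ)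
      map_one := rfl
      map_mul := fun h a b => pullback_cup f.unop h a b }
  map_id _ := DGA.hom_ext fun _ _ => rfl
  map_comp _ _ := DGA.hom_ext fun _ _ => rfl

end SingularCochains


/-- A simplicial complex on the vertex set `Fin m`: a set of finite subsets that contains the empty
simplex and is closed under passing to subsets. Not every vertex has to belong to it (there may be
ghost vertices). -/
@[ext]
structure SimplicialComplexOn (m : ℕ) where
  faces : Set (Finset (Fin m))
  empty_mem : ∅ ∈ faces
  down_closed : ∀ {σ τ : Finset (Fin m)}, σ ∈ faces → τ ⊆ σ → τ ∈ faces

namespace SimplicialComplexOn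

/-- Simplicial complexes on `Fin m` are ordered by inclusion (`K ≤ L` if `K` is a subcomplex of `L`). -/
instance (m : ℕ) : PartialOrder (SimplicialComplexOn m) :=
  PartialOrder.lift faces fun _ _ => SimplicialComplexOn.ext

variable {R : Type} [CommRing R] {m : ℕ}

theorem le_iff {K L : SimplicialComplexOn m} : K ≤ L ↔ K.faces ⊆ L.faces := Iff.rfl

/-- The Stanley-Reisner ideal, generated by the monomials `∏ i ∈ σ, t i` for all non-faces `σ`. -/
noncomputable def stanleyReisnerIdeal (R : Type) [CommRing R] (K : SimplicialComplexOn m) : Ideal (MvPolynomial (Fin m) R) :=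
  Ideal.span {f | ∃ σ : Finset (Fin m), σ ∉ K.faces ∧ f = ∏ i ∈ σ, MvPolynomial.X i}

theorem stanleyReisnerIdeal_anti {K L : SimplicialComplexOn m} (h : K ≤ L) :
    (L.stanleyReisnerIdeal R) ≤ K.stanleyReisnerIdeal R :=
  Ideal.span_mono fun _ ⟨σ, hσ, hf⟩ => ⟨σ, fun hK => hσ (h hK), hf⟩

/-- The Stanley-Reisner ring `R[K]`. -/
def StanleyReisnerRing (R : Type) [CommRing R] (K : SimplicialComplexOn m) : Type :=
  MvPolynomial (Fin m) R ⧸ K.stanleyReisnerIdeal R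

noncomputable instance (K : SimplicialComplexOn m) : CommRing (K.StanleyReisnerRing R) :=
  inferInstanceAs (CommRing (MvPolynomial (Fin m) R ⧸ K.stanleyReisnerIdeal R))

noncomputable instance (K : SimplicialComplexOn m) : Algebra R (K.StanleyReisnerRing R) :=
  inferInstanceAs (Algebra R (MvPolynomial (Fin m) R ⧸ K.stanleyReisnerIdeal R))

/-- The projection of the polynomial ring onto the Stanley-Reisner ring. -/
noncomputable def srMk (R : Type) [CommRing R] (K : SimplicialComplexOn m) :
    MvPolynomial (Fin m) R →ₐ[R] K.StanleyReisnerRing R :=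
  Ideal.Quotient.mkₐ R (K.stanleyReisnerIdeal R)

/-- The algebra underlying `A(K)`, namely `R[K] ⊗ Λ(s 1, …, s m)`. Since the first factor is
concentrated in even degrees, this is also the tensor product in the graded sense. -/
abbrev ARing (R : Type) [CommRing R] (K : SimplicialComplexOn m) : Type :=
  (K.StanleyReisnerRing R) ⊗[R] ExteriorAlgebra R (Fin m → R)

noncomputable section

/-- The class of the `i`-th variable in the Stanley-Reisner ring. -/
def srVar (R : Type) [CommRing R] (K : SimplicialComplexOn m) (i : Fin m) : K.StanleyReisnerRing R :=
  K.srMk R (MvPolynomial.X i)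

/-- The generator `s i` of degree `1`. -/
def s (R : Type) [CommRing R] (K : SimplicialComplexOn m) (i : Fin m) : K.ARing R :=
  1 ⊗ₜ ExteriorAlgebra.ι R (Pi.single i 1)

/-- The generator `t i` of degree `2`. -/
def t (R : Type) [CommRing R] (K : SimplicialComplexOn m) (i : Fin m) : K.ARing R := K.srVar R i ⊗ₜ 1

/-- The antiderivation of the exterior algebra sending the `i`-th generator to `1` and all others to `0`. -/
def extContract (R : Type) [CommRing R] (i : Fin m) :
    ExteriorAlgebra R (Fin m → R) →ₗ[R] ExteriorAlgebra R (Fin m → R) :=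
  CliffordAlgebra.contractLeft (LinearMap.proj i)

/-- The differential of `A(K)`: the `R[K]`-linear antiderivation with `d (s i) = t i` and `d (t i) = 0`. -/
def dA (R : Type) [CommRing R] (K : SimplicialComplexOn m) : K.ARing R →ₗ[R] K.ARing R :=
  ∑ i : Fin m, TensorProduct.map (LinearMap.mulLeft R (K.srVar R i)) (extContract R i)

theorem dA_tmul (R : Type) [CommRing R] (K : SimplicialComplexOn m) (f : K.StanleyReisnerRing R)
    (w : ExteriorAlgebra R (Fin m → R)) :
    K.dA R (f ⊗ₜ w) = ∑ i, (K.srVar R i * f) ⊗ₜ extContract R i w := by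
  simp [dA, LinearMap.sum_apply]

theorem extContract_one (i : Fin m) : extContract R i 1 = 0 := by
  exact CliffordAlgebra.contractLeft_one (R := R) (Q := (0 : QuadraticForm R (Fin m → R))) _

theorem extContract_ι (i : Fin m) (x : Fin m → R) :
    extContract R i (ExteriorAlgebra.ι R x) = algebraMap R _ (x i) :=
  CliffordAlgebra.contractLeft_ι _ _ _

theorem extContract_ι_mul (i : Fin m) (x : Fin m → R) (w : ExteriorAlgebra R (Fin m → R)) :
    extContract R i (ExteriorAlgebra.ι R x * w) = x i • w - ExteriorAlgebra.ι R x * extContract R i w := by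
  exact CliffordAlgebra.contractLeft_ι_mul (R := R) (Q := (0 : QuadraticForm R (Fin m → R))) _ _ _

/-- The sign involution of the exterior algebra. -/
def extInv (R : Type) [CommRing R] : ExteriorAlgebra R (Fin m → R) →ₐ[R] ExteriorAlgebra R (Fin m → R) :=
  CliffordAlgebra.involute

theorem extInv_ι (x : Fin m → R) : extInv R (ExteriorAlgebra.ι R x) = - ExteriorAlgebra.ι R x :=
  CliffordAlgebra.involute_ι _

theorem extContract_mul (i : Fin m) (v w : ExteriorAlgebra R (Fin m → R)) :
    extContract R i (v * w) = extContract R i v * w + extInv R v * extContract R i w := by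
  induction v using CliffordAlgebra.left_induction with
  | algebraMap r =>
    change CliffordAlgebra.contractLeft _ _ = CliffordAlgebra.contractLeft _ _ * _ + _
    rw [CliffordAlgebra.contractLeft_algebraMap_mul, CliffordAlgebra.contractLeft_algebraMap,
      zero_mul, zero_add, AlgHom.commutes]
    rfl
  | add x y hx hy => rw [add_mul, map_add, hx, hy, map_add, map_add, add_mul, add_mul]; abel
  | ι_mul x v hx =>
    change extContract R i (ExteriorAlgebra.ι R v * x * w) =
      extContract R i (ExteriorAlgebra.ι R v * x) * w +
        extInv R (ExteriorAlgebra.ι R v * x) * extContract R i w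
    rw [mul_assoc, extContract_ι_mul, extContract_ι_mul, hx, map_mul, extInv_ι, mul_add, sub_mul,
      smul_mul_assoc, neg_mul, neg_mul, mul_assoc, mul_assoc]
    abel

theorem extContract_mem (i : Fin m) (n : ℕ) {w : ExteriorAlgebra R (Fin m → R)}
    (hw : w ∈ ⋀[R]^(n + 1) (Fin m → R)) : extContract R i w ∈ ⋀[R]^n (Fin m → R) := by
  induction n generalizing w with
  | zero =>
    simp only [ExteriorAlgebra.exteriorPower, zero_add, pow_one, pow_zero] at hw ⊢
    obtain ⟨x, rfl⟩ := hw
    rw [extContract_ι]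
    exact Submodule.algebraMap_mem _
  | succ n ih =>
    rw [ExteriorAlgebra.exteriorPower, pow_succ'] at hw
    induction hw using Submodule.mul_induction_on' with
    | mem_mul_mem x hx y hy =>
      obtain ⟨x, rfl⟩ := hx
      rw [extContract_ι_mul]
      refine Submodule.sub_mem _ (Submodule.smul_mem _ _ hy) ?_
      rw [ExteriorAlgebra.exteriorPower, pow_succ']
      exact Submodule.mul_mem_mul ⟨x, rfl⟩ (ih hy)
    | add x _ y _ hx hy => rw [map_add]; exact Submodule.add_mem _ hx hy

theorem extContract_mem_zero (i : Fin m) {w : ExteriorAlgebra R (Fin m → R)}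
    (hw : w ∈ ⋀[R]^0 (Fin m → R)) : extContract R i w = 0 := by
  simp only [ExteriorAlgebra.exteriorPower, pow_zero] at hw
  obtain ⟨r, rfl⟩ := Submodule.mem_one.1 hw
  exact CliffordAlgebra.contractLeft_algebraMap (0 : QuadraticForm R (Fin m → R)) _ _

theorem extInv_mem (n : ℕ) {w : ExteriorAlgebra R (Fin m → R)}
    (hw : w ∈ ⋀[R]^n (Fin m → R)) : extInv R w = (-1 : R) ^ n • w := by
  induction n generalizing w with
  | zero =>
    simp only [ExteriorAlgebra.exteriorPower, pow_zero] at hw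
    obtain ⟨r, rfl⟩ := Submodule.mem_one.1 hw
    rw [AlgHom.commutes, pow_zero, one_smul]
  | succ n ih =>
    rw [ExteriorAlgebra.exteriorPower, pow_succ'] at hw
    induction hw using Submodule.mul_induction_on' with
    | mem_mul_mem x hx y hy =>
      obtain ⟨x, rfl⟩ := hx
      rw [map_mul, ih hy, extInv_ι, pow_succ]
      simp
    | add x _ y _ hx hy => rw [map_add, hx, hy, smul_add]

/-- The sign involution of `A(K)`. -/
def AInv (R : Type) [CommRing R] (K : SimplicialComplexOn m) : K.ARing R →ₐ[R] K.ARing R :=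
  Algebra.TensorProduct.map (AlgHom.id R _) (extInv R)

theorem dA_mul' (R : Type) [CommRing R] (K : SimplicialComplexOn m) (a b : K.ARing R) :
    K.dA R (a * b) = K.dA R a * b + K.AInv R a * K.dA R b := by
  induction a using TensorProduct.induction_on with
  | zero => simp
  | add x y hx hy => rw [add_mul, map_add, hx, hy, map_add, map_add, add_mul, add_mul]; abel
  | tmul f v =>
    induction b using TensorProduct.induction_on with
    | zero => simp
    | add x y hx hy => rw [mul_add, map_add, hx, hy, map_add, mul_add, mul_add]; abel
    | tmul g w =>
      rw [Algebra.TensorProduct.tmul_mul_tmul, dA_tmul, dA_tmul, dA_tmul, AInv,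
        Algebra.TensorProduct.map_tmul, Finset.sum_mul, Finset.mul_sum, ← Finset.sum_add_distrib]
      refine Finset.sum_congr rfl fun i _ => ?_
      rw [extContract_mul, TensorProduct.tmul_add, Algebra.TensorProduct.tmul_mul_tmul,
        Algebra.TensorProduct.tmul_mul_tmul, mul_assoc, AlgHom.id_apply, mul_left_comm f]

theorem dA_dA (R : Type) [CommRing R] (K : SimplicialComplexOn m) (a : K.ARing R) : K.dA R (K.dA R a) = 0 := by
  induction a using TensorProduct.induction_on with
  | zero => simp
  | add x y hx hy => rw [map_add, map_add, hx, hy, add_zero]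
  | tmul f w =>
    simp only [dA_tmul, map_sum]
    rw [← Finset.sum_product']
    have hc : ∀ i j : Fin m, extContract R i (extContract R j w) = - extContract R j (extContract R i w) :=
      fun i j => CliffordAlgebra.contractLeft_comm _ _ _
    refine Finset.sum_involution (fun p _ => (p.2, p.1)) ?_ ?_ ?_ ?_
    · rintro ⟨i, j⟩ -
      simp only
      rw [hc i j, TensorProduct.tmul_neg, mul_left_comm, add_comm]
      exact neg_add_cancel (_ : K.ARing R)
    · rintro ⟨i, j⟩ - hne heq
      apply hne
      simp only [Prod.mk.injEq] at heq
      obtain rfl := heq.1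
      simp only
      rw [show extContract R j (extContract R j w) = 0 from
        CliffordAlgebra.contractLeft_contractLeft _ _, TensorProduct.tmul_zero]
    · simp
    · simp

theorem dA_s (R : Type) [CommRing R] (K : SimplicialComplexOn m) (i : Fin m) : K.dA R (K.s R i) = K.t R i := by
  rw [s, dA_tmul, Finset.sum_eq_single i]
  · simp [extContract_ι, t]
  · intro j _ hj
    simp [extContract_ι, Pi.single_eq_of_ne hj]
  · simp

theorem dA_t (R : Type) [CommRing R] (K : SimplicialComplexOn m) (i : Fin m) : K.dA R (K.t R i) = 0 := by
  rw [t, dA_tmul]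
  simp [extContract_one]

/-- The elements of the Stanley-Reisner ring of polynomial degree `k` (hence of degree `2 * k`). -/
def gradeSR (R : Type) [CommRing R] (K : SimplicialComplexOn m) (k : ℕ) : Submodule R (K.StanleyReisnerRing R) :=
  (MvPolynomial.homogeneousSubmodule (Fin m) R k).map
    (K.srMk R).toLinearMap

/-- The elements of `A(K)` of degree `n`, where the `t i` have degree `2` and the `s i` degree `1`. -/
def gradeA (R : Type) [CommRing R] (K : SimplicialComplexOn m) (n : ℕ) : Submodule R (K.ARing R) :=
  Submodule.span R {a | ∃ k j : ℕ, 2 * k + j = n ∧ ∃ f ∈ K.gradeSR R k,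
    ∃ w ∈ ⋀[R]^j (Fin m → R), a = f ⊗ₜ w}

theorem gradeSR_mul {K : SimplicialComplexOn m} {k l : ℕ} {f g : K.StanleyReisnerRing R}
    (hf : f ∈ K.gradeSR R k) (hg : g ∈ K.gradeSR R l) : f * g ∈ K.gradeSR R (k + l) := by
  obtain ⟨f, hf, rfl⟩ := hf
  obtain ⟨g, hg, rfl⟩ := hg
  exact ⟨f * g, MvPolynomial.IsHomogeneous.mul hf hg, map_mul (K.srMk R) _ _⟩

theorem srVar_mem (R : Type) [CommRing R] (K : SimplicialComplexOn m) (i : Fin m) : K.srVar R i ∈ K.gradeSR R 1 :=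
  ⟨_, MvPolynomial.isHomogeneous_X _ _, rfl⟩

theorem one_mem_gradeA (R : Type) [CommRing R] (K : SimplicialComplexOn m) : (1 : K.ARing R) ∈ K.gradeA R 0 :=
  Submodule.subset_span ⟨0, 0, rfl, 1, ⟨1, MvPolynomial.isHomogeneous_one _ _, map_one (K.srMk R)⟩, 1,
    SetLike.GradedOne.one_mem (A := fun i : ℕ => ⋀[R]^i (Fin m → R)), rfl⟩

theorem mul_mem_gradeA {K : SimplicialComplexOn m} {p q : ℕ} {a b : K.ARing R}
    (ha : a ∈ K.gradeA R p) (hb : b ∈ K.gradeA R q) : a * b ∈ K.gradeA R (p + q) := by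
  have := Submodule.mul_mem_mul ha hb
  rw [gradeA, gradeA, Submodule.span_mul_span] at this
  refine Submodule.span_le.2 ?_ this
  rintro _ ⟨_, ⟨k, j, rfl, f, hf, v, hv, rfl⟩, _, ⟨k', j', rfl, g, hg, w, hw, rfl⟩, rfl⟩
  refine Submodule.subset_span ⟨k + k', j + j', by ring, f * g, gradeSR_mul hf hg, v * w,
    SetLike.GradedMul.mul_mem (A := fun i : ℕ => ⋀[R]^i (Fin m → R)) hv hw, ?_⟩
  exact Algebra.TensorProduct.tmul_mul_tmul _ _ _ _

theorem dA_mem {K : SimplicialComplexOn m} {n : ℕ} {a : K.ARing R} (ha : a ∈ K.gradeA R n) :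
    K.dA R a ∈ K.gradeA R (n + 1) := by
  suffices K.gradeA R n ≤ (K.gradeA R (n + 1)).comap (K.dA R) from this ha
  refine Submodule.span_le.2 ?_
  rintro _ ⟨k, j, rfl, f, hf, w, hw, rfl⟩
  rw [SetLike.mem_coe, Submodule.mem_comap, dA_tmul]
  refine Submodule.sum_mem _ fun i _ => ?_
  obtain _ | j := j
  · rw [extContract_mem_zero i hw, TensorProduct.tmul_zero]; exact Submodule.zero_mem _
  · exact Submodule.subset_span ⟨1 + k, j, by ring, _, gradeSR_mul (srVar_mem R K i) hf, _,
      extContract_mem i j hw, rfl⟩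

theorem AInv_mem {K : SimplicialComplexOn m} {n : ℕ} {a : K.ARing R} (ha : a ∈ K.gradeA R n) :
    K.AInv R a = (-1 : R) ^ n • a := by
  suffices K.gradeA R n ≤ LinearMap.eqLocus (K.AInv R).toLinearMap (LinearMap.lsmul R _ ((-1 : R) ^ n)) from
    this ha
  refine Submodule.span_le.2 ?_
  rintro _ ⟨k, j, rfl, f, hf, w, hw, rfl⟩
  change K.AInv R (f ⊗ₜ w) = (-1 : R) ^ (2 * k + j) • (f ⊗ₜ w)
  rw [AInv, Algebra.TensorProduct.map_tmul, extInv_mem j hw, pow_add, pow_mul, neg_one_sq, one_pow,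
    one_mul, TensorProduct.tmul_smul]
  rfl

theorem dA_mul {K : SimplicialComplexOn m} {p : ℕ} {a : K.ARing R} (ha : a ∈ K.gradeA R p)
    (b : K.ARing R) : K.dA R (a * b) = K.dA R a * b + (-1 : R) ^ p • (a * K.dA R b) := by
  rw [dA_mul', AInv_mem ha, smul_mul_assoc]

/-- The two-sided ideal of `A(K)` generated by all `(t i) ^ 2` and all `s i * t i`. -/
def idealB (R : Type) [CommRing R] (K : SimplicialComplexOn m) : Ideal (K.ARing R) :=
  (TwoSidedIdeal.span {a | ∃ i, a = K.t R i * K.t R i ∨ a = K.s R i * K.t R i}).asIdeal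

instance (K : SimplicialComplexOn m) : (K.idealB R).IsTwoSided :=
  inferInstanceAs (TwoSidedIdeal.asIdeal _).IsTwoSided

/-- The algebra underlying `B(K)`. -/
abbrev BRing (R : Type) [CommRing R] (K : SimplicialComplexOn m) : Type := (K.ARing R) ⧸ (K.idealB R)

theorem AInv_s (R : Type) [CommRing R] (K : SimplicialComplexOn m) (i : Fin m) : K.AInv R (K.s R i) = - K.s R i := by
  rw [s, AInv, Algebra.TensorProduct.map_tmul, extInv_ι, TensorProduct.tmul_neg]; rfl
theorem AInv_t (R : Type) [CommRing R] (K : SimplicialComplexOn m) (i : Fin m) : K.AInv R (K.t R i) = K.t R i := by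
  rw [t, AInv, Algebra.TensorProduct.map_tmul, map_one]; rfl

theorem AInv_dA_mem_idealB {K : SimplicialComplexOn m} {a : K.ARing R} (ha : a ∈ K.idealB R) :
    K.AInv R a ∈ K.idealB R ∧ K.dA R a ∈ K.idealB R := by
  rw [idealB, TwoSidedIdeal.mem_asIdeal] at ha
  induction ha using TwoSidedIdeal.span_induction with
  | mem x hx =>
    have hx' : x ∈ K.idealB R := TwoSidedIdeal.mem_asIdeal.2 (TwoSidedIdeal.subset_span hx)
    obtain ⟨i, rfl | rfl⟩ := hx
    · simp only [map_mul, AInv_t, dA_mul', dA_t]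
      exact ⟨hx', by simp⟩
    · have ht : K.t R i * K.t R i ∈ K.idealB R :=
        TwoSidedIdeal.mem_asIdeal.2 (TwoSidedIdeal.subset_span ⟨i, Or.inl rfl⟩)
      simp only [map_mul, AInv_t, AInv_s, dA_mul', dA_t, dA_s]
      exact ⟨by simpa using hx', by simpa using ht⟩
  | zero => simp
  | add x y hx hy h1 h2 =>
    rw [map_add, map_add]
    exact ⟨add_mem h1.1 h2.1, add_mem h1.2 h2.2⟩
  | neg x hx h =>
    rw [map_neg, map_neg]
    exact ⟨neg_mem h.1, neg_mem h.2⟩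
  | left_absorb a x hx h =>
    have hx' : x ∈ K.idealB R := TwoSidedIdeal.mem_asIdeal.2 hx
    rw [map_mul, dA_mul']
    exact ⟨Ideal.mul_mem_left _ _ h.1,
      add_mem (Ideal.mul_mem_left _ _ hx') (Ideal.mul_mem_left _ _ h.2)⟩
  | right_absorb a x hx h =>
    rw [map_mul, dA_mul']
    exact ⟨Ideal.mul_mem_right _ _ h.1,
      add_mem (Ideal.mul_mem_right _ _ h.2) (Ideal.mul_mem_right _ _ h.1)⟩

/-- The differential of `B(K)`, induced from that of `A(K)`. -/
def dB (R : Type) [CommRing R] (K : SimplicialComplexOn m) : K.BRing R →ₗ[R] K.BRing R where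
  toFun := QuotientAddGroup.map (K.idealB R).toAddSubgroup (K.idealB R).toAddSubgroup
    (K.dA R).toAddMonoidHom fun _ ha => (AInv_dA_mem_idealB ha).2
  map_add' := map_add _
  map_smul' r x := by
    obtain ⟨a, rfl⟩ := Ideal.Quotient.mk_surjective x
    exact congrArg (Ideal.Quotient.mk (K.idealB R)) (map_smul (K.dA R) r a)

theorem dB_mk (R : Type) [CommRing R] (K : SimplicialComplexOn m) (a : K.ARing R) :
    K.dB R (Ideal.Quotient.mk _ a) = Ideal.Quotient.mk _ (K.dA R a) := rfl

/-- The projection `A(K) → B(K)`. -/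
def bMk (R : Type) [CommRing R] (K : SimplicialComplexOn m) : K.ARing R →ₐ[R] K.BRing R :=
  Ideal.Quotient.mkₐ R (K.idealB R)

/-- The elements of `B(K)` of degree `n`. -/
def gradeB (R : Type) [CommRing R] (K : SimplicialComplexOn m) (n : ℕ) :
    Submodule R (K.BRing R) :=
  (K.gradeA R n).map (K.bMk R).toLinearMap


/-- The restriction `R[K] → R[L]` to a subcomplex, sending each variable to itself. -/
def srRestrict (R : Type) [CommRing R] {K L : SimplicialComplexOn m} (h : L ≤ K) :
    K.StanleyReisnerRing R →ₐ[R] L.StanleyReisnerRing R :=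
  Ideal.Quotient.factorₐ R (stanleyReisnerIdeal_anti h)

theorem srRestrict_mk {K L : SimplicialComplexOn m} (h : L ≤ K) (f : MvPolynomial (Fin m) R) :
    srRestrict R h (K.srMk R f) = L.srMk R f := rfl

theorem srMk_surjective (K : SimplicialComplexOn m) : Function.Surjective (K.srMk R) :=
  Ideal.Quotient.mk_surjective

/-- The restriction `A(K) → A(L)` to a subcomplex, sending each `s i` and each `t i` to itself. -/
def aRestrict (R : Type) [CommRing R] {K L : SimplicialComplexOn m} (h : L ≤ K) :
    K.ARing R →ₐ[R] L.ARing R :=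
  Algebra.TensorProduct.map (srRestrict R h) (AlgHom.id R _)

theorem aRestrict_tmul {K L : SimplicialComplexOn m} (h : L ≤ K) (f : K.StanleyReisnerRing R)
    (w : ExteriorAlgebra R (Fin m → R)) : aRestrict R h (f ⊗ₜ w) = srRestrict R h f ⊗ₜ w := rfl

theorem aRestrict_s {K L : SimplicialComplexOn m} (h : L ≤ K) (i : Fin m) :
    aRestrict R h (K.s R i) = L.s R i := by
  rw [s, aRestrict_tmul, map_one]; rfl

theorem aRestrict_t {K L : SimplicialComplexOn m} (h : L ≤ K) (i : Fin m) :
    aRestrict R h (K.t R i) = L.t R i := rfl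

theorem aRestrict_mem {K L : SimplicialComplexOn m} (h : L ≤ K) {n : ℕ} {a : K.ARing R}
    (ha : a ∈ K.gradeA R n) : aRestrict R h a ∈ L.gradeA R n := by
  suffices K.gradeA R n ≤ (L.gradeA R n).comap (aRestrict R h).toLinearMap from this ha
  refine Submodule.span_le.2 ?_
  rintro _ ⟨k, j, rfl, _, ⟨f, hf, rfl⟩, w, hw, rfl⟩
  rw [SetLike.mem_coe, Submodule.mem_comap, AlgHom.toLinearMap_apply, AlgHom.toLinearMap_apply,
    aRestrict_tmul, srRestrict_mk]
  exact Submodule.subset_span ⟨k, j, rfl, L.srMk R f, ⟨f, hf, rfl⟩, w, hw, rfl⟩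

theorem aRestrict_dA {K L : SimplicialComplexOn m} (h : L ≤ K) (a : K.ARing R) :
    aRestrict R h (K.dA R a) = L.dA R (aRestrict R h a) := by
  induction a using TensorProduct.induction_on with
  | zero => simp
  | add x y hx hy => simp only [map_add, hx, hy]
  | tmul f w =>
    rw [dA_tmul, map_sum, aRestrict_tmul, dA_tmul]
    refine Finset.sum_congr rfl fun i _ => ?_
    rw [aRestrict_tmul, map_mul]
    rfl

theorem aRestrict_id (K : SimplicialComplexOn m) (a : K.ARing R) :
    aRestrict R (le_refl K) a = a := by
  induction a using TensorProduct.induction_on with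
  | zero => simp
  | add x y hx hy => rw [map_add, hx, hy]
  | tmul f w =>
    obtain ⟨f, rfl⟩ := K.srMk_surjective f
    rw [aRestrict_tmul, srRestrict_mk]

theorem aRestrict_comp {K L M : SimplicialComplexOn m} (h : L ≤ K) (h' : M ≤ L) (a : K.ARing R) :
    aRestrict R h' (aRestrict R h a) = aRestrict R (h'.trans h) a := by
  induction a using TensorProduct.induction_on with
  | zero => simp
  | add x y hx hy => simp only [map_add, hx, hy]
  | tmul f w =>
    obtain ⟨f, rfl⟩ := K.srMk_surjective f
    rw [aRestrict_tmul, aRestrict_tmul, aRestrict_tmul, srRestrict_mk, srRestrict_mk, srRestrict_mk]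

theorem aRestrict_mem_idealB {K L : SimplicialComplexOn m} (h : L ≤ K) {a : K.ARing R}
    (ha : a ∈ K.idealB R) : aRestrict R h a ∈ L.idealB R := by
  rw [idealB, TwoSidedIdeal.mem_asIdeal] at ha ⊢
  induction ha using TwoSidedIdeal.span_induction with
  | mem x hx =>
    obtain ⟨i, rfl | rfl⟩ := hx
    · rw [map_mul, aRestrict_t]
      exact TwoSidedIdeal.subset_span ⟨i, Or.inl rfl⟩
    · rw [map_mul, aRestrict_t, aRestrict_s]
      exact TwoSidedIdeal.subset_span ⟨i, Or.inr rfl⟩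
  | zero => rw [map_zero]; exact TwoSidedIdeal.zero_mem _
  | add x y hx hy h1 h2 => rw [map_add]; exact TwoSidedIdeal.add_mem _ h1 h2
  | neg x hx h => rw [map_neg]; exact TwoSidedIdeal.neg_mem _ h
  | left_absorb a x hx h => rw [map_mul]; exact TwoSidedIdeal.mul_mem_left _ _ _ h
  | right_absorb a x hx h => rw [map_mul]; exact TwoSidedIdeal.mul_mem_right _ _ _ h

/-- The restriction `B(K) → B(L)` to a subcomplex. -/
def bRestrict (R : Type) [CommRing R] {K L : SimplicialComplexOn m} (h : L ≤ K) :
    K.BRing R →ₐ[R] L.BRing R :=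
  { Ideal.quotientMap (L.idealB R) (aRestrict R h).toRingHom
      (fun _ ha => aRestrict_mem_idealB h ha) with
    commutes' := fun r => congrArg (L.bMk R) ((aRestrict R h).commutes r) }

theorem bRestrict_mk {K L : SimplicialComplexOn m} (h : L ≤ K) (a : K.ARing R) :
    bRestrict R h (K.bMk R a) = L.bMk R (aRestrict R h a) := rfl

theorem bMk_surjective (K : SimplicialComplexOn m) : Function.Surjective (K.bMk R) :=
  Ideal.Quotient.mk_surjective

/-- The cdga `A(K)`. -/
def dgaA (R : Type) [CommRing R] (K : SimplicialComplexOn m) : DGA R :=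
  DGA.ofRing (K.gradeA R) (K.dA R) (one_mem_gradeA R K) mul_mem_gradeA dA_mem (dA_dA R K) dA_mul

/-- The cdga `B(K)`. -/
def dgaB (R : Type) [CommRing R] (K : SimplicialComplexOn m) : DGA R :=
  DGA.ofRing (K.gradeB R) (K.dB R) ⟨1, one_mem_gradeA R K, map_one (K.bMk R)⟩
    (by
      rintro p q _ _ ⟨a, ha, rfl⟩ ⟨b, hb, rfl⟩
      exact ⟨a * b, mul_mem_gradeA ha hb, map_mul (K.bMk R) a b⟩)
    (by
      rintro n _ ⟨a, ha, rfl⟩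
      exact ⟨K.dA R a, dA_mem ha, rfl⟩)
    (by
      intro x
      obtain ⟨a, rfl⟩ := K.bMk_surjective x
      exact (congrArg (K.bMk R) (dA_dA R K a)).trans (map_zero _))
    (by
      rintro p _ ⟨a, ha, rfl⟩ y
      obtain ⟨b, rfl⟩ := K.bMk_surjective y
      refine (congrArg (K.bMk R) (dA_mul ha b)).trans ?_
      rw [map_add, map_smul, map_mul (K.bMk R), map_mul (K.bMk R)]
      rfl)

/-- The cdga `A(K)` as a contravariant functor with respect to inclusions of subcomplexes. -/
def functorA (R : Type) [CommRing R] (m : ℕ) : (SimplicialComplexOn m)ᵒᵖ ⥤ DGA R where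
  obj K := dgaA R K.unop
  map f := DGA.ofRingHom (aRestrict R (leOfHom f.unop)) (aRestrict_mem _) (aRestrict_dA _)
  map_id K := DGA.hom_ext fun n a => Subtype.ext (aRestrict_id _ _)
  map_comp f g := DGA.hom_ext fun n a => Subtype.ext (aRestrict_comp _ _ _).symm

/-- The cdga `B(K)` as a contravariant functor with respect to inclusions of subcomplexes. -/
def functorB (R : Type) [CommRing R] (m : ℕ) : (SimplicialComplexOn m)ᵒᵖ ⥤ DGA R where
  obj K := dgaB R K.unop
  map f := DGA.ofRingHom (bRestrict R (leOfHom f.unop))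
    (by
      rintro n _ ⟨a, ha, rfl⟩
      exact ⟨_, aRestrict_mem (leOfHom f.unop) ha, rfl⟩)
    (by
      intro x
      obtain ⟨a, rfl⟩ := bMk_surjective _ x
      exact congrArg (bMk R _) (aRestrict_dA (leOfHom f.unop) a))
  map_id K := DGA.hom_ext fun n a => Subtype.ext (by
    obtain ⟨_, a, _, rfl⟩ := a
    exact congrArg (bMk R _) (aRestrict_id _ _))
  map_comp f g := DGA.hom_ext fun n a => Subtype.ext (by
    obtain ⟨_, a, _, rfl⟩ := a
    exact congrArg (bMk R _) (aRestrict_comp _ _ _).symm)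

/-- The moment-angle complex of `K`, a subspace of the `m`-th power of the closed unit disc. -/
def momentAngleComplex (K : SimplicialComplexOn m) : Set (Fin m → ℂ) :=
  ⋃ σ ∈ K.faces, {z | (∀ i, z i ∈ Metric.closedBall (0 : ℂ) 1) ∧
    ∀ i, i ∉ σ → z i ∈ Metric.sphere (0 : ℂ) 1}

theorem momentAngleComplex_mono {K L : SimplicialComplexOn m} (h : K ≤ L) :
    K.momentAngleComplex ⊆ L.momentAngleComplex :=
  Set.biUnion_subset_biUnion_left h

/-- The moment-angle complex as a functor: inclusions of subcomplexes give inclusions of spaces. -/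
def momentAngleFunctor (m : ℕ) : SimplicialComplexOn m ⥤ TopCat.{0} where
  obj K := TopCat.of K.momentAngleComplex
  map f := TopCat.ofHom ⟨Set.inclusion (momentAngleComplex_mono (leOfHom f)),
    continuous_inclusion _⟩
  map_id _ := rfl
  map_comp _ _ := rfl

/-- The normalized singular cochain algebra of the moment-angle complex of `K`, as a contravariant
functor with respect to inclusions of subcomplexes. -/
def functorCochains (R : Type) [CommRing R] (m : ℕ) : (SimplicialComplexOn m)ᵒᵖ ⥤ DGA R :=
  (momentAngleFunctor m ⋙ TopCat.toSSet).op ⋙ SingularCochains.functor R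

end

end SimplicialComplexOn

/-!
Write `K` for the simplicial complex. The quasi-isomorphisms form the zigzag

  `C*(Z(K)) → C*(small simplices of Z(K)) → B(K) ← A(K)`,

where a singular simplex is small if it lies in one of the polydiscs whose union is `Z(K)`.

*Small simplices.* The polydiscs are closed, so the theorem of small simplices does not apply to them
directly. A radial deformation thickens each polydisc to a set containing an open neighbourhood of it in
`Z(K)`, without changing the small cochains up to homotopy, and for the thickened sets barycentric
subdivision applies (`inducesIso_smallIncl`, `restrictToSmall_isQuasiIso`).

*The comparison map* (`comparison`, natural by `comparisonNat`) evaluates a small cochain on explicit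
singular simplices attached to words in the letters `1, …, m`. The `n`-simplex is parametrized by its
`n` partial sums of barycentric coordinates, one for each position in the word. A letter that occurs once
winds its coordinate around the circle and stands for `s i`; a letter that occurs twice maps a triangle
onto the disc and stands for `t i`. The values are the coefficients of a sum of monomials of `B(K)`, and
words with a letter occurring three times do not contribute. On an inner face two neighbouring partial
sums agree, so that the faces of a word and of the word with these two letters exchanged cancel, while two
equal neighbouring letters give a degenerate simplex (`sum_value_d`). The two outer faces amount to
multiplication by `s j + t j * ∂ / ∂ s j` and by `s j`; their difference `t j * ∂ / ∂ s j`, summed over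
`j`, is the differential (`wordSum_d`). Front and back faces of a word simplex are the word simplices of
the two parts of the word, which makes the map multiplicative on the nose (`wordSum_mul`).

*It is a quasi-isomorphism.* Both sides satisfy Mayer-Vietoris, because a simplex which is small for a
union of subcomplexes is small for one of them (`small_isMayerVietoris`, `functorB_isMayerVietoris`).
Removing a maximal face reduces everything to a full simplex `σ` (`comparison_inducesIso`), for which
`Z(σ)` is a product of discs and circles. There it is shown that cocycles are classified by their periods,
their values on the word simplices as an element of the exterior algebra. The circle factors are unwrapped
one at a time: the cochains on the quotient by the translation group `ℤ` are the invariant cochains on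
the covering, and the difference operator of the translation is surjective. The resulting exact sequence,
together with a formula for its connecting map (`period_d_wrapPull`), shows that a cocycle without periods
is a coboundary (`isCoboundary_of_period_eq_zero`) and provides a cocycle for each circle
(`exists_cocycle_period`), whose products realize the exterior algebra on the generators outside `σ`. On
the algebraic side this is the cohomology of `B(σ)` (`isCoboundary_of_extKill_augB`).

*From `A` to `B`.* The homotopy `t i ^ (l + 1) ↦ t i ^ l * s i` for `l ≥ 1` connects the identity of `A(K)`
to a projection that kills all multiples of `t i ^ 2` and `s i * t i`; composing over all `i` gives a
chain map `A(K) → A(K)` that factors through a section of `A(K) → B(K)`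
(`exists_truncList_homotopy`, `projAB_isQuasiIso`). Only monomials divisible by `t i ^ 2` are divided by
`t i`, so supports do not change and the homotopy is defined on the Stanley-Reisner ring of any complex.
-/

/-! ### Quasi-isomorphisms in terms of elements -/

section Elements

variable {R : Type} [CommRing R] {K L : CochainComplex (ModuleCat.{0} R) ℕ}

/-- `a` is a coboundary. In degree `0` this means `a = 0`, since then `K.d i 0 = 0` for all `i`. -/
def IsCoboundary (K : CochainComplex (ModuleCat.{0} R) ℕ) (n : ℕ) (a : K.X n) : Prop :=
  ∃ (i : ℕ) (c : K.X i), K.d i n c = a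

theorem isCoboundary_zero (n : ℕ) : IsCoboundary K n 0 := ⟨n, 0, map_zero _⟩

theorem isCoboundary_d {i n : ℕ} (c : K.X i) : IsCoboundary K n (K.d i n c) := ⟨i, c, rfl⟩

theorem isCoboundary_degree_zero {a : K.X 0} (h : IsCoboundary K 0 a) : a = 0 := by
  obtain ⟨i, c, rfl⟩ := h
  rw [K.shape _ _ (by simp)]
  rfl

theorem isCoboundary_succ {n : ℕ} {a : K.X (n + 1)} (h : IsCoboundary K (n + 1) a) :
    ∃ c : K.X n, K.d n (n + 1) c = a := by
  obtain ⟨i, c, rfl⟩ := h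
  by_cases hi : i = n
  · subst hi; exact ⟨c, rfl⟩
  · refine ⟨0, ?_⟩
    rw [K.shape i (n + 1) (by simpa using hi), map_zero]
    rfl

theorem IsCoboundary.add {n : ℕ} {a b : K.X n} (ha : IsCoboundary K n a)
    (hb : IsCoboundary K n b) : IsCoboundary K n (a + b) := by
  cases n with
  | zero => rw [isCoboundary_degree_zero ha, isCoboundary_degree_zero hb, add_zero]
            exact isCoboundary_zero 0
  | succ n =>
    obtain ⟨c, rfl⟩ := isCoboundary_succ ha
    obtain ⟨c', rfl⟩ := isCoboundary_succ hb
    exact ⟨n, c + c', map_add _ _ _⟩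

theorem IsCoboundary.neg {n : ℕ} {a : K.X n} (ha : IsCoboundary K n a) :
    IsCoboundary K n (-a) := by
  obtain ⟨i, c, rfl⟩ := ha
  exact ⟨i, -c, map_neg _ _⟩

theorem IsCoboundary.sub {n : ℕ} {a b : K.X n} (ha : IsCoboundary K n a)
    (hb : IsCoboundary K n b) : IsCoboundary K n (a - b) := by
  rw [sub_eq_add_neg]; exact ha.add hb.neg

theorem hom_d_apply (f : K ⟶ L) (i j : ℕ) (a : K.X i) :
    f.f j (K.d i j a) = L.d i j (f.f i a) := by
  rw [← ConcreteCategory.comp_apply, ← ConcreteCategory.comp_apply, f.comm]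

theorem d_d_apply (i j k : ℕ) (a : K.X i) : K.d j k (K.d i j a) = 0 := by
  rw [← ConcreteCategory.comp_apply, K.d_comp_d]
  rfl

theorem IsCoboundary.map {n : ℕ} {a : K.X n} (ha : IsCoboundary K n a) (f : K ⟶ L) :
    IsCoboundary L n (f.f n a) := by
  obtain ⟨i, c, rfl⟩ := ha
  exact ⟨i, f.f i c, (hom_d_apply f _ _ _).symm⟩

theorem IsCoboundary.d_eq_zero {n k : ℕ} {a : K.X n} (ha : IsCoboundary K n a) :
    K.d n k a = 0 := by
  obtain ⟨i, c, rfl⟩ := ha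
  exact d_d_apply _ _ _ _

/-- The elementwise form of a quasi-isomorphism of cochain complexes. -/
structure InducesIso (f : K ⟶ L) : Prop where
  inj : ∀ (n : ℕ) (a : K.X n), K.d n (n + 1) a = 0 → IsCoboundary L n (f.f n a) →
    IsCoboundary K n a
  surj : ∀ (n : ℕ) (b : L.X n), L.d n (n + 1) b = 0 →
    ∃ a : K.X n, K.d n (n + 1) a = 0 ∧ IsCoboundary L n (f.f n a - b)

theorem InducesIso.quasiIso {f : K ⟶ L} (h : InducesIso f) : QuasiIso f := by
  refine ⟨fun n => ?_⟩
  rw [quasiIsoAt_iff_isIso_homologyMap]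
  have hprev : ∀ (M : CochainComplex (ModuleCat.{0} R) ℕ) (a : M.X n), IsCoboundary M n a ↔
      ∃ c, M.d ((ComplexShape.up ℕ).prev n) n c = a := by
    intro M a
    refine ⟨fun ha => ?_, fun ⟨c, hc⟩ => ⟨_, c, hc⟩⟩
    cases n with
    | zero => exact ⟨0, by rw [map_zero, isCoboundary_degree_zero ha]⟩
    | succ n =>
      obtain ⟨c, rfl⟩ := isCoboundary_succ ha
      rw [show (ComplexShape.up ℕ).prev (n + 1) = n by simp]
      exact ⟨c, rfl⟩
  have hepi : ∀ A : ModuleCat.{0} R, Epi (ModuleCat.freeDesc (R := R) (M := A) (↾fun a : A => a)) := fun A =>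
    (ModuleCat.epi_iff_surjective _).2 fun a => ⟨ModuleCat.freeMk a, by simp⟩
  have : Mono (HomologicalComplex.homologyMap f n) := by
    rw [HomologicalComplex.mono_homologyMap_iff_up_to_refinements f _ n (n + 1) rfl (by simp)]
    intro A x hx y hy
    have key : ∀ a : A, ∃ c, K.d ((ComplexShape.up ℕ).prev n) n c = x a := fun a =>
      (hprev K _).1 (h.inj n _ (ConcreteCategory.congr_hom hx a)
        ⟨_, y a, (ConcreteCategory.congr_hom hy a).symm⟩)
    choose c hc using key
    refine ⟨_, _, hepi A, ModuleCat.freeDesc (↾c), ModuleCat.free_hom_ext fun a => ?_⟩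
    simp [hc]
  have : Epi (HomologicalComplex.homologyMap f n) := by
    rw [HomologicalComplex.epi_homologyMap_iff_up_to_refinements f _ n (n + 1) rfl (by simp)]
    intro A y hy
    have key : ∀ a : A, ∃ (b : K.X n) (c : L.X ((ComplexShape.up ℕ).prev n)),
        K.d n (n + 1) b = 0 ∧ y a = f.f n b + L.d _ n c := by
      intro a
      obtain ⟨b, hb, hc⟩ := h.surj n _ (ConcreteCategory.congr_hom hy a)
      obtain ⟨c, hc⟩ := (hprev L _).1 hc.neg
      exact ⟨b, c, hb, by rw [hc]; abel⟩
    choose b c hb hc using key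
    refine ⟨_, _, hepi A, ModuleCat.freeDesc (↾b), ModuleCat.free_hom_ext fun a => ?_,
      ModuleCat.freeDesc (↾c), ModuleCat.free_hom_ext fun a => ?_⟩
    · simp [hb]
    · simp [hc]
  exact isIso_of_mono_of_epi _

theorem InducesIso.comp {M : CochainComplex (ModuleCat.{0} R) ℕ} {f : K ⟶ L} {g : L ⟶ M}
    (hf : InducesIso f) (hg : InducesIso g) : InducesIso (f ≫ g) where
  inj n a ha h := hf.inj n a ha (hg.inj n _ (by rw [← hom_d_apply, ha, map_zero]) h)
  surj n b hb := by
    obtain ⟨a, ha, h⟩ := hg.surj n b hb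
    obtain ⟨a', ha', h'⟩ := hf.surj n a ha
    refine ⟨a', ha', ?_⟩
    have := (h'.map g).add h
    rw [map_sub] at this
    simpa using this

/-- A commutative square of cochain complexes that is degreewise a pull-back of modules and whose
right-hand map `s` is surjective; it has a Mayer-Vietoris sequence. -/
structure IsMayerVietoris {A B C D : CochainComplex (ModuleCat.{0} R) ℕ}
    (p : A ⟶ B) (q : A ⟶ C) (r : B ⟶ D) (s : C ⟶ D) : Prop where
  comm : p ≫ r = q ≫ s
  ext : ∀ (n : ℕ) (a : A.X n), p.f n a = 0 → q.f n a = 0 → a = 0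
  glue : ∀ (n : ℕ) (b : B.X n) (c : C.X n), r.f n b = s.f n c →
    ∃ a : A.X n, p.f n a = b ∧ q.f n a = c
  surj : ∀ n : ℕ, Function.Surjective (s.f n)

namespace IsMayerVietoris

variable {A B C D : CochainComplex (ModuleCat.{0} R) ℕ}
  {p : A ⟶ B} {q : A ⟶ C} {r : B ⟶ D} {s : C ⟶ D}

theorem comm_apply (h : IsMayerVietoris p q r s) (n : ℕ) (a : A.X n) :
    r.f n (p.f n a) = s.f n (q.f n a) := by
  have := HomologicalComplex.congr_hom h.comm n
  exact ConcreteCategory.congr_hom this a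

theorem ext' (h : IsMayerVietoris p q r s) {n : ℕ} {a a' : A.X n} (hp : p.f n a = p.f n a')
    (hq : q.f n a = q.f n a') : a = a' :=
  sub_eq_zero.1 (h.ext n _ (by rw [map_sub, hp, sub_self]) (by rw [map_sub, hq, sub_self]))

theorem lift_isCoboundary (h : IsMayerVietoris p q r s) {n : ℕ} {x : D.X n}
    (hx : IsCoboundary D n x) : ∃ c : C.X n, IsCoboundary C n c ∧ s.f n c = x := by
  obtain ⟨i, y, rfl⟩ := hx
  obtain ⟨z, rfl⟩ := h.surj i y
  exact ⟨_, isCoboundary_d z, hom_d_apply _ _ _ _⟩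

theorem isCoboundary_of_glue (h : IsMayerVietoris p q r s) {n : ℕ} {a : A.X (n + 1)} {b : B.X n}
    {c : C.X n} (hb : B.d n (n + 1) b = p.f _ a) (hc : C.d n (n + 1) c = q.f _ a)
    (hbc : r.f n b = s.f n c) : IsCoboundary A (n + 1) a := by
  obtain ⟨x, rfl, rfl⟩ := h.glue n b c hbc
  exact ⟨n, x, h.ext' (by rw [hom_d_apply, hb]) (by rw [hom_d_apply, hc])⟩

/-- The five lemma for the Mayer-Vietoris sequences of two squares. -/
theorem inducesIso {A' B' C' D' : CochainComplex (ModuleCat.{0} R) ℕ}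
    {p' : A' ⟶ B'} {q' : A' ⟶ C'} {r' : B' ⟶ D'} {s' : C' ⟶ D'}
    (h : IsMayerVietoris p q r s) (h' : IsMayerVietoris p' q' r' s')
    (α : A ⟶ A') (β : B ⟶ B') (γ : C ⟶ C') (δ : D ⟶ D')
    (hp : p ≫ β = α ≫ p') (hq : q ≫ γ = α ≫ q') (hr : r ≫ δ = β ≫ r') (hs : s ≫ δ = γ ≫ s')
    (hβ : InducesIso β) (hγ : InducesIso γ) (hδ : InducesIso δ) : InducesIso α := by
  have ep : ∀ n (a : A.X n), β.f n (p.f n a) = p'.f n (α.f n a) := fun n a =>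
    ConcreteCategory.congr_hom (HomologicalComplex.congr_hom hp n) a
  have eq : ∀ n (a : A.X n), γ.f n (q.f n a) = q'.f n (α.f n a) := fun n a =>
    ConcreteCategory.congr_hom (HomologicalComplex.congr_hom hq n) a
  have er : ∀ n (a : B.X n), δ.f n (r.f n a) = r'.f n (β.f n a) := fun n a =>
    ConcreteCategory.congr_hom (HomologicalComplex.congr_hom hr n) a
  have es : ∀ n (a : C.X n), δ.f n (s.f n a) = s'.f n (γ.f n a) := fun n a =>
    ConcreteCategory.congr_hom (HomologicalComplex.congr_hom hs n) a
  -- a primitive upstairs can be chosen compatibly with a given primitive downstairs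
  have lift : ∀ {X X' : CochainComplex (ModuleCat.{0} R) ℕ} {φ : X ⟶ X'} (_ : InducesIso φ)
      (n : ℕ) (x : X.X (n + 1)) (y : X'.X n), X.d (n + 1) (n + 2) x = 0 →
      X'.d n (n + 1) y = φ.f _ x →
      ∃ z : X.X n, X.d n (n + 1) z = x ∧ IsCoboundary X' n (φ.f n z - y) := by
    intro X X' φ hφ n x y hx hy
    obtain ⟨z, rfl⟩ := isCoboundary_succ (hφ.inj _ x hx ⟨n, y, hy⟩)
    obtain ⟨w, hw, hw'⟩ := hφ.surj n (φ.f n z - y) (by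
      rw [map_sub, hy, ← hom_d_apply, sub_self])
    refine ⟨z - w, by rw [map_sub, hw, sub_zero], ?_⟩
    have := hw'.neg
    rw [map_sub]
    convert this using 1
    abel
  constructor
  · intro n a ha hb
    cases n with
    | zero =>
      have hb := isCoboundary_degree_zero hb
      rw [h.ext 0 a]
      · exact isCoboundary_zero 0
      · refine isCoboundary_degree_zero (hβ.inj 0 _ (by rw [← hom_d_apply, ha, map_zero]) ?_)
        rw [ep, hb, map_zero]; exact isCoboundary_zero 0
      · refine isCoboundary_degree_zero (hγ.inj 0 _ (by rw [← hom_d_apply, ha, map_zero]) ?_)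
        rw [eq, hb, map_zero]; exact isCoboundary_zero 0
    | succ n =>
      obtain ⟨b, hb⟩ := isCoboundary_succ hb
      obtain ⟨y, hy, hy'⟩ := lift hβ n (p.f _ a) (p'.f _ b)
        (by rw [← hom_d_apply, ha, map_zero]) (by rw [← hom_d_apply, hb, ep])
      obtain ⟨z, hz, hz'⟩ := lift hγ n (q.f _ a) (q'.f _ b)
        (by rw [← hom_d_apply, ha, map_zero]) (by rw [← hom_d_apply, hb, eq])
      have hcyc : D.d n (n + 1) (r.f n y - s.f n z) = 0 := by
        rw [map_sub, ← hom_d_apply, ← hom_d_apply, hy, hz, h.comm_apply, sub_self]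
      have := hδ.inj n _ hcyc (by
        have := (hy'.map r').sub (hz'.map s')
        rw [map_sub, map_sub, ← er, ← es, h'.comm_apply] at this
        rw [map_sub]
        convert this using 1
        abel)
      obtain ⟨c, hc, hc'⟩ := h.lift_isCoboundary this
      exact h.isCoboundary_of_glue hy (c := z + c) (by rw [map_add, hc.d_eq_zero, add_zero, hz])
        (by rw [map_add, hc']; abel)
  · intro n b hb
    obtain ⟨y, hy, hy'⟩ := hβ.surj n (p'.f n b) (by rw [← hom_d_apply, hb, map_zero])
    obtain ⟨z, hz, hz'⟩ := hγ.surj n (q'.f n b) (by rw [← hom_d_apply, hb, map_zero])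
    have := hδ.inj n (r.f n y - s.f n z)
      (by rw [map_sub, ← hom_d_apply, ← hom_d_apply, hy, hz, map_zero, map_zero, sub_self]) (by
        have := (hy'.map r').sub (hz'.map s')
        rw [map_sub, map_sub, ← er, ← es, h'.comm_apply] at this
        rw [map_sub]
        convert this using 1
        abel)
    obtain ⟨c, hc, hc'⟩ := h.lift_isCoboundary this
    obtain ⟨a, ha, ha'⟩ := h.glue n y (z + c) (by rw [map_add, hc']; abel)
    have hda : A.d n (n + 1) a = 0 := h.ext _ _
      (by rw [hom_d_apply, ha, hy]) (by rw [hom_d_apply, ha', map_add, hz, hc.d_eq_zero, add_zero])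
    have hpa : IsCoboundary B' n (p'.f n (α.f n a - b)) := by rwa [map_sub, ← ep, ha]
    have hqa : IsCoboundary C' n (q'.f n (α.f n a - b)) := by
      rw [map_sub, ← eq, ha', map_add]
      convert hz'.add (hc.map γ) using 1
      abel
    cases n with
    | zero =>
      refine ⟨a, hda, ?_⟩
      rw [h'.ext _ _ (isCoboundary_degree_zero hpa) (isCoboundary_degree_zero hqa)]
      exact isCoboundary_zero 0
    | succ n =>
      obtain ⟨e, he⟩ := isCoboundary_succ hpa
      obtain ⟨e', he'⟩ := isCoboundary_succ hqa
      obtain ⟨f, hf, hf'⟩ := hδ.surj n (r'.f n e - s'.f n e') (by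
        rw [map_sub, ← hom_d_apply, ← hom_d_apply, he, he', h'.comm_apply, sub_self])
      obtain ⟨g, rfl⟩ := h.surj n f
      obtain ⟨k, hk, hk'⟩ := h'.lift_isCoboundary hf'
      obtain ⟨a₀, ha₀, ha₀'⟩ := h.glue (n + 1) 0 (C.d n (n + 1) g)
        (by rw [map_zero, hom_d_apply, hf])
      refine ⟨a + a₀, ?_, h'.isCoboundary_of_glue (b := e) (c := e' + γ.f n g - k) ?_ ?_ ?_⟩
      · rw [map_add, hda, zero_add]
        exact h.ext _ _ (by rw [hom_d_apply, ha₀, map_zero])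
          (by rw [hom_d_apply, ha₀', d_d_apply])
      · rw [he, map_add, add_sub_right_comm, map_add, ← ep _ a₀, ha₀, map_zero, add_zero]
      · rw [map_sub, map_add, he', hk.d_eq_zero, sub_zero, ← hom_d_apply, ← ha₀', eq, ← map_add]
        congr 1
        rw [map_add]; abel
      · rw [map_sub, map_add, hk', ← es]; abel

end IsMayerVietoris

end Elements

/-! ### Monomials in the Stanley-Reisner ring -/

namespace SimplicialComplexOn

noncomputable section

variable {R : Type} [CommRing R] {m : ℕ} {K L : SimplicialComplexOn m}

theorem mem_stanleyReisnerIdeal_iff {f : MvPolynomial (Fin m) R} :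
    f ∈ K.stanleyReisnerIdeal R ↔ ∀ a ∈ f.support, a.support ∉ K.faces := by
  have h : {f | ∃ σ : Finset (Fin m), σ ∉ K.faces ∧
      f = ∏ i ∈ σ, (MvPolynomial.X i : MvPolynomial (Fin m) R)} = (fun s => MvPolynomial.monomial s (1 : R)) ''
        {a | ∃ σ : Finset (Fin m), σ ∉ K.faces ∧ a = ∑ i ∈ σ, Finsupp.single i 1} := by
    ext f
    constructor
    · rintro ⟨σ, hσ, rfl⟩
      refine ⟨_, ⟨σ, hσ, rfl⟩, ?_⟩
      simp [MvPolynomial.X, MvPolynomial.monomial_sum_one]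
    · rintro ⟨_, ⟨σ, hσ, rfl⟩, rfl⟩
      refine ⟨σ, hσ, ?_⟩
      simp [MvPolynomial.X, MvPolynomial.monomial_sum_one]
  rw [stanleyReisnerIdeal, h, MvPolynomial.mem_ideal_span_monomial_image]
  refine forall₂_congr fun a _ => ⟨?_, fun ha => ⟨_, ⟨a.support, ha, rfl⟩, fun i => ?_⟩⟩
  · rintro ⟨_, ⟨σ, hσ, rfl⟩, hle⟩ ha
    refine hσ (K.down_closed ha fun i hi => ?_)
    have := hle i
    rw [Finsupp.finsetSum_apply] at this
    simp only [Finsupp.single_apply, Finset.sum_ite_eq', hi, if_true] at this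
    exact Finsupp.mem_support_iff.2 (by omega)
  · rw [Finsupp.finsetSum_apply]
    simp only [Finsupp.single_apply, Finset.sum_ite_eq', Finsupp.mem_support_iff]
    split_ifs <;> omega

/-- The class of a monomial in the Stanley-Reisner ring. -/
def tmon (R : Type) [CommRing R] (K : SimplicialComplexOn m) (a : Fin m →₀ ℕ) :
    K.StanleyReisnerRing R :=
  K.srMk R (MvPolynomial.monomial a 1)

theorem tmon_eq_zero {a : Fin m →₀ ℕ} (ha : a.support ∉ K.faces) : K.tmon R a = 0 := by
  refine Ideal.Quotient.eq_zero_iff_mem.2 (mem_stanleyReisnerIdeal_iff.2 fun b hb => ?_)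
  have := MvPolynomial.support_monomial_subset hb
  rw [Finset.mem_singleton] at this
  rwa [this]

theorem tmon_zero : K.tmon R 0 = 1 := map_one (K.srMk R)

theorem srVar_mul_tmon (i : Fin m) (a : Fin m →₀ ℕ) :
    K.srVar R i * K.tmon R a = K.tmon R (a + Finsupp.single i 1) := by
  rw [tmon, tmon, srVar, ← map_mul, MvPolynomial.X, MvPolynomial.monomial_mul, add_comm, one_mul]

theorem srRestrict_tmon (h : L ≤ K) (a : Fin m →₀ ℕ) :
    srRestrict R h (K.tmon R a) = L.tmon R a := rfl

section

variable {M : Type} [AddCommGroup M] [Module R M]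

/-- The linear map on the Stanley-Reisner ring with prescribed values on monomials. -/
def srDesc (K : SimplicialComplexOn m) (g : (Fin m →₀ ℕ) → M)
    (hg : ∀ a, a.support ∉ K.faces → g a = 0) : K.StanleyReisnerRing R →ₗ[R] M :=
  (Submodule.liftQ ((K.stanleyReisnerIdeal R).restrictScalars R)
    ((MvPolynomial.basisMonomials (Fin m) R).constr R g) (by
      intro f hf
      rw [LinearMap.mem_ker, Module.Basis.constr_apply]
      refine Finset.sum_eq_zero fun a ha => ?_
      change (_ : R) • g a = 0
      rw [hg a (mem_stanleyReisnerIdeal_iff.1 hf a ha), smul_zero])) ∘ₗ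
    (Submodule.Quotient.restrictScalarsEquiv R (K.stanleyReisnerIdeal R)).symm.toLinearMap

theorem srDesc_tmon (g : (Fin m →₀ ℕ) → M) (hg : ∀ a, a.support ∉ K.faces → g a = 0)
    (a : Fin m →₀ ℕ) : srDesc (R := R) K g hg (K.tmon R a) = g a := by
  have := (MvPolynomial.basisMonomials (Fin m) R).constr_basis R g a
  rw [MvPolynomial.coe_basisMonomials] at this
  exact this

theorem sr_hom_ext {f g : K.StanleyReisnerRing R →ₗ[R] M}
    (h : ∀ a, f (K.tmon R a) = g (K.tmon R a)) : f = g := by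
  ext x
  obtain ⟨x, rfl⟩ := K.srMk_surjective x
  have : f ∘ₗ (K.srMk R).toLinearMap = g ∘ₗ (K.srMk R).toLinearMap :=
    (MvPolynomial.basisMonomials (Fin m) R).ext fun a => by
      simpa using! h a
  exact LinearMap.congr_fun this x

theorem A_hom_ext {f g : K.ARing R →ₗ[R] M}
    (h : ∀ a w, f (K.tmon R a ⊗ₜ w) = g (K.tmon R a ⊗ₜ w)) : f = g :=
  TensorProduct.ext (sr_hom_ext fun a => LinearMap.ext fun w => h a w)

end

theorem gradeA_eq_span (n : ℕ) : K.gradeA R n = Submodule.span R {x | ∃ (a : Fin m →₀ ℕ) (j : ℕ),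
    2 * a.degree + j = n ∧ ∃ w ∈ ⋀[R]^j (Fin m → R), x = K.tmon R a ⊗ₜ w} := by
  apply le_antisymm
  · refine Submodule.span_le.2 ?_
    rintro _ ⟨k, j, rfl, _, ⟨f, hf, rfl⟩, w, hw, rfl⟩
    rw [AlgHom.toLinearMap_apply, f.as_sum, map_sum, TensorProduct.sum_tmul]
    refine Submodule.sum_mem _ fun a ha => ?_
    rw [show MvPolynomial.monomial a (f.coeff a) = f.coeff a • MvPolynomial.monomial a (1 : R) by
      rw [MvPolynomial.smul_monomial, smul_eq_mul, mul_one], map_smul, ← TensorProduct.smul_tmul']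
    refine Submodule.smul_mem _ _ (Submodule.subset_span ⟨a, j, ?_, w, hw, rfl⟩)
    have := hf (MvPolynomial.mem_support_iff.1 ha)
    rw [← this, Finsupp.degree_eq_weight_one]
    rfl
  · refine Submodule.span_le.2 ?_
    rintro _ ⟨a, j, rfl, w, hw, rfl⟩
    exact Submodule.subset_span ⟨a.degree, j, rfl, _,
      ⟨_, MvPolynomial.isHomogeneous_monomial 1 rfl, rfl⟩, w, hw, rfl⟩

theorem tmon_tmul_mem {a : Fin m →₀ ℕ} {j n : ℕ} (h : 2 * a.degree + j = n)
    {w : ExteriorAlgebra R (Fin m → R)} (hw : w ∈ ⋀[R]^j (Fin m → R)) :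
    K.tmon R a ⊗ₜ w ∈ K.gradeA R n := by
  rw [gradeA_eq_span]
  exact Submodule.subset_span ⟨a, j, h, w, hw, rfl⟩

theorem dA_tmon_tmul (a : Fin m →₀ ℕ) (w : ExteriorAlgebra R (Fin m → R)) :
    K.dA R (K.tmon R a ⊗ₜ w) =
      ∑ i, K.tmon R (a + Finsupp.single i 1) ⊗ₜ extContract R i w := by
  simp only [dA_tmul, srVar_mul_tmon]

/-! ### Commutation rules -/

/-- The `i`-th generator of the exterior algebra. -/
abbrev extGen (R : Type) [CommRing R] (i : Fin m) : ExteriorAlgebra R (Fin m → R) :=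
  ExteriorAlgebra.ι R (Pi.single i 1)

theorem extContract_gen_mul_self (i : Fin m) (w : ExteriorAlgebra R (Fin m → R)) :
    extContract R i (extGen R i * w) = w - extGen R i * extContract R i w := by
  rw [extContract_ι_mul, Pi.single_eq_same, one_smul]

theorem extContract_gen_mul_of_ne {i j : Fin m} (h : j ≠ i) (w : ExteriorAlgebra R (Fin m → R)) :
    extContract R j (extGen R i * w) = - (extGen R i * extContract R j w) := by
  rw [extContract_ι_mul, Pi.single_eq_of_ne h, zero_smul, zero_sub]

theorem extContract_comm (i j : Fin m) (w : ExteriorAlgebra R (Fin m → R)) :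
    extContract R i (extContract R j w) = - extContract R j (extContract R i w) :=
  CliffordAlgebra.contractLeft_comm _ _ _

theorem extGen_mul_self (i : Fin m) (w : ExteriorAlgebra R (Fin m → R)) :
    extGen R i * (extGen R i * w) = 0 := by
  rw [← mul_assoc, extGen, ExteriorAlgebra.ι_sq_zero, zero_mul]

theorem extGen_mul_comm (i j : Fin m) (w : ExteriorAlgebra R (Fin m → R)) :
    extGen R i * (extGen R j * w) = - (extGen R j * (extGen R i * w)) := by
  rw [← mul_assoc, ← mul_assoc, ← neg_mul]
  congr 1
  exact eq_neg_of_add_eq_zero_left (ExteriorAlgebra.ι_add_mul_swap _ _)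

theorem extGen_mem (i : Fin m) {j : ℕ} {w : ExteriorAlgebra R (Fin m → R)}
    (hw : w ∈ ⋀[R]^j (Fin m → R)) : extGen R i * w ∈ ⋀[R]^(j + 1) (Fin m → R) := by
  rw [ExteriorAlgebra.exteriorPower, pow_succ']
  exact Submodule.mul_mem_mul ⟨_, rfl⟩ hw

theorem mul_ι (x : Fin m → R) (w : ExteriorAlgebra R (Fin m → R)) :
    w * ExteriorAlgebra.ι R x = ExteriorAlgebra.ι R x * extInv R w := by
  induction w using CliffordAlgebra.left_induction with
  | algebraMap r =>
    rw [AlgHom.commutes]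
    exact Algebra.commutes _ _
  | add y z hy hz => rw [add_mul, hy, hz, map_add, mul_add]
  | ι_mul y v hy =>
    change ExteriorAlgebra.ι R v * y * _ = _ * extInv R (ExteriorAlgebra.ι R v * y)
    rw [map_mul, extInv_ι, mul_assoc, hy, ← mul_assoc, ← mul_assoc,
      eq_neg_of_add_eq_zero_left (ExteriorAlgebra.ι_add_mul_swap v x), neg_mul, mul_neg, neg_mul]

theorem mul_s (x : K.ARing R) (i : Fin m) : x * K.s R i = K.s R i * K.AInv R x := by
  induction x using TensorProduct.induction_on with
  | zero => simp
  | add x y hx hy => rw [add_mul, hx, hy, map_add, mul_add]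
  | tmul f w =>
    rw [s, AInv, Algebra.TensorProduct.map_tmul, Algebra.TensorProduct.tmul_mul_tmul,
      Algebra.TensorProduct.tmul_mul_tmul, mul_ι, mul_one, one_mul]
    rfl

theorem t_mul_comm (x : K.ARing R) (i : Fin m) : x * K.t R i = K.t R i * x := by
  induction x using TensorProduct.induction_on with
  | zero => simp
  | add x y hx hy => rw [add_mul, hx, hy, mul_add]
  | tmul f w =>
    rw [t, Algebra.TensorProduct.tmul_mul_tmul, Algebra.TensorProduct.tmul_mul_tmul,
      mul_comm f, mul_one, one_mul]

theorem t_mul_t_mul (i j : Fin m) (x : K.ARing R) :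
    K.t R i * (K.t R j * x) = K.t R j * (K.t R i * x) := by
  rw [← mul_assoc, t_mul_comm, mul_assoc]

theorem s_mul_t_mul (i j : Fin m) (x : K.ARing R) :
    K.s R i * (K.t R j * x) = K.t R j * (K.s R i * x) := by
  rw [← mul_assoc, t_mul_comm, mul_assoc]

theorem s_mul_tmul (i : Fin m) (f : K.StanleyReisnerRing R) (w : ExteriorAlgebra R (Fin m → R)) :
    K.s R i * (f ⊗ₜ w) = f ⊗ₜ (extGen R i * w) := by
  rw [s, Algebra.TensorProduct.tmul_mul_tmul, one_mul]

theorem t_mul_tmon (i : Fin m) (a : Fin m →₀ ℕ) (w : ExteriorAlgebra R (Fin m → R)) :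
    K.t R i * (K.tmon R a ⊗ₜ w) = K.tmon R (a + Finsupp.single i 1) ⊗ₜ w := by
  rw [t, Algebra.TensorProduct.tmul_mul_tmul, one_mul, srVar_mul_tmon]

theorem s_mul_s_self (i : Fin m) (x : K.ARing R) : K.s R i * (K.s R i * x) = 0 := by
  induction x using TensorProduct.induction_on with
  | zero => simp
  | add x y hx hy => rw [mul_add, mul_add, hx, hy, add_zero]
  | tmul f w => rw [s_mul_tmul, s_mul_tmul, extGen_mul_self, TensorProduct.tmul_zero]

theorem s_mul_s (i j : Fin m) (x : K.ARing R) :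
    K.s R i * (K.s R j * x) = - (K.s R j * (K.s R i * x)) := by
  induction x using TensorProduct.induction_on with
  | zero => simp
  | add x y hx hy => simp only [mul_add, hx, hy, neg_add]
  | tmul f w =>
    simp only [s_mul_tmul]
    rw [extGen_mul_comm, TensorProduct.tmul_neg]

/-- The contraction `∂ / ∂ s i` on `A(K)`. -/
def contractA (R : Type) [CommRing R] (K : SimplicialComplexOn m) (i : Fin m) :
    K.ARing R →ₗ[R] K.ARing R :=
  TensorProduct.map LinearMap.id (extContract R i)

theorem contractA_tmul (i : Fin m) (f : K.StanleyReisnerRing R)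
    (w : ExteriorAlgebra R (Fin m → R)) :
    K.contractA R i (f ⊗ₜ w) = f ⊗ₜ extContract R i w := rfl

theorem contractA_one (i : Fin m) : K.contractA R i 1 = 0 := by
  rw [Algebra.TensorProduct.one_def, contractA_tmul, extContract_one, TensorProduct.tmul_zero]

theorem contractA_t_mul (i j : Fin m) (x : K.ARing R) :
    K.contractA R i (K.t R j * x) = K.t R j * K.contractA R i x := by
  induction x using TensorProduct.induction_on with
  | zero => simp
  | add x y hx hy => simp only [mul_add, map_add, hx, hy]
  | tmul f w =>
    rw [t, Algebra.TensorProduct.tmul_mul_tmul, contractA_tmul, contractA_tmul,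
      Algebra.TensorProduct.tmul_mul_tmul, one_mul, one_mul]

theorem contractA_mul (i : Fin m) (x y : K.ARing R) :
    K.contractA R i (x * y) = K.contractA R i x * y + K.AInv R x * K.contractA R i y := by
  induction x using TensorProduct.induction_on with
  | zero => simp
  | add x y hx hy => simp only [add_mul, map_add, hx, hy]; abel
  | tmul f v =>
    induction y using TensorProduct.induction_on with
    | zero => simp
    | add x y hx hy => simp only [mul_add, map_add, hx, hy]; abel
    | tmul g w =>
      rw [Algebra.TensorProduct.tmul_mul_tmul, contractA_tmul, contractA_tmul, contractA_tmul, AInv,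
        Algebra.TensorProduct.map_tmul, extContract_mul, TensorProduct.tmul_add,
        Algebra.TensorProduct.tmul_mul_tmul, Algebra.TensorProduct.tmul_mul_tmul, AlgHom.id_apply]

theorem contractA_s_mul_self (i : Fin m) (x : K.ARing R) :
    K.contractA R i (K.s R i * x) = x - K.s R i * K.contractA R i x := by
  induction x using TensorProduct.induction_on with
  | zero => simp
  | add x y hx hy => simp only [mul_add, map_add, hx, hy]; abel
  | tmul f w =>
    rw [s_mul_tmul, contractA_tmul, contractA_tmul, s_mul_tmul, extContract_gen_mul_self,
      TensorProduct.tmul_sub]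

theorem contractA_s_mul_of_ne {i j : Fin m} (h : j ≠ i) (x : K.ARing R) :
    K.contractA R j (K.s R i * x) = - (K.s R i * K.contractA R j x) := by
  induction x using TensorProduct.induction_on with
  | zero => simp
  | add x y hx hy => simp only [mul_add, map_add, hx, hy]; abel
  | tmul f w =>
    rw [s_mul_tmul, contractA_tmul, contractA_tmul, s_mul_tmul, extContract_gen_mul_of_ne h,
      TensorProduct.tmul_neg]

theorem contractA_comm (i j : Fin m) (x : K.ARing R) :
    K.contractA R i (K.contractA R j x) = - K.contractA R j (K.contractA R i x) := by
  induction x using TensorProduct.induction_on with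
  | zero => simp
  | add x y hx hy => simp only [map_add, hx, hy]; abel
  | tmul f w => simp only [contractA_tmul]; rw [extContract_comm, TensorProduct.tmul_neg]

theorem dA_eq_sum (x : K.ARing R) : K.dA R x = ∑ i, K.t R i * K.contractA R i x := by
  induction x using TensorProduct.induction_on with
  | zero => simp
  | add x y hx hy => simp only [map_add, hx, hy, mul_add, Finset.sum_add_distrib]
  | tmul f w =>
    rw [dA_tmul]
    refine Finset.sum_congr rfl fun i _ => ?_
    rw [contractA_tmul, t, Algebra.TensorProduct.tmul_mul_tmul, one_mul]

theorem s_mem (i : Fin m) : K.s R i ∈ K.gradeA R 1 := by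
  rw [s, ← tmon_zero]
  exact tmon_tmul_mem (j := 1) (by simp) (by
    rw [ExteriorAlgebra.exteriorPower, pow_one]; exact ⟨_, rfl⟩)

theorem t_mem (i : Fin m) : K.t R i ∈ K.gradeA R 2 := by
  rw [t, ← mul_one (K.srVar R i), ← tmon_zero, srVar_mul_tmon]
  exact tmon_tmul_mem (j := 0) (by simp)
    (SetLike.GradedOne.one_mem (A := fun i : ℕ => ⋀[R]^i (Fin m → R)))

theorem contractA_mem (i : Fin m) {n : ℕ} {x : K.ARing R} (hx : x ∈ K.gradeA R (n + 1)) :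
    K.contractA R i x ∈ K.gradeA R n := by
  suffices K.gradeA R (n + 1) ≤ (K.gradeA R n).comap (K.contractA R i) from this hx
  rw [gradeA_eq_span (n + 1)]
  refine Submodule.span_le.2 ?_
  rintro _ ⟨a, j, h, w, hw, rfl⟩
  rw [SetLike.mem_coe, Submodule.mem_comap, contractA_tmul]
  obtain _ | j := j
  · rw [extContract_mem_zero i hw, TensorProduct.tmul_zero]; exact Submodule.zero_mem _
  · exact tmon_tmul_mem (j := j) (by omega) (extContract_mem i j hw)

theorem contractA_mem_zero (i : Fin m) {x : K.ARing R} (hx : x ∈ K.gradeA R 0) :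
    K.contractA R i x = 0 := by
  suffices K.gradeA R 0 ≤ LinearMap.ker (K.contractA R i) from this hx
  rw [gradeA_eq_span]
  refine Submodule.span_le.2 ?_
  rintro _ ⟨a, j, h, w, hw, rfl⟩
  obtain rfl : j = 0 := by omega
  rw [SetLike.mem_coe, LinearMap.mem_ker, contractA_tmul, extContract_mem_zero i hw,
    TensorProduct.tmul_zero]

theorem t_sq_mul_mem_idealB (i : Fin m) (x : K.ARing R) :
    K.t R i * (K.t R i * x) ∈ K.idealB R := by
  rw [← mul_assoc]
  refine Ideal.mul_mem_right _ _ ?_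
  exact TwoSidedIdeal.mem_asIdeal.2 (TwoSidedIdeal.subset_span ⟨i, Or.inl rfl⟩)

theorem s_mul_t_mul_mem_idealB (i : Fin m) (x : K.ARing R) :
    K.s R i * (K.t R i * x) ∈ K.idealB R := by
  rw [← mul_assoc]
  refine Ideal.mul_mem_right _ _ ?_
  exact TwoSidedIdeal.mem_asIdeal.2 (TwoSidedIdeal.subset_span ⟨i, Or.inr rfl⟩)

/-- `idealB` is spanned by the multiples of its generators on one side. -/
theorem idealB_le {P : AddSubgroup (K.ARing R)}
    (ht : ∀ i x, K.t R i * (K.t R i * x) ∈ P) (hs : ∀ i x, K.s R i * (K.t R i * x) ∈ P)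
    {x : K.ARing R} (hx : x ∈ K.idealB R) : x ∈ P := by
  rw [idealB, TwoSidedIdeal.mem_asIdeal] at hx
  suffices ∀ y z, y * x * z ∈ P by simpa using this 1 1
  induction hx using TwoSidedIdeal.span_induction with
  | mem x hx =>
    intro y z
    obtain ⟨i, rfl | rfl⟩ := hx
    · rw [← mul_assoc, t_mul_comm, mul_assoc (K.t R i), t_mul_comm, mul_assoc]
      exact ht _ _
    · rw [← mul_assoc, t_mul_comm, mul_s, mul_assoc, mul_assoc, ← s_mul_t_mul]
      exact hs _ _
  | zero => intro y z; simp [P.zero_mem]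
  | add x y hx hy h1 h2 => intro y z; rw [mul_add, add_mul]; exact P.add_mem (h1 _ _) (h2 _ _)
  | neg x hx h => intro y z; rw [mul_neg, neg_mul]; exact P.neg_mem (h _ _)
  | left_absorb a x hx h => intro y z; rw [← mul_assoc]; exact h _ _
  | right_absorb a x hx h => intro y z; rw [← mul_assoc, mul_assoc]; exact h _ _

end

end SimplicialComplexOn

/-! ### Contracting homotopies and the comparison of `A(K)` and `B(K)` -/

namespace SimplicialComplexOn

noncomputable section

variable {R : Type} [CommRing R] {m : ℕ} {K L : SimplicialComplexOn m}

/-- Division by `t i` of the monomials of `t i`-degree greater than `k` is well defined on the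
Stanley-Reisner ring. -/
def CanDivide (K : SimplicialComplexOn m) (i : Fin m) (k : ℕ) : Prop :=
  1 ≤ k ∨ ∀ σ ∈ K.faces, insert i σ ∈ K.faces

theorem CanDivide.not_mem {i : Fin m} {k : ℕ} (h : K.CanDivide i k) {a : Fin m →₀ ℕ}
    (ha : a.support ∉ K.faces) (hk : k < a i) :
    (a - Finsupp.single i 1).support ∉ K.faces := by
  intro h'
  have hsub : ∀ j : Fin m, j ≠ i → (a - Finsupp.single i 1 : Fin m →₀ ℕ) j = a j := fun j hj => by
    rw [Finsupp.tsub_apply, Finsupp.single_eq_of_ne hj, tsub_zero]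
  obtain h1 | h1 := h
  · refine ha (K.down_closed h' fun j hj => ?_)
    rw [Finsupp.mem_support_iff] at hj ⊢
    by_cases hji : j = i
    · subst hji
      rw [Finsupp.tsub_apply, Finsupp.single_eq_same]
      omega
    · rwa [hsub j hji]
  · refine ha (K.down_closed (h1 _ h') fun j hj => ?_)
    rw [Finset.mem_insert, Finsupp.mem_support_iff]
    by_cases hji : j = i
    · exact Or.inl hji
    · right; rw [hsub j hji]; exact Finsupp.mem_support_iff.1 hj

/-- The homotopy `t i ^ (l + 1) ↦ t i ^ l * s i` for `l ≥ k`, extended to `A(K)`. -/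
def divA (K : SimplicialComplexOn m) (i : Fin m) (k : ℕ) (h : K.CanDivide i k) :
    K.ARing R →ₗ[R] K.ARing R :=
  TensorProduct.lift (srDesc K (fun a => if k < a i then
    (TensorProduct.mk R _ _ (K.tmon R (a - Finsupp.single i 1))) ∘ₗ
      LinearMap.mulLeft R (extGen R i) else 0) (by
    intro a ha
    split_ifs with hk
    · rw [tmon_eq_zero (h.not_mem ha hk), map_zero, LinearMap.zero_comp]
    · rfl))

theorem divA_tmon (i : Fin m) (k : ℕ) (h : K.CanDivide i k) (a : Fin m →₀ ℕ)
    (w : ExteriorAlgebra R (Fin m → R)) : divA K i k h (K.tmon R a ⊗ₜ w) =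
      if k < a i then K.tmon R (a - Finsupp.single i 1) ⊗ₜ (extGen R i * w) else 0 := by
  rw [divA, TensorProduct.lift.tmul, srDesc_tmon]
  split_ifs <;> rfl

/-- The projection of `A(K)` onto the span of the monomials that have degree less than `k` in `t i`,
or degree `k` in `t i` and no factor `s i`. -/
def truncA (R : Type) [CommRing R] (K : SimplicialComplexOn m) (i : Fin m) (k : ℕ) :
    K.ARing R →ₗ[R] K.ARing R :=
  TensorProduct.lift (srDesc K (fun a => if a i < k then TensorProduct.mk R _ _ (K.tmon R a) else
    if a i = k then (TensorProduct.mk R _ _ (K.tmon R a)) ∘ₗ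
      (extContract R i ∘ₗ LinearMap.mulLeft R (extGen R i)) else 0) (by
    intro a ha
    rw [tmon_eq_zero ha, map_zero]
    split_ifs <;> simp))

theorem truncA_tmon (i : Fin m) (k : ℕ) (a : Fin m →₀ ℕ) (w : ExteriorAlgebra R (Fin m → R)) :
    K.truncA R i k (K.tmon R a ⊗ₜ w) = if a i < k then K.tmon R a ⊗ₜ w else
      if a i = k then K.tmon R a ⊗ₜ extContract R i (extGen R i * w) else 0 := by
  rw [truncA, TensorProduct.lift.tmul, srDesc_tmon]
  split_ifs <;> rfl

theorem divA_homotopy (i : Fin m) (k : ℕ) (h : K.CanDivide i k) (x : K.ARing R) :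
    x - K.truncA R i k x = K.dA R (divA K i k h x) + divA K i k h (K.dA R x) := by
  suffices LinearMap.id - K.truncA R i k = K.dA R ∘ₗ divA K i k h + divA K i k h ∘ₗ K.dA R from
    LinearMap.congr_fun this x
  refine A_hom_ext fun a w => ?_
  simp only [LinearMap.sub_apply, LinearMap.add_apply, LinearMap.comp_apply, LinearMap.id_apply,
    dA_tmon_tmul, map_sum, divA_tmon]
  have e1 : K.dA R (if k < a i then K.tmon R (a - Finsupp.single i 1) ⊗ₜ[R] (extGen R i * w)
      else 0) = ∑ j, if k < a i then K.tmon R (a - Finsupp.single i 1 + Finsupp.single j 1) ⊗ₜ[R]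
        extContract R j (extGen R i * w) else 0 := by
    split_ifs
    · rw [dA_tmon_tmul]
    · simp
  rw [e1, ← Finset.sum_add_distrib, Finset.sum_eq_single i, truncA_tmon]
  · have e2 : a + Finsupp.single i 1 - Finsupp.single i 1 = a := add_tsub_cancel_right _ _
    rw [Finsupp.add_apply, Finsupp.single_eq_same, e2]
    by_cases h1 : k < a i
    · have e3 : a - Finsupp.single i 1 + Finsupp.single i 1 = a :=
        tsub_add_cancel_of_le (Finsupp.single_le_iff.2 (by omega))
      rw [if_pos h1, if_neg (show ¬ a i < k by omega), if_neg (show ¬ a i = k by omega),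
        if_pos (show k < a i + 1 by omega), e3,
        extContract_gen_mul_self, TensorProduct.tmul_sub, sub_zero, sub_add_cancel]
    · rw [if_neg h1, zero_add]
      by_cases h2 : a i = k
      · rw [if_neg (show ¬ a i < k by omega), if_pos h2, if_pos (show k < a i + 1 by omega),
          extContract_gen_mul_self,
          TensorProduct.tmul_sub, sub_sub_cancel]
      · rw [if_pos (show a i < k by omega), if_neg (show ¬ k < a i + 1 by omega), sub_self]
  · intro j _ hj
    rw [Finsupp.add_apply, Finsupp.single_eq_of_ne hj.symm, add_zero]
    split_ifs with hk
    · have : a - Finsupp.single i 1 + Finsupp.single j 1 =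
          a + Finsupp.single j 1 - Finsupp.single i 1 :=
        tsub_add_eq_add_tsub (Finsupp.single_le_iff.2 (by omega))
      rw [this, extContract_gen_mul_of_ne hj, ← TensorProduct.tmul_add, neg_add_cancel,
        TensorProduct.tmul_zero]
    · rw [add_zero]
  · simp

theorem divA_mem (i : Fin m) (k : ℕ) (h : K.CanDivide i k) {n : ℕ} {x : K.ARing R}
    (hx : x ∈ K.gradeA R (n + 1)) : divA K i k h x ∈ K.gradeA R n := by
  suffices K.gradeA R (n + 1) ≤ (K.gradeA R n).comap (divA K i k h) from this hx
  rw [gradeA_eq_span (n + 1)]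
  refine Submodule.span_le.2 ?_
  rintro _ ⟨a, j, hn, w, hw, rfl⟩
  rw [SetLike.mem_coe, Submodule.mem_comap, divA_tmon]
  split_ifs with hk
  · refine tmon_tmul_mem (j := j + 1) ?_ (extGen_mem i hw)
    have e3 : a - Finsupp.single i 1 + Finsupp.single i 1 = a :=
      tsub_add_cancel_of_le (Finsupp.single_le_iff.2 (by omega))
    rw [← e3, map_add, Finsupp.degree_single] at hn
    omega
  · exact Submodule.zero_mem _

theorem divA_mem_zero (i : Fin m) (k : ℕ) (h : K.CanDivide i k) {x : K.ARing R}
    (hx : x ∈ K.gradeA R 0) : divA K i k h x = 0 := by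
  suffices K.gradeA R 0 ≤ LinearMap.ker (divA K i k h) from this hx
  rw [gradeA_eq_span]
  refine Submodule.span_le.2 ?_
  rintro _ ⟨a, j, hn, w, hw, rfl⟩
  have : a = 0 := (Finsupp.degree_eq_zero_iff a).1 (by omega)
  rw [SetLike.mem_coe, LinearMap.mem_ker, divA_tmon, this, Finsupp.zero_apply, if_neg (by omega)]

/-- The composition of the projections `truncA` for a list of indices. -/
def truncList (R : Type) [CommRing R] (K : SimplicialComplexOn m) (k : ℕ) (l : List (Fin m)) :
    K.ARing R →ₗ[R] K.ARing R :=
  l.foldr (fun i f => f ∘ₗ K.truncA R i k) LinearMap.id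

theorem truncList_nil (k : ℕ) (x : K.ARing R) : K.truncList R k [] x = x := rfl

theorem truncList_cons (k : ℕ) (i : Fin m) (l : List (Fin m)) (x : K.ARing R) :
    K.truncList R k (i :: l) x = K.truncList R k l (K.truncA R i k x) := rfl

theorem exists_truncList_homotopy (k : ℕ) (l : List (Fin m)) (hl : ∀ i ∈ l, K.CanDivide i k) :
    ∃ H : K.ARing R →ₗ[R] K.ARing R,
      (∀ n, ∀ x ∈ K.gradeA R (n + 1), H x ∈ K.gradeA R n) ∧ (∀ x ∈ K.gradeA R 0, H x = 0) ∧
      ∀ x, x - K.truncList R k l x = K.dA R (H x) + H (K.dA R x) := by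
  induction l with
  | nil => exact ⟨0, fun n x _ => Submodule.zero_mem _, fun _ _ => rfl, fun x => by
      simp [truncList_nil]⟩
  | cons i l ih =>
    obtain ⟨H, h1, h2, h3⟩ := ih fun j hj => hl j (List.mem_cons_of_mem _ hj)
    have hi := hl i List.mem_cons_self
    have key : ∀ n, ∀ x ∈ K.gradeA R n, K.truncA R i k x ∈ K.gradeA R n := by
      intro n x hx
      have := divA_homotopy i k hi x
      rw [sub_eq_iff_eq_add, ← sub_eq_iff_eq_add'] at this
      rw [← this]
      refine Submodule.sub_mem _ hx (Submodule.add_mem _ ?_ (divA_mem i k hi (dA_mem hx)))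
      cases n with
      | zero => rw [divA_mem_zero i k hi hx, map_zero]; exact Submodule.zero_mem _
      | succ n => exact dA_mem (divA_mem i k hi hx)
    have hcomm : ∀ x, K.truncA R i k (K.dA R x) = K.dA R (K.truncA R i k x) := by
      intro x
      have e1 := congrArg (K.dA R) (divA_homotopy i k hi x)
      have e2 := divA_homotopy i k hi (K.dA R x)
      rw [map_sub, map_add, dA_dA, zero_add] at e1
      rw [dA_dA, map_zero, add_zero, ← e1] at e2
      exact sub_right_inj.1 e2
    refine ⟨divA K i k hi + H ∘ₗ K.truncA R i k, fun n x hx => Submodule.add_mem _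
      (divA_mem i k hi hx) (h1 n _ (key _ x hx)), fun x hx => ?_, fun x => ?_⟩
    · rw [LinearMap.add_apply, divA_mem_zero i k hi hx, LinearMap.comp_apply, h2 _ (key 0 x hx),
        add_zero]
    · have e1 := divA_homotopy i k hi x
      have e2 := h3 (K.truncA R i k x)
      simp only [truncList_cons, LinearMap.comp_apply, LinearMap.add_apply, map_add, hcomm]
      rw [← sub_add_sub_cancel _ (K.truncA R i k x), e1, e2]
      abel

theorem truncList_dA (k : ℕ) (l : List (Fin m)) (hl : ∀ i ∈ l, K.CanDivide i k) (x : K.ARing R) :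
    K.truncList R k l (K.dA R x) = K.dA R (K.truncList R k l x) := by
  obtain ⟨H, -, -, h⟩ := exists_truncList_homotopy (R := R) k l hl
  have e1 := congrArg (K.dA R) (h x)
  have e2 := h (K.dA R x)
  rw [map_sub, map_add, dA_dA, zero_add] at e1
  rw [dA_dA, map_zero, add_zero, ← e1] at e2
  exact sub_right_inj.1 e2

theorem truncList_mem (k : ℕ) (l : List (Fin m)) (hl : ∀ i ∈ l, K.CanDivide i k) {n : ℕ}
    {x : K.ARing R} (hx : x ∈ K.gradeA R n) : K.truncList R k l x ∈ K.gradeA R n := by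
  obtain ⟨H, h1, h2, h⟩ := exists_truncList_homotopy (R := R) k l hl
  have := h x
  rw [sub_eq_iff_eq_add, ← sub_eq_iff_eq_add'] at this
  rw [← this]
  refine Submodule.sub_mem _ hx (Submodule.add_mem _ ?_ (h1 _ _ (dA_mem hx)))
  cases n with
  | zero => rw [h2 _ hx, map_zero]; exact Submodule.zero_mem _
  | succ n => exact dA_mem (h1 _ _ hx)

theorem truncA_t_mul_of_ne {i j : Fin m} (h : j ≠ i) (k : ℕ) (x : K.ARing R) :
    K.truncA R j k (K.t R i * x) = K.t R i * K.truncA R j k x := by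
  suffices K.truncA R j k ∘ₗ LinearMap.mulLeft R (K.t R i) =
    LinearMap.mulLeft R (K.t R i) ∘ₗ K.truncA R j k from LinearMap.congr_fun this x
  refine A_hom_ext fun a w => ?_
  simp only [LinearMap.comp_apply, LinearMap.mulLeft_apply, t_mul_tmon, truncA_tmon,
    Finsupp.add_apply, Finsupp.single_eq_of_ne h, add_zero]
  split_ifs <;> simp [t_mul_tmon]

theorem truncA_s_mul_of_ne {i j : Fin m} (h : j ≠ i) (k : ℕ) (x : K.ARing R) :
    K.truncA R j k (K.s R i * x) = K.s R i * K.truncA R j k x := by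
  suffices K.truncA R j k ∘ₗ LinearMap.mulLeft R (K.s R i) =
    LinearMap.mulLeft R (K.s R i) ∘ₗ K.truncA R j k from LinearMap.congr_fun this x
  refine A_hom_ext fun a w => ?_
  simp only [LinearMap.comp_apply, LinearMap.mulLeft_apply, s_mul_tmul, truncA_tmon]
  split_ifs
  · rw [s_mul_tmul]
  · rw [s_mul_tmul, extGen_mul_comm j i, map_neg, extContract_gen_mul_of_ne h, neg_neg]
  · rw [mul_zero]

theorem truncA_t_mul_t (i : Fin m) (x : K.ARing R) :
    K.truncA R i 1 (K.t R i * (K.t R i * x)) = 0 := by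
  suffices K.truncA R i 1 ∘ₗ LinearMap.mulLeft R (K.t R i) ∘ₗ LinearMap.mulLeft R (K.t R i) = 0 from
    LinearMap.congr_fun this x
  refine A_hom_ext fun a w => ?_
  simp [t_mul_tmon, truncA_tmon]

theorem truncA_s_mul_t (i : Fin m) (x : K.ARing R) :
    K.truncA R i 1 (K.s R i * (K.t R i * x)) = 0 := by
  suffices K.truncA R i 1 ∘ₗ LinearMap.mulLeft R (K.s R i) ∘ₗ LinearMap.mulLeft R (K.t R i) = 0 from
    LinearMap.congr_fun this x
  refine A_hom_ext fun a w => ?_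
  simp [t_mul_tmon, truncA_tmon, s_mul_tmul, extGen_mul_self]

theorem truncList_idealB {x : K.ARing R} (hx : x ∈ K.idealB R) :
    K.truncList R 1 (List.finRange m) x = 0 := by
  have h1 : ∀ (l : List (Fin m)) (i : Fin m) (y : K.ARing R), i ∈ l →
      K.truncList R 1 l (K.t R i * (K.t R i * y)) = 0 := by
    intro l i
    induction l with
    | nil => simp
    | cons j l ih =>
      intro y hi
      rw [truncList_cons]
      by_cases hj : j = i
      · rw [hj, truncA_t_mul_t, map_zero]
      · rw [truncA_t_mul_of_ne hj, truncA_t_mul_of_ne hj]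
        exact ih _ ((List.mem_cons.1 hi).resolve_left (Ne.symm hj))
  have h2 : ∀ (l : List (Fin m)) (i : Fin m) (y : K.ARing R), i ∈ l →
      K.truncList R 1 l (K.s R i * (K.t R i * y)) = 0 := by
    intro l i
    induction l with
    | nil => simp
    | cons j l ih =>
      intro y hi
      rw [truncList_cons]
      by_cases hj : j = i
      · rw [hj, truncA_s_mul_t, map_zero]
      · rw [truncA_s_mul_of_ne hj, truncA_t_mul_of_ne hj]
        exact ih _ ((List.mem_cons.1 hi).resolve_left (Ne.symm hj))
  exact idealB_le (P := (LinearMap.ker (K.truncList R 1 (List.finRange m))).toAddSubgroup)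
    (fun i y => h1 _ i y (List.mem_finRange i)) (fun i y => h2 _ i y (List.mem_finRange i)) hx

theorem sub_truncA_mem_idealB (i : Fin m) (x : K.ARing R) :
    x - K.truncA R i 1 x ∈ K.idealB R := by
  suffices (⊤ : Submodule R (K.ARing R)) ≤ ((K.idealB R).restrictScalars R).comap
    (LinearMap.id - K.truncA R i 1) from this (Submodule.mem_top (x := x))
  suffices (K.bMk R).toLinearMap ∘ₗ (LinearMap.id - K.truncA R i 1) = 0 by
    intro y _
    exact Ideal.Quotient.eq_zero_iff_mem.1 (LinearMap.congr_fun this y)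
  refine A_hom_ext fun a w => ?_
  refine Ideal.Quotient.eq_zero_iff_mem.2 ?_
  rw [LinearMap.sub_apply, LinearMap.id_apply, truncA_tmon]
  have hpos : 0 < a i → a = a - Finsupp.single i 1 + Finsupp.single i 1 := fun h =>
    (tsub_add_cancel_of_le (Finsupp.single_le_iff.2 h)).symm
  split_ifs with h1 h2
  · rw [sub_self]; exact Ideal.zero_mem _
  · rw [extContract_gen_mul_self, TensorProduct.tmul_sub, sub_sub_cancel, hpos (by omega),
      ← s_mul_tmul, ← t_mul_tmon]
    exact s_mul_t_mul_mem_idealB _ _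
  · rw [sub_zero, hpos (by omega), ← t_mul_tmon]
    have : (a - Finsupp.single i 1) =
        a - Finsupp.single i 1 - Finsupp.single i 1 + Finsupp.single i 1 :=
      (tsub_add_cancel_of_le (Finsupp.single_le_iff.2 (by
        rw [Finsupp.tsub_apply, Finsupp.single_eq_same]; omega))).symm
    rw [this, ← t_mul_tmon]
    exact t_sq_mul_mem_idealB _ _

theorem bMk_truncList (l : List (Fin m)) (x : K.ARing R) :
    K.bMk R (K.truncList R 1 l x) = K.bMk R x := by
  induction l generalizing x with
  | nil => rfl
  | cons i l ih =>
    rw [truncList_cons, ih]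
    exact (Ideal.Quotient.eq.2 (sub_truncA_mem_idealB i x)).symm

theorem aRestrict_truncA (h : L ≤ K) (i : Fin m) (k : ℕ) (x : K.ARing R) :
    aRestrict R h (K.truncA R i k x) = L.truncA R i k (aRestrict R h x) := by
  suffices (aRestrict R h).toLinearMap ∘ₗ K.truncA R i k =
    L.truncA R i k ∘ₗ (aRestrict R h).toLinearMap from LinearMap.congr_fun this x
  refine A_hom_ext fun a w => ?_
  simp only [LinearMap.comp_apply, AlgHom.toLinearMap_apply, truncA_tmon, aRestrict_tmul,
    srRestrict_tmon]
  split_ifs <;> simp only [aRestrict_tmul, srRestrict_tmon, map_zero]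

theorem aRestrict_truncList (h : L ≤ K) (k : ℕ) (l : List (Fin m)) (x : K.ARing R) :
    aRestrict R h (K.truncList R k l x) = L.truncList R k l (aRestrict R h x) := by
  induction l generalizing x with
  | nil => rfl
  | cons i l ih => rw [truncList_cons, ih, aRestrict_truncA]; rfl

theorem canDivide_one (i : Fin m) : K.CanDivide i 1 := Or.inl le_rfl

theorem mem_idealB_iff {x : K.ARing R} :
    x ∈ K.idealB R ↔ K.truncList R 1 (List.finRange m) x = 0 := by
  refine ⟨truncList_idealB, fun h => ?_⟩
  refine Ideal.Quotient.eq_zero_iff_mem.1 ?_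
  have := bMk_truncList (K := K) (List.finRange m) x
  rw [h, map_zero] at this
  exact this.symm

/-- The natural projection `A(K) → B(K)` as a morphism of dgas. -/
def projAB (R : Type) [CommRing R] (K : SimplicialComplexOn m) : dgaA R K ⟶ dgaB R K :=
  DGA.ofRingHom (K.bMk R) (fun ha => ⟨_, ha, rfl⟩) (fun _ => rfl)

/-- The element of `A(K)` underlying an element of the dga. -/
def valA {n : ℕ} : (dgaA R K).cx.X n →ₗ[R] K.ARing R := (K.gradeA R n).subtype

/-- The element of `B(K)` underlying an element of the dga. -/
def valB {n : ℕ} : (dgaB R K).cx.X n →ₗ[R] K.BRing R := (K.gradeB R n).subtype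

theorem valA_mem {n : ℕ} (a : (dgaA R K).cx.X n) : valA a ∈ K.gradeA R n := Subtype.prop _

theorem valB_mem {n : ℕ} (b : (dgaB R K).cx.X n) : valB b ∈ K.gradeB R n := Subtype.prop _

theorem valA_injective {n : ℕ} : Function.Injective (valA : (dgaA R K).cx.X n → K.ARing R) :=
  Subtype.val_injective

theorem valB_injective {n : ℕ} : Function.Injective (valB : (dgaB R K).cx.X n → K.BRing R) :=
  Subtype.val_injective

theorem exists_valA {n : ℕ} {x : K.ARing R} (hx : x ∈ K.gradeA R n) :
    ∃ a : (dgaA R K).cx.X n, valA a = x := ⟨(⟨x, hx⟩ : K.gradeA R n), rfl⟩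

theorem exists_valB {n : ℕ} {x : K.BRing R} (hx : x ∈ K.gradeB R n) :
    ∃ b : (dgaB R K).cx.X n, valB b = x := ⟨(⟨x, hx⟩ : K.gradeB R n), rfl⟩

theorem valA_d (n : ℕ) (a : (dgaA R K).cx.X n) :
    valA ((dgaA R K).cx.d n (n + 1) a) = K.dA R (valA a) := by
  simp only [dgaA, DGA.ofRing, CochainComplex.of_d]
  rfl

theorem valB_d (n : ℕ) (b : (dgaB R K).cx.X n) :
    valB ((dgaB R K).cx.d n (n + 1) b) = K.dB R (valB b) := by
  simp only [dgaB, DGA.ofRing, CochainComplex.of_d]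
  rfl

theorem valB_projAB (n : ℕ) (a : (dgaA R K).cx.X n) :
    valB ((projAB R K).toHom.f n a) = K.bMk R (valA a) := rfl

theorem bMk_eq_zero_iff {x : K.ARing R} : K.bMk R x = 0 ↔ x ∈ K.idealB R :=
  Ideal.Quotient.eq_zero_iff_mem

theorem dB_bMk (x : K.ARing R) : K.dB R (K.bMk R x) = K.bMk R (K.dA R x) := rfl

theorem projAB_isQuasiIso (R : Type) [CommRing R] (K : SimplicialComplexOn m) :
    DGA.IsQuasiIso (projAB R K) := by
  obtain ⟨H, h1, h2, h3⟩ := exists_truncList_homotopy (R := R) (K := K) 1 (List.finRange m)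
    (fun i _ => canDivide_one i)
  refine InducesIso.quasiIso ⟨fun n a ha hb => ?_, fun n b hb => ?_⟩
  · have ha' : K.dA R (valA a) = 0 := by rw [← valA_d, ha, map_zero]
    -- a cocycle in the kernel of the projection is the coboundary of its image under the homotopy
    have key : ∀ x ∈ K.idealB R, K.dA R x = 0 → x = K.dA R (H x) := by
      intro x hx hd
      have := h3 x
      rwa [truncList_idealB hx, hd, map_zero, sub_zero, add_zero] at this
    cases n with
    | zero =>
      have hz : valA a ∈ K.idealB R := by
        rw [← bMk_eq_zero_iff, ← valB_projAB, isCoboundary_degree_zero hb, map_zero]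
      have : a = 0 := valA_injective (by
        rw [key _ hz ha', h2 _ (valA_mem a), map_zero, map_zero])
      rw [this]
      exact isCoboundary_zero 0
    | succ n =>
      obtain ⟨b, hb⟩ := isCoboundary_succ hb
      obtain ⟨c, hc, hcb⟩ := valB_mem b
      rw [AlgHom.toLinearMap_apply] at hcb
      have hz : valA a - K.dA R c ∈ K.idealB R := by
        rw [← bMk_eq_zero_iff, map_sub, ← valB_projAB, ← hb, valB_d, ← hcb, dB_bMk, sub_self]
      have e := key _ hz (by rw [map_sub, ha', dA_dA, sub_zero])
      obtain ⟨y, hy⟩ := exists_valA (Submodule.add_mem _ hc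
        (h1 n _ (Submodule.sub_mem _ (valA_mem a) (dA_mem hc))))
      refine ⟨n, y, valA_injective ?_⟩
      rw [valA_d, hy, map_add, ← e, add_sub_cancel]
  · obtain ⟨c, hc, hcb⟩ := valB_mem b
    rw [AlgHom.toLinearMap_apply] at hcb
    have hdc : K.dA R c ∈ K.idealB R := by
      rw [← bMk_eq_zero_iff, ← dB_bMk, hcb, ← valB_d, hb, map_zero]
    obtain ⟨y, hy⟩ := exists_valA (truncList_mem 1 (List.finRange m)
      (fun i _ => canDivide_one i) hc)
    refine ⟨y, valA_injective ?_, ?_⟩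
    · rw [valA_d, hy, ← truncList_dA 1 _ (fun i _ => canDivide_one i), truncList_idealB hdc,
        map_zero]
    · convert isCoboundary_zero n
      refine sub_eq_zero.2 (valB_injective ?_)
      rw [valB_projAB, hy, bMk_truncList, hcb]

/-! ### Mayer-Vietoris for `B` -/

/-- The linear extension `A(L) → A(K)` sending monomials to monomials. -/
def aExtend (R : Type) [CommRing R] (K L : SimplicialComplexOn m) : L.ARing R →ₗ[R] K.ARing R :=
  TensorProduct.map (srDesc L (open Classical in fun a => if a.support ∈ L.faces then K.tmon R a
    else 0) fun _ ha => if_neg ha) LinearMap.id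

theorem aExtend_tmon (a : Fin m →₀ ℕ) (w : ExteriorAlgebra R (Fin m → R)) :
    aExtend R K L (L.tmon R a ⊗ₜ w) =
      (open Classical in if a.support ∈ L.faces then K.tmon R a ⊗ₜ w else 0) := by
  rw [aExtend, TensorProduct.map_tmul, srDesc_tmon]
  split_ifs
  · rfl
  · rw [TensorProduct.zero_tmul]

theorem aExtend_mem {n : ℕ} {x : L.ARing R} (hx : x ∈ L.gradeA R n) :
    aExtend R K L x ∈ K.gradeA R n := by
  suffices L.gradeA R n ≤ (K.gradeA R n).comap (aExtend R K L) from this hx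
  rw [gradeA_eq_span n]
  refine Submodule.span_le.2 ?_
  rintro _ ⟨a, j, hn, w, hw, rfl⟩
  rw [SetLike.mem_coe, Submodule.mem_comap, aExtend_tmon]
  split_ifs
  · exact tmon_tmul_mem hn hw
  · exact Submodule.zero_mem _

variable {M N : SimplicialComplexOn m}

theorem aExtend_decomposition (hL : L ≤ K) (hM : M ≤ K) (hN : N ≤ K)
    (hLM : K.faces ⊆ L.faces ∪ M.faces) (hN' : N.faces = L.faces ∩ M.faces) (x : K.ARing R) :
    x = aExtend R K L (aRestrict R hL x) + aExtend R K M (aRestrict R hM x) -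
      aExtend R K N (aRestrict R hN x) := by
  suffices LinearMap.id = aExtend R K L ∘ₗ (aRestrict R hL).toLinearMap +
      aExtend R K M ∘ₗ (aRestrict R hM).toLinearMap -
      aExtend R K N ∘ₗ (aRestrict R hN).toLinearMap from LinearMap.congr_fun this x
  refine A_hom_ext fun a w => ?_
  have hmem : a.support ∈ N.faces ↔ a.support ∈ L.faces ∧ a.support ∈ M.faces := by rw [hN']; rfl
  simp only [LinearMap.sub_apply, LinearMap.add_apply, LinearMap.comp_apply, LinearMap.id_apply,
    AlgHom.toLinearMap_apply, aRestrict_tmul, srRestrict_tmon, aExtend_tmon]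
  by_cases h1 : a.support ∈ L.faces <;> by_cases h2 : a.support ∈ M.faces <;> simp [h1, h2, hmem]
  rw [tmon_eq_zero fun h => (hLM h).elim h1 h2, TensorProduct.zero_tmul]

theorem aRestrict_aExtend (hL : L ≤ K) (hN' : N.faces = L.faces ∩ M.faces)
    (hNM : N ≤ M) (x : M.ARing R) :
    aRestrict R hL (aExtend R K M x) = aExtend R L N (aRestrict R hNM x) := by
  suffices (aRestrict R hL).toLinearMap ∘ₗ aExtend R K M =
    aExtend R L N ∘ₗ (aRestrict R hNM).toLinearMap from LinearMap.congr_fun this x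
  refine A_hom_ext fun a w => ?_
  have hmem : a.support ∈ N.faces ↔ a.support ∈ L.faces ∧ a.support ∈ M.faces := by rw [hN']; rfl
  simp only [LinearMap.comp_apply,
    AlgHom.toLinearMap_apply, aRestrict_tmul, srRestrict_tmon, aExtend_tmon]
  by_cases h1 : a.support ∈ L.faces <;> by_cases h2 : a.support ∈ M.faces <;>
    simp [h1, h2, hmem, aRestrict_tmul, srRestrict_tmon]
  rw [tmon_eq_zero h1, TensorProduct.zero_tmul]

theorem aRestrict_aExtend_self (hL : L ≤ K) (x : L.ARing R) :
    aRestrict R hL (aExtend R K L x) = x := by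
  suffices (aRestrict R hL).toLinearMap ∘ₗ aExtend R K L = LinearMap.id from
    LinearMap.congr_fun this x
  refine A_hom_ext fun a w => ?_
  simp only [LinearMap.comp_apply, AlgHom.toLinearMap_apply, aExtend_tmon, LinearMap.id_apply]
  split_ifs with h
  · rfl
  · rw [tmon_eq_zero h, TensorProduct.zero_tmul, map_zero]

theorem valB_restrict {K L : (SimplicialComplexOn m)ᵒᵖ} (f : K ⟶ L) {n : ℕ}
    (b : (dgaB R K.unop).cx.X n) :
    valB (((functorB R m).map f).toHom.f n b) = bRestrict R (leOfHom f.unop) (valB b) := rfl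

/-- `B` turns a union `K = L ∪ M` with `N = L ∩ M` into a Mayer-Vietoris square. Since `truncList`
embeds `B` naturally into `A`, this reduces to the analogous statement for `A`, where it follows by
inclusion-exclusion. -/
theorem functorB_isMayerVietoris (hL : L ≤ K) (hM : M ≤ K) (hNL : N ≤ L) (hNM : N ≤ M)
    (hLM : K.faces ⊆ L.faces ∪ M.faces) (hN : N.faces = L.faces ∩ M.faces) :
    IsMayerVietoris ((functorB R m).map (homOfLE hL).op).toHom
      ((functorB R m).map (homOfLE hM).op).toHom ((functorB R m).map (homOfLE hNL).op).toHom
      ((functorB R m).map (homOfLE hNM).op).toHom := by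
  have hT : ∀ {P Q : SimplicialComplexOn m} (h : Q ≤ P) (x : P.ARing R),
      bRestrict R h (P.bMk R x) = 0 →
      aRestrict R h (P.truncList R 1 (List.finRange m) x) = 0 := by
    intro P Q h x hx
    rw [bRestrict_mk, bMk_eq_zero_iff, mem_idealB_iff] at hx
    rw [aRestrict_truncList, hx]
  refine ⟨?_, fun n b h1 h2 => ?_, fun n b c h => ?_, fun n b => ?_⟩
  · have : (functorB R m).map (homOfLE hL).op ≫ (functorB R m).map (homOfLE hNL).op =
        (functorB R m).map (homOfLE hM).op ≫ (functorB R m).map (homOfLE hNM).op := by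
      rw [← Functor.map_comp, ← Functor.map_comp]; rfl
    exact congrArg DGA.Hom.toHom this
  · obtain ⟨x, -, hx⟩ := valB_mem b
    rw [AlgHom.toLinearMap_apply] at hx
    have h1 := hT hL x (by
      rw [hx]
      exact (valB_restrict (homOfLE hL).op b).symm.trans ((congrArg valB h1).trans (map_zero _)))
    have h2 := hT hM x (by
      rw [hx]
      exact (valB_restrict (homOfLE hM).op b).symm.trans ((congrArg valB h2).trans (map_zero _)))
    have := aExtend_decomposition (R := R) hL hM (hNL.trans hL) hLM hN
      (K.truncList R 1 (List.finRange m) x)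
    rw [← aRestrict_comp hL hNL, h1, h2] at this
    simp only [map_zero, add_zero, sub_zero] at this
    refine valB_injective (hx.symm.trans (Eq.trans ?_ (map_zero valB).symm))
    rw [← bMk_truncList (List.finRange m), this, map_zero]
  · obtain ⟨x, hx, hxb⟩ := valB_mem b
    obtain ⟨y, hy, hyc⟩ := valB_mem c
    rw [AlgHom.toLinearMap_apply] at hxb hyc
    set x' := L.truncList R 1 (List.finRange m) x with hx'
    set y' := M.truncList R 1 (List.finRange m) y with hy'
    have hxy : aRestrict R hNL x' = aRestrict R hNM y' := by
      have h := congrArg valB h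
      have h3 : bRestrict R hNL (L.bMk R x) = bRestrict R hNM (M.bMk R y) := by
        rw [hxb, hyc]
        exact (valB_restrict (homOfLE hNL).op b).symm.trans
          (h.trans (valB_restrict (homOfLE hNM).op c))
      rw [bRestrict_mk, bRestrict_mk, ← sub_eq_zero, ← map_sub, bMk_eq_zero_iff,
        mem_idealB_iff, map_sub, sub_eq_zero] at h3
      rw [hx', hy', aRestrict_truncList, aRestrict_truncList, h3]
    have hx'' : x' ∈ L.gradeA R n := truncList_mem 1 _ (fun i _ => canDivide_one i) hx
    have hy'' : y' ∈ M.gradeA R n := truncList_mem 1 _ (fun i _ => canDivide_one i) hy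
    obtain ⟨z, hz⟩ := exists_valB (K := K) (R := R) (n := n)
      ⟨aExtend R K L x' + aExtend R K M y' - aExtend R K N (aRestrict R hNL x'),
        Submodule.sub_mem _ (Submodule.add_mem _ (aExtend_mem hx'') (aExtend_mem hy''))
          (aExtend_mem (aRestrict_mem _ hx'')), rfl⟩
    rw [AlgHom.toLinearMap_apply] at hz
    refine ⟨z, valB_injective ?_, valB_injective ?_⟩
    · refine (valB_restrict (homOfLE hL).op z).trans ?_
      rw [hz, bRestrict_mk, map_sub, map_add, aRestrict_aExtend_self,
        aRestrict_aExtend hL hN hNM, aRestrict_aExtend hL (N := N) (M := N)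
        (by rw [Set.inter_eq_right.2 hNL]) le_rfl, aRestrict_id, hxy, add_sub_cancel_right, hx',
        bMk_truncList, hxb]
    · refine (valB_restrict (homOfLE hM).op z).trans ?_
      rw [hz, bRestrict_mk, map_sub, map_add, aRestrict_aExtend_self,
        aRestrict_aExtend hM (by rw [hN, Set.inter_comm]) hNL,
        aRestrict_aExtend hM (N := N) (M := N)
        (by rw [Set.inter_eq_right.2 hNM]) le_rfl, aRestrict_id, add_sub_cancel_left, hy',
        bMk_truncList, hyc]
  · obtain ⟨x, hx, hxb⟩ := valB_mem b
    obtain ⟨z, hz⟩ := exists_valB (K := M) (R := R) (n := n) ⟨aExtend R M N x, aExtend_mem hx, rfl⟩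
    refine ⟨z, valB_injective ?_⟩
    refine (valB_restrict (homOfLE hNM).op z).trans ?_
    rw [hz, AlgHom.toLinearMap_apply, bRestrict_mk, aRestrict_aExtend_self]
    exact hxb

end

end SimplicialComplexOn

/-! ### Singular simplices subordinate to a family of subsets -/

namespace SingularCochains

noncomputable section

section Cochain

variable {R : Type} [CommRing R] {S T : SSet.{0}}

/-- The function on simplices underlying a normalized cochain. -/
def toFun {n : ℕ} : (dga R S).cx.X n →ₗ[R] (S _⦋n⦌ → R) := (normalizedCochains R S n).subtype

theorem toFun_injective {n : ℕ} :
    Function.Injective (toFun : (dga R S).cx.X n → (S _⦋n⦌ → R)) := Subtype.val_injective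

theorem toFun_degenerate {n : ℕ} (γ : (dga R S).cx.X n) {x : S _⦋n⦌} (hx : x ∈ S.degenerate n) :
    toFun γ x = 0 := γ.2 x hx

theorem exists_toFun {n : ℕ} {f : S _⦋n⦌ → R} (hf : f ∈ normalizedCochains R S n) :
    ∃ γ : (dga R S).cx.X n, toFun γ = f := ⟨(⟨f, hf⟩ : normalizedCochains R S n), rfl⟩

theorem toFun_d (n : ℕ) (γ : (dga R S).cx.X n) :
    toFun ((dga R S).cx.d n (n + 1) γ) = coboundaryFun R S n (toFun γ) := by
  simp only [dga, CochainComplex.of_d]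
  rfl

theorem toFun_d_apply (n : ℕ) (γ : (dga R S).cx.X n) (x : S _⦋n + 1⦌) :
    toFun ((dga R S).cx.d n (n + 1) γ) x =
      -(-1) ^ n * ∑ i : Fin (n + 2), (-1) ^ (i : ℕ) * toFun γ (S.δ i x) := by
  rw [toFun_d]; rfl

theorem toFun_one (x : S _⦋0⦌) : toFun (dga R S).one x = 1 := rfl

theorem toFun_mul {p q n : ℕ} (h : p + q = n) (a : (dga R S).cx.X p) (b : (dga R S).cx.X q)
    (x : S _⦋n⦌) : toFun ((dga R S).mul h a b) x = (-1) ^ (p * q) *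
      (toFun a (S.map (frontFace h).op x) * toFun b (S.map (backFace h).op x)) := rfl

/-- Pull-back of normalized cochains, as a map of complexes. -/
def pull (R : Type) [CommRing R] (f : S ⟶ T) : (dga R T).cx ⟶ (dga R S).cx :=
  ((functor R).map f.op).toHom

theorem toFun_pull (f : S ⟶ T) {n : ℕ} (γ : (dga R T).cx.X n) (x : S _⦋n⦌) :
    toFun ((pull R f).f n γ) x = toFun γ (f.app _ x) := rfl

end Cochain

/-- The continuous map of standard simplices induced by a map of vertices. -/
def simplexMap {a b : SimplexCategory} (f : a ⟶ b) :
    C(stdSimplex ℝ (Fin (a.len + 1)), stdSimplex ℝ (Fin (b.len + 1))) :=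
  ⟨stdSimplex.map f.toOrderHom, stdSimplex.continuous_map _⟩

theorem simplexMap_comp {a b c : SimplexCategory} (f : a ⟶ b) (g : b ⟶ c) :
    (simplexMap g).comp (simplexMap f) = simplexMap (f ≫ g) :=
  ContinuousMap.ext fun τ =>
    stdSimplex.map_comp_apply (f.toOrderHom : Fin (a.len + 1) → Fin (b.len + 1))
      (g.toOrderHom : Fin (b.len + 1) → Fin (c.len + 1)) τ

theorem simplexMap_id (a : SimplexCategory) : simplexMap (𝟙 a) = ContinuousMap.id _ :=
  ContinuousMap.ext fun τ => stdSimplex.map_id_apply τ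

variable {X Y : Type} [TopologicalSpace X] [TopologicalSpace Y]

/-- The simplicial set of those singular simplices in `X` that lie in some member of `𝒰`. -/
def small (𝒰 : Set (Set X)) : SSet.{0} where
  obj Δ := {x : C(stdSimplex ℝ (Fin (Δ.unop.len + 1)), X) // ∃ U ∈ 𝒰, ∀ τ, x τ ∈ U}
  map f := ↾fun x => ⟨x.1.comp (simplexMap f.unop), x.2.imp fun _ h => ⟨h.1, fun _ => h.2 _⟩⟩
  map_id Δ := TypeCat.Hom.ext (TypeCat.Fun.ext (funext fun x => Subtype.ext
    ((congrArg x.1.comp (simplexMap_id Δ.unop)).trans (ContinuousMap.comp_id _))))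
  map_comp f g := TypeCat.Hom.ext (TypeCat.Fun.ext (funext fun x => Subtype.ext
    (congrArg x.1.comp (simplexMap_comp g.unop f.unop)).symm))

variable {𝒰 : Set (Set X)} {𝒱 : Set (Set Y)}

/-- A singular simplex that lies in a member of `𝒰`, as a simplex of `small 𝒰`. -/
def mkSmall {n : ℕ} (x : C(stdSimplex ℝ (Fin (n + 1)), X)) (h : ∃ U ∈ 𝒰, ∀ τ, x τ ∈ U) :
    (small 𝒰) _⦋n⦌ := ⟨x, h⟩

theorem small_map_val {a b : ℕ} (f : ⦋a⦌ ⟶ ⦋b⦌) (x : (small 𝒰) _⦋b⦌) :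
    ((small 𝒰).map f.op x).1 = x.1.comp (simplexMap f) := rfl

theorem small_δ_val {n : ℕ} (i : Fin (n + 2)) (x : (small 𝒰) _⦋n + 1⦌) :
    ((small 𝒰).δ i x).1 = x.1.comp (simplexMap (SimplexCategory.δ i)) := rfl

/-- The map of simplicial sets induced by a continuous map sending each member of `𝒰` into a member
of `𝒱`. -/
def smallMap (f : C(X, Y)) (h : ∀ U ∈ 𝒰, ∃ V ∈ 𝒱, Set.MapsTo f U V) : small 𝒰 ⟶ small 𝒱 where
  app Δ := ↾fun x => ⟨f.comp x.1, by
    obtain ⟨U, hU, hx⟩ := x.2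
    obtain ⟨V, hV, hf⟩ := h U hU
    exact ⟨V, hV, fun τ => hf (hx τ)⟩⟩
  naturality _ _ _ := rfl

/-- The inclusion of the simplices subordinate to `𝒰` into those subordinate to `𝒱`, if `𝒰` refines
`𝒱`. -/
def smallIncl {𝒰 𝒱 : Set (Set X)} (h : ∀ U ∈ 𝒰, ∃ V ∈ 𝒱, U ⊆ V) : small 𝒰 ⟶ small 𝒱 :=
  smallMap (ContinuousMap.id X) h

/-- The value of a cochain on an arbitrary singular simplex, extended by `0`. -/
def value {R : Type} [CommRing R] {n : ℕ} (γ : (dga R (small 𝒰)).cx.X n)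
    (x : C(stdSimplex ℝ (Fin (n + 1)), X)) : R :=
  open Classical in if h : ∃ U ∈ 𝒰, ∀ τ, x τ ∈ U then toFun γ (mkSmall x h) else 0

section Value

variable {R : Type} [CommRing R] {n : ℕ}

theorem value_val (γ : (dga R (small 𝒰)).cx.X n) (x : (small 𝒰) _⦋n⦌) : value γ x.1 = toFun γ x :=
  dif_pos x.2

theorem value_of_mem (γ : (dga R (small 𝒰)).cx.X n) {x : C(stdSimplex ℝ (Fin (n + 1)), X)}
    (h : ∃ U ∈ 𝒰, ∀ τ, x τ ∈ U) : value γ x = toFun γ (mkSmall x h) := dif_pos h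

theorem value_add (γ γ' : (dga R (small 𝒰)).cx.X n) (x : C(stdSimplex ℝ (Fin (n + 1)), X)) :
    value (γ + γ') x = value γ x + value γ' x := by
  unfold value
  split_ifs
  · rw [map_add]; rfl
  · rw [add_zero]

/-- A cochain vanishes on a simplex that factors through a degeneracy. -/
theorem value_degenerate (γ : (dga R (small 𝒰)).cx.X (n + 1))
    {x : C(stdSimplex ℝ (Fin (n + 2)), X)} (i : Fin (n + 1))
    (hx : (x.comp (simplexMap (SimplexCategory.δ i.castSucc))).comp
      (simplexMap (SimplexCategory.σ i)) = x) : value γ x = 0 := by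
  unfold value
  split_ifs with h
  · refine toFun_degenerate γ ?_
    have : (mkSmall x h : (small 𝒰) _⦋n + 1⦌) =
        (small 𝒰).σ i ((small 𝒰).δ i.castSucc (mkSmall x h)) := Subtype.ext hx.symm
    rw [this]
    exact (small 𝒰).σ_mem_degenerate _ _
  · rfl

theorem value_d (γ : (dga R (small 𝒰)).cx.X n) {x : C(stdSimplex ℝ (Fin (n + 2)), X)}
    (h : ∃ U ∈ 𝒰, ∀ τ, x τ ∈ U) : value ((dga R (small 𝒰)).cx.d n (n + 1) γ) x =
      -(-1) ^ n * ∑ i : Fin (n + 2), (-1) ^ (i : ℕ) *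
        value γ (x.comp (simplexMap (SimplexCategory.δ i))) := by
  rw [value_of_mem _ h, toFun_d_apply]
  congr 1
  refine Finset.sum_congr rfl fun i _ => ?_
  rw [← value_val, small_δ_val]
  rfl

theorem value_mul {p q : ℕ} (e : p + q = n) (a : (dga R (small 𝒰)).cx.X p)
    (b : (dga R (small 𝒰)).cx.X q) {x : C(stdSimplex ℝ (Fin (n + 1)), X)}
    (h : ∃ U ∈ 𝒰, ∀ τ, x τ ∈ U) : value ((dga R (small 𝒰)).mul e a b) x =
      (-1) ^ (p * q) * (value a (x.comp (simplexMap (frontFace e))) *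
        value b (x.comp (simplexMap (backFace e)))) := by
  rw [value_of_mem _ h, toFun_mul, ← value_val, ← value_val, small_map_val, small_map_val]
  rfl

theorem value_map (f : C(X, Y)) (h : ∀ U ∈ 𝒰, ∃ V ∈ 𝒱, Set.MapsTo f U V)
    (γ : (dga R (small 𝒱)).cx.X n) {x : C(stdSimplex ℝ (Fin (n + 1)), X)}
    (hx : ∃ U ∈ 𝒰, ∀ τ, x τ ∈ U) :
    value ((pull R (smallMap f h)).f n γ) x = value γ (f.comp x) := by
  rw [value_of_mem _ hx]
  exact (value_val γ ((smallMap f h).app _ (mkSmall x hx))).symm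

theorem value_incl {𝒰 𝒱 : Set (Set X)} (h : ∀ U ∈ 𝒰, ∃ V ∈ 𝒱, U ⊆ V)
    (γ : (dga R (small 𝒱)).cx.X n) {x : C(stdSimplex ℝ (Fin (n + 1)), X)}
    (hx : ∃ U ∈ 𝒰, ∀ τ, x τ ∈ U) : value ((pull R (smallIncl h)).f n γ) x = value γ x :=
  value_map (ContinuousMap.id X) h γ hx

end Value

/-! ### Partial sums of barycentric coordinates -/

/-- The sum of the first `k + 1` barycentric coordinates. -/
def partialSum {n : ℕ} (k : Fin n) (τ : stdSimplex ℝ (Fin (n + 1))) : NNReal :=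
  ⟨∑ l : Fin (n + 1), if l.val ≤ k.val then τ l else 0,
    Finset.sum_nonneg fun l _ => by split_ifs; exacts [τ.2.1 l, le_rfl]⟩

theorem partialSum_coe {n : ℕ} (k : Fin n) (τ : stdSimplex ℝ (Fin (n + 1))) :
    (partialSum k τ : ℝ) = ∑ l : Fin (n + 1), if l.val ≤ k.val then τ l else 0 := rfl

theorem partialSum_le_one {n : ℕ} (k : Fin n) (τ : stdSimplex ℝ (Fin (n + 1))) :
    partialSum k τ ≤ 1 := by
  rw [← NNReal.coe_le_coe, partialSum_coe, NNReal.coe_one, ← τ.2.2]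
  exact Finset.sum_le_sum fun l _ => by split_ifs; exacts [le_rfl, τ.2.1 l]

theorem continuous_partialSum {n : ℕ} (k : Fin n) : Continuous (partialSum k) := by
  refine Continuous.subtype_mk (continuous_finsetSum _ fun l _ => ?_) _
  split_ifs
  · exact (continuous_apply l).comp continuous_subtype_val
  · exact continuous_const

theorem partialSum_map {a b : ℕ} (f : ⦋a⦌ ⟶ ⦋b⦌) (k : Fin b) (τ : stdSimplex ℝ (Fin (a + 1))) :
    (partialSum k (simplexMap f τ) : ℝ) =
      ∑ j : Fin (a + 1), if (f.toOrderHom j).val ≤ k.val then τ j else 0 := by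
  rw [partialSum_coe]
  have h : ∀ l, simplexMap f τ l = ∑ j : Fin (a + 1), if f.toOrderHom j = l then τ j else 0 := by
    intro l
    change FunOnFinite.linearMap ℝ ℝ _ τ.1 l = _
    rw [FunOnFinite.linearMap_apply_apply, Finset.sum_filter]
    rfl
  simp only [h, ← Finset.sum_filter]
  rw [Finset.sum_filter, Finset.sum_filter]
  simp only [Finset.sum_filter]
  have : ∀ l : Fin (b + 1), (if l.val ≤ k.val then
      ∑ j : Fin (a + 1), (if f.toOrderHom j = l then τ j else 0) else 0) =
      ∑ j : Fin (a + 1), if f.toOrderHom j = l then (if l.val ≤ k.val then τ j else 0) else 0 := by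
    intro l
    split_ifs <;> simp
  simp only [this]
  rw [Finset.sum_comm]
  refine Finset.sum_congr rfl fun j _ => ?_
  rw [Finset.sum_ite_eq]
  simp

end

end SingularCochains

/-! ### The element of `A(K)` attached to a word -/

namespace SimplicialComplexOn

noncomputable section

variable {R : Type} [CommRing R] {m : ℕ} {K L : SimplicialComplexOn m}

/-- The operator `s j + t j * ∂ / ∂ s j`. It agrees with multiplication by `s j` on elements without
`s j`, and sends `s j` to `t j`. -/
def letterOp (R : Type) [CommRing R] (K : SimplicialComplexOn m) (j : Fin m) :
    K.ARing R →ₗ[R] K.ARing R :=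
  LinearMap.mulLeft R (K.s R j) + LinearMap.mulLeft R (K.t R j) ∘ₗ K.contractA R j

theorem letterOp_apply (j : Fin m) (x : K.ARing R) :
    K.letterOp R j x = K.s R j * x + K.t R j * K.contractA R j x := rfl

theorem letterOp_anticomm {i j : Fin m} (h : i ≠ j) (x : K.ARing R) :
    K.letterOp R i (K.letterOp R j x) = - K.letterOp R j (K.letterOp R i x) := by
  simp only [letterOp_apply, map_add, contractA_s_mul_of_ne h, contractA_s_mul_of_ne h.symm,
    contractA_t_mul, s_mul_s i j, contractA_comm i j, s_mul_t_mul, t_mul_t_mul i j, mul_neg]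
  abel

theorem letterOp_t_mul (i j : Fin m) (x : K.ARing R) :
    K.letterOp R i (K.t R j * x) = K.t R j * K.letterOp R i x := by
  simp only [letterOp_apply, contractA_t_mul, s_mul_t_mul, t_mul_t_mul i j, mul_add]

theorem contractA_idealB (i : Fin m) {x : K.ARing R} (hx : x ∈ K.idealB R) :
    K.t R i * K.contractA R i x ∈ K.idealB R := by
  let P : AddSubgroup (K.ARing R) :=
    { carrier := {y | K.t R i * K.contractA R i y ∈ K.idealB R}
      zero_mem' := by rw [Set.mem_ofPred_eq, map_zero, mul_zero]; exact Submodule.zero_mem _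
      add_mem' := fun {y z} hy hz => by
        rw [Set.mem_ofPred_eq, map_add, mul_add]; exact Submodule.add_mem _ hy hz
      neg_mem' := fun {y} hy => by
        rw [Set.mem_ofPred_eq, map_neg, mul_neg]; exact Submodule.neg_mem _ hy }
  have hP : ∀ y, y ∈ P ↔ K.t R i * K.contractA R i y ∈ K.idealB R := fun y => Iff.rfl
  refine (hP x).1 (idealB_le (P := P) (fun j y => (hP _).2 ?_) (fun j y => (hP _).2 ?_) hx)
  · rw [contractA_t_mul, contractA_t_mul]
    exact Ideal.mul_mem_left _ _ (t_sq_mul_mem_idealB _ _)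
  · by_cases h : i = j
    · subst h
      rw [contractA_s_mul_self, mul_sub]
      exact Submodule.sub_mem _ (t_sq_mul_mem_idealB _ _) (Ideal.mul_mem_left _ _ (by
        rw [contractA_t_mul]; exact s_mul_t_mul_mem_idealB _ _))
    · rw [contractA_s_mul_of_ne h, contractA_t_mul]
      exact Ideal.mul_mem_left _ _ (neg_mem (s_mul_t_mul_mem_idealB _ _))

theorem letterOp_idealB (i : Fin m) {x : K.ARing R} (hx : x ∈ K.idealB R) :
    K.letterOp R i x ∈ K.idealB R := by
  rw [letterOp_apply]
  exact Submodule.add_mem _ (Ideal.mul_mem_left _ _ hx) (contractA_idealB i hx)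

theorem letterOp_t_mul_self (i : Fin m) (x : K.ARing R) :
    K.letterOp R i (K.t R i * x) ∈ K.idealB R := by
  rw [letterOp_apply, contractA_t_mul]
  exact Submodule.add_mem _ (s_mul_t_mul_mem_idealB _ _) (t_sq_mul_mem_idealB _ _)

theorem letterOp_mem (i : Fin m) {n : ℕ} {x : K.ARing R} (hx : x ∈ K.gradeA R n) :
    K.letterOp R i x ∈ K.gradeA R (n + 1) := by
  rw [letterOp_apply]
  refine Submodule.add_mem _ (by rw [add_comm n]; exact mul_mem_gradeA (s_mem i) hx) ?_
  cases n with
  | zero => rw [contractA_mem_zero i hx, mul_zero]; exact Submodule.zero_mem _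
  | succ n =>
    have := mul_mem_gradeA (t_mem (R := R) (K := K) i) (contractA_mem i hx)
    rwa [show 2 + n = n + 1 + 1 by omega] at this

theorem aRestrict_contractA (h : L ≤ K) (i : Fin m) (x : K.ARing R) :
    aRestrict R h (K.contractA R i x) = L.contractA R i (aRestrict R h x) := by
  induction x using TensorProduct.induction_on with
  | zero => simp
  | add x y hx hy => simp only [map_add, hx, hy]
  | tmul f w => rw [contractA_tmul, aRestrict_tmul, aRestrict_tmul, contractA_tmul]

theorem aRestrict_letterOp (h : L ≤ K) (i : Fin m) (x : K.ARing R) :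
    aRestrict R h (K.letterOp R i x) = L.letterOp R i (aRestrict R h x) := by
  simp only [letterOp_apply, map_add, map_mul, aRestrict_s, aRestrict_t, aRestrict_contractA]

/-- The element of `A(K)` attached to a word. A word without repetitions gives the product of the
corresponding `s j`; the second occurrence of a letter `j` turns `s j` into `± t j`. -/
def listMono (R : Type) [CommRing R] (K : SimplicialComplexOn m) (l : List (Fin m)) : K.ARing R :=
  l.foldr (fun j x => K.letterOp R j x) 1

theorem listMono_nil : K.listMono R [] = 1 := rfl

theorem listMono_cons (j : Fin m) (l : List (Fin m)) :
    K.listMono R (j :: l) = K.letterOp R j (K.listMono R l) := rfl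

theorem listMono_mem (l : List (Fin m)) : K.listMono R l ∈ K.gradeA R l.length := by
  induction l with
  | nil => exact one_mem_gradeA R K
  | cons j l ih => exact letterOp_mem j ih

theorem aRestrict_listMono (h : L ≤ K) (l : List (Fin m)) :
    aRestrict R h (K.listMono R l) = L.listMono R l := by
  induction l with
  | nil => exact map_one _
  | cons j l ih => rw [listMono_cons, aRestrict_letterOp, ih, listMono_cons]

theorem contractA_listMono {j : Fin m} {l : List (Fin m)} (h : j ∉ l) :
    K.contractA R j (K.listMono R l) = 0 := by
  induction l with
  | nil => exact contractA_one j
  | cons i l ih =>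
    rw [List.mem_cons, not_or] at h
    rw [listMono_cons, letterOp_apply, map_add, contractA_s_mul_of_ne h.1, contractA_t_mul,
      contractA_comm, ih h.2]
    simp

theorem listMono_append {l l' : List (Fin m)} (h : ∀ j ∈ l, j ∉ l') :
    K.listMono R (l ++ l') = K.listMono R l * K.listMono R l' := by
  induction l with
  | nil => rw [List.nil_append, listMono_nil, one_mul]
  | cons i l ih =>
    rw [List.cons_append, listMono_cons, ih fun j hj => h j (List.mem_cons_of_mem _ hj),
      listMono_cons, letterOp_apply, letterOp_apply, contractA_mul,
      contractA_listMono (h i List.mem_cons_self), mul_zero, add_zero, add_mul, mul_assoc, mul_assoc]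

/-- If `j` occurs in a word, then each term of the corresponding element contains `s j` or `t j`. -/
theorem exists_listMono_of_mem {j : Fin m} {l : List (Fin m)} (h : j ∈ l) :
    ∃ x y, K.listMono R l = K.s R j * x + K.t R j * y := by
  induction l with
  | nil => simp at h
  | cons i l ih =>
    by_cases hij : j = i
    · subst hij
      exact ⟨_, _, rfl⟩
    · obtain ⟨x, y, hxy⟩ := ih ((List.mem_cons.1 h).resolve_left hij)
      refine ⟨-(K.letterOp R i x), K.letterOp R i y, ?_⟩
      rw [listMono_cons, hxy, map_add, letterOp_t_mul]
      congr 1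
      rw [letterOp_apply, letterOp_apply, contractA_s_mul_of_ne (Ne.symm hij), s_mul_s i j, mul_neg,
        mul_neg, mul_add, neg_add, s_mul_t_mul]

theorem s_mul_listMono_mem_idealB {j : Fin m} {l : List (Fin m)} (h : j ∈ l) :
    K.s R j * K.listMono R l ∈ K.idealB R := by
  obtain ⟨x, y, hxy⟩ := exists_listMono_of_mem (R := R) (K := K) h
  rw [hxy, mul_add, s_mul_s_self, zero_add]
  exact s_mul_t_mul_mem_idealB _ _

theorem listMono_mul_mem_idealB {j : Fin m} {l l' : List (Fin m)} (h : j ∈ l) (h' : j ∈ l') :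
    K.listMono R l * K.listMono R l' ∈ K.idealB R := by
  obtain ⟨x, y, hxy⟩ := exists_listMono_of_mem (R := R) (K := K) h
  obtain ⟨x', y', hxy'⟩ := exists_listMono_of_mem (R := R) (K := K) h'
  have e1 : K.s R j * x * (K.s R j * x') = 0 := by
    rw [mul_assoc, ← mul_assoc x, mul_s, mul_assoc, s_mul_s_self]
  have e2 : K.s R j * x * (K.t R j * y') = K.s R j * (K.t R j * (x * y')) := by
    rw [mul_assoc, ← mul_assoc x, t_mul_comm, mul_assoc]
  have e3 : K.t R j * y * (K.s R j * x') = K.s R j * (K.t R j * (K.AInv R y * x')) := by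
    rw [mul_assoc, ← mul_assoc y, mul_s, s_mul_t_mul, mul_assoc]
  have e4 : K.t R j * y * (K.t R j * y') = K.t R j * (K.t R j * (y * y')) := by
    rw [mul_assoc, ← mul_assoc y, t_mul_comm, mul_assoc]
  rw [hxy, hxy', add_mul, mul_add, mul_add, e1, e2, e3, e4, zero_add]
  exact Submodule.add_mem _ (s_mul_t_mul_mem_idealB _ _)
    (Submodule.add_mem _ (s_mul_t_mul_mem_idealB _ _) (t_sq_mul_mem_idealB _ _))

theorem listMono_concat {j : Fin m} {l : List (Fin m)} (h : j ∉ l) :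
    K.listMono R (l ++ [j]) = (-1 : R) ^ l.length • (K.s R j * K.listMono R l) := by
  have e : K.listMono R [j] = K.s R j := by
    rw [listMono_cons, listMono_nil, letterOp_apply, contractA_one, mul_zero, add_zero, mul_one]
  rw [listMono_append fun i hi => by rw [List.mem_singleton]; rintro rfl; exact h hi, e, mul_s,
    AInv_mem (listMono_mem l), mul_smul_comm]

theorem dA_listMono (l : List (Fin m)) : K.dA R (K.listMono R l) =
    ∑ j, (K.listMono R (j :: l) - K.s R j * K.listMono R l) := by
  rw [dA_eq_sum]
  refine Finset.sum_congr rfl fun j _ => ?_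
  rw [listMono_cons, letterOp_apply, add_sub_cancel_left]

/-- The letters that occur at least twice in a word. -/
def repeated (l : List (Fin m)) : Finset (Fin m) := Finset.univ.filter fun j => 2 ≤ l.count j

theorem tmon_tmul_mul_comm (a : Fin m →₀ ℕ) (i : Fin m) (y : K.ARing R) :
    K.letterOp R i ((K.tmon R a ⊗ₜ 1) * y) = (K.tmon R a ⊗ₜ 1) * K.letterOp R i y := by
  induction y using TensorProduct.induction_on with
  | zero => simp
  | add x y hx hy => simp only [mul_add, map_add, hx, hy]
  | tmul f w =>
    rw [letterOp_apply, letterOp_apply, Algebra.TensorProduct.tmul_mul_tmul, one_mul, contractA_tmul,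
      contractA_tmul, s_mul_tmul, s_mul_tmul, mul_add, Algebra.TensorProduct.tmul_mul_tmul, one_mul, t,
      Algebra.TensorProduct.tmul_mul_tmul, Algebra.TensorProduct.tmul_mul_tmul,
      Algebra.TensorProduct.tmul_mul_tmul, one_mul, one_mul, mul_left_comm]

/-- The element attached to a word is divisible by the product of the `t j` for all repeated letters
`j`, with a quotient that does not involve the other letters too often. -/
theorem exists_listMono_eq (l : List (Fin m)) : ∃ y : K.ARing R,
    K.listMono R l = (K.tmon R (∑ j ∈ repeated l, Finsupp.single j 1) ⊗ₜ 1) * y ∧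
    (∀ j, l.count j = 0 → K.contractA R j y = 0) ∧ (∀ j, l.count j = 1 → K.s R j * y = 0) := by
  induction l with
  | nil =>
    refine ⟨1, ?_, fun j _ => contractA_one j, fun j h => by simp at h⟩
    have : repeated ([] : List (Fin m)) = ∅ := by simp [repeated]
    rw [this, Finset.sum_empty, tmon_zero, mul_one]; rfl
  | cons i l ih =>
    obtain ⟨y, hy, h0, h1⟩ := ih
    have hc : ∀ j, j ≠ i → (i :: l).count j = l.count j := fun j hj =>
      List.count_cons_of_ne hj.symm
    have hself : (i :: l).count i = l.count i + 1 := List.count_cons_self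
    have hs : ∀ j, j ≠ i → K.s R j * y = 0 → K.s R j * K.contractA R i y = 0 := by
      intro j hj h
      have := contractA_s_mul_of_ne (R := R) (K := K) hj.symm y
      rw [h, map_zero] at this
      exact neg_eq_zero.1 this.symm
    by_cases h : l.count i = 1
    · have hrep : repeated (i :: l) = insert i (repeated l) := by
        ext j
        by_cases hj : j = i
        · subst hj; simp [repeated, hself, h]
        · simp [repeated, hc j hj, hj]
      have hi : i ∉ repeated l := by simp [repeated, h]
      refine ⟨K.contractA R i y, ?_, fun j hj => ?_, fun j hj => ?_⟩
      · rw [listMono_cons, hy, tmon_tmul_mul_comm, letterOp_apply, h1 i h, zero_add, ← mul_assoc,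
          t_mul_comm, t_mul_tmon, hrep, Finset.sum_insert hi, add_comm]
      · have hj' : j ≠ i := by rintro rfl; omega
        rw [contractA_comm, h0 j (by rw [← hc j hj']; exact hj), map_zero, neg_zero]
      · have hj' : j ≠ i := by rintro rfl; omega
        exact hs j hj' (h1 j (by rw [← hc j hj']; exact hj))
    · have hrep : repeated (i :: l) = repeated l := by
        ext j
        by_cases hj : j = i
        · subst hj; simp only [repeated, Finset.mem_filter, Finset.mem_univ, true_and, hself]; omega
        · simp [repeated, hc j hj]
      refine ⟨K.letterOp R i y, ?_, fun j hj => ?_, fun j hj => ?_⟩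
      · rw [listMono_cons, hy, tmon_tmul_mul_comm, hrep]
      · have hj' : j ≠ i := by rintro rfl; omega
        have := h0 j (by rw [← hc j hj']; exact hj)
        rw [letterOp_apply, map_add, contractA_s_mul_of_ne hj', contractA_t_mul, contractA_comm, this]
        simp
      · by_cases hj' : j = i
        · subst hj'
          rw [letterOp_apply, h0 j (by omega), mul_zero, add_zero, s_mul_s_self]
        · have := h1 j (by rw [← hc j hj']; exact hj)
          rw [letterOp_apply, mul_add, s_mul_s, this, s_mul_t_mul, hs j hj' this]
          simp

theorem listMono_eq_zero {l : List (Fin m)} (h : repeated l ∉ K.faces) : K.listMono R l = 0 := by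
  obtain ⟨y, hy, -⟩ := exists_listMono_eq (R := R) (K := K) l
  have : (∑ j ∈ repeated l, Finsupp.single j 1 : Fin m →₀ ℕ).support = repeated l := by
    ext j
    simp [Finsupp.single_apply, Finsupp.finsetSum_apply]
  rw [hy, tmon_eq_zero (by rwa [this]), TensorProduct.zero_tmul, zero_mul]

theorem listMono_mem_idealB {l : List (Fin m)} {j : Fin m} (h : 3 ≤ l.count j) :
    K.listMono R l ∈ K.idealB R := by
  induction l with
  | nil => simp at h
  | cons i l ih =>
    by_cases hij : j = i
    · subst hij
      rw [List.count_cons_self] at h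
      obtain ⟨y, hy, -⟩ := exists_listMono_eq (R := R) (K := K) l
      have hj : j ∈ repeated l := by simp only [repeated, Finset.mem_filter, Finset.mem_univ, true_and]; omega
      rw [listMono_cons, hy, ← Finset.sum_erase_add _ _ hj, ← t_mul_tmon, mul_assoc]
      exact letterOp_t_mul_self _ _
    · rw [List.count_cons_of_ne (Ne.symm hij)] at h
      exact letterOp_idealB _ (ih h)

end

end SimplicialComplexOn

/-! ### The singular simplices attached to words -/

namespace SingularCochains

noncomputable section

section PartialSums

variable {a b : ℕ}

theorem partialSum_map_of_iff (f : ⦋a⦌ ⟶ ⦋b⦌) {k : Fin b} {k' : Fin a}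
    (h : ∀ j : Fin (a + 1), (f.toOrderHom j).val ≤ k.val ↔ j.val ≤ k'.val)
    (τ : stdSimplex ℝ (Fin (a + 1))) : partialSum k (simplexMap f τ) = partialSum k' τ := by
  rw [← NNReal.coe_inj, partialSum_map, partialSum_coe]
  exact Finset.sum_congr rfl fun j _ => by simp only [h]

theorem partialSum_map_eq_zero (f : ⦋a⦌ ⟶ ⦋b⦌) {k : Fin b}
    (h : ∀ j : Fin (a + 1), k.val < (f.toOrderHom j).val) (τ : stdSimplex ℝ (Fin (a + 1))) :
    partialSum k (simplexMap f τ) = 0 := by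
  rw [← NNReal.coe_inj, partialSum_map]
  exact Finset.sum_eq_zero fun j _ => if_neg (not_le.2 (h j))

theorem partialSum_map_eq_one (f : ⦋a⦌ ⟶ ⦋b⦌) {k : Fin b}
    (h : ∀ j : Fin (a + 1), (f.toOrderHom j).val ≤ k.val) (τ : stdSimplex ℝ (Fin (a + 1))) :
    partialSum k (simplexMap f τ) = 1 := by
  rw [← NNReal.coe_inj, partialSum_map, NNReal.coe_one, ← τ.2.2]
  exact Finset.sum_congr rfl fun j _ => if_pos (h j)

variable {p q n : ℕ}

theorem partialSum_back_castAdd (k : Fin p) (τ : stdSimplex ℝ (Fin (q + 1))) :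
    partialSum (Fin.castAdd q k) (simplexMap (backFace (rfl : p + q = p + q)) τ) = 0 :=
  partialSum_map_eq_zero _ (fun j => by rw [backFace_apply, Fin.val_castAdd]; omega) τ

theorem partialSum_back_natAdd (k : Fin q) (τ : stdSimplex ℝ (Fin (q + 1))) :
    partialSum (Fin.natAdd p k) (simplexMap (backFace (rfl : p + q = p + q)) τ) = partialSum k τ :=
  partialSum_map_of_iff _ (fun j => by rw [backFace_apply, Fin.val_natAdd]; omega) τ

theorem partialSum_front_castAdd (k : Fin p) (τ : stdSimplex ℝ (Fin (p + 1))) :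
    partialSum (Fin.castAdd q k) (simplexMap (frontFace (rfl : p + q = p + q)) τ) =
      partialSum k τ :=
  partialSum_map_of_iff _ (fun j => by rw [frontFace_apply, Fin.val_castAdd]) τ

theorem partialSum_front_natAdd (k : Fin q) (τ : stdSimplex ℝ (Fin (p + 1))) :
    partialSum (Fin.natAdd p k) (simplexMap (frontFace (rfl : p + q = p + q)) τ) = 1 :=
  partialSum_map_eq_one _ (fun j => by
    rw [frontFace_apply, Fin.val_natAdd]
    exact (Nat.lt_succ_iff.1 j.isLt).trans (Nat.le_add_right _ _)) τ

theorem partialSum_δ_zero_zero (τ : stdSimplex ℝ (Fin (n + 1))) :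
    partialSum (0 : Fin (n + 1)) (simplexMap (SimplexCategory.δ 0) τ) = 0 :=
  partialSum_map_eq_zero _ (fun j => by rw [δ_val]; simp) τ

theorem partialSum_δ_zero_succ (k : Fin n) (τ : stdSimplex ℝ (Fin (n + 1))) :
    partialSum k.succ (simplexMap (SimplexCategory.δ 0) τ) = partialSum k τ :=
  partialSum_map_of_iff _ (fun j => by rw [δ_val]; simp) τ

theorem partialSum_δ_last_castSucc (k : Fin n) (τ : stdSimplex ℝ (Fin (n + 1))) :
    partialSum k.castSucc (simplexMap (SimplexCategory.δ (Fin.last (n + 1))) τ) =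
      partialSum k τ :=
  partialSum_map_of_iff _ (fun j => by
    rw [δ_val, if_pos (show j.val < (Fin.last (n + 1)).val from j.isLt), Fin.val_castSucc]) τ

theorem partialSum_δ_last_last (τ : stdSimplex ℝ (Fin (n + 1))) :
    partialSum (Fin.last n) (simplexMap (SimplexCategory.δ (Fin.last (n + 1))) τ) = 1 :=
  partialSum_map_eq_one _ (fun j => by
    rw [δ_val, if_pos (show j.val < (Fin.last (n + 1)).val from j.isLt), Fin.val_last]
    exact Nat.lt_succ_iff.1 j.isLt) τ

theorem partialSum_δ_castSucc {k : Fin n} {l : Fin n} (h : l ≤ k)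
    (τ : stdSimplex ℝ (Fin (n + 1))) :
    partialSum l.castSucc (simplexMap (SimplexCategory.δ k.succ.castSucc) τ) = partialSum l τ :=
  partialSum_map_of_iff _ (fun j => by
    rw [Fin.le_def] at h
    rw [δ_val]
    simp only [Fin.val_castSucc, Fin.val_succ]
    split_ifs <;> omega) τ

theorem partialSum_δ_succ {k : Fin n} {l : Fin n} (h : k ≤ l)
    (τ : stdSimplex ℝ (Fin (n + 1))) :
    partialSum l.succ (simplexMap (SimplexCategory.δ k.succ.castSucc) τ) = partialSum l τ :=
  partialSum_map_of_iff _ (fun j => by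
    rw [Fin.le_def] at h
    rw [δ_val]
    simp only [Fin.val_castSucc, Fin.val_succ]
    split_ifs <;> omega) τ

theorem partialSum_σ_δ {k j : Fin (n + 1)} (h : j ≠ k) (τ : stdSimplex ℝ (Fin (n + 2))) :
    partialSum j (simplexMap (SimplexCategory.δ k.castSucc) (simplexMap (SimplexCategory.σ k) τ)) =
      partialSum j τ := by
  rw [← ContinuousMap.comp_apply, simplexMap_comp]
  refine partialSum_map_of_iff _ (fun l => ?_) τ
  rw [Ne, Fin.ext_iff] at h
  rw [comp_val, δ_val, σ_val, Fin.val_castSucc]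
  split_ifs <;> omega

/-- A simplex that does not depend on the `k`-th partial sum of the barycentric coordinates is
degenerate. -/
theorem value_eq_zero_of_independent {R : Type} [CommRing R] {X : Type} [TopologicalSpace X]
    {𝒰 : Set (Set X)} (γ : (dga R (small 𝒰)).cx.X n) {x : C(stdSimplex ℝ (Fin (n + 1)), X)}
    (k : Fin n) (hx : ∀ τ τ', (∀ j ≠ k, partialSum j τ = partialSum j τ') → x τ = x τ') :
    value γ x = 0 := by
  obtain _ | n := n
  · exact k.elim0
  · exact value_degenerate γ k (ContinuousMap.ext fun τ => hx _ _ fun j hj => partialSum_σ_δ hj τ)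

end PartialSums

end

end SingularCochains

namespace MomentAngle

open SingularCochains

noncomputable section

/-- For fixed `a` this is a loop in `b ∈ [0, a]`, running once around the circle of radius `a` that
touches the unit circle at `1` from inside. -/
def loopDisc (a b : ℝ) : ℂ := (1 - a : ℝ) + a * Complex.exp ((2 * Real.pi * (b / a) : ℝ) * Complex.I)

theorem norm_mul_exp (a c : ℝ) : ‖(a : ℂ) * Complex.exp ((c : ℝ) * Complex.I)‖ = |a| := by
  rw [norm_mul, Complex.norm_exp_ofReal_mul_I, mul_one, Complex.norm_real, Real.norm_eq_abs]

theorem continuous_loopDisc : Continuous fun p : ℝ × ℝ => loopDisc p.1 p.2 := by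
  refine Continuous.add (by fun_prop) (continuous_iff_continuousAt.2 fun p => ?_)
  by_cases h : p.1 = 0
  · have : Filter.Tendsto (fun q : ℝ × ℝ => |q.1|) (nhds p) (nhds 0) := by
      have : Continuous fun q : ℝ × ℝ => |q.1| := by fun_prop
      simpa [h] using this.tendsto p
    rw [ContinuousAt, h]
    simp only [Complex.ofReal_zero, zero_mul]
    exact squeeze_zero_norm (fun q => (norm_mul_exp _ _).le) this
  · have hd : ContinuousAt (fun q : ℝ × ℝ => q.2 / q.1) p :=
      continuousAt_snd.div continuousAt_fst h
    have hd' : ContinuousAt (fun q : ℝ × ℝ => ((2 * Real.pi * (q.2 / q.1) : ℝ) : ℂ)) p :=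
      Complex.continuous_ofReal.continuousAt.comp (continuousAt_const.mul hd)
    exact (Complex.continuous_ofReal.continuousAt.comp continuousAt_fst).mul
      (Complex.continuous_exp.continuousAt.comp (hd'.mul continuousAt_const))

theorem loopDisc_zero_right (a : ℝ) : loopDisc a 0 = 1 := by simp [loopDisc]

theorem loopDisc_self (a : ℝ) : loopDisc a a = 1 := by
  by_cases h : a = 0
  · subst h; exact loopDisc_zero_right 0
  · rw [loopDisc, div_self h]
    have : Complex.exp ((2 * Real.pi * 1 : ℝ) * Complex.I) = 1 := by
      rw [mul_one]; push_cast; exact Complex.exp_two_pi_mul_I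
    rw [this]; push_cast; ring

theorem loopDisc_one (b : ℝ) : loopDisc 1 b = Complex.exp ((2 * Real.pi * b : ℝ) * Complex.I) := by
  simp [loopDisc]

theorem norm_loopDisc_le {a : ℝ} (h0 : 0 ≤ a) (h1 : a ≤ 1) (b : ℝ) : ‖loopDisc a b‖ ≤ 1 := by
  refine (norm_add_le _ _).trans ?_
  rw [norm_mul_exp, Complex.norm_real, Real.norm_eq_abs, abs_of_nonneg h0,
    abs_of_nonneg (by linarith)]
  linarith

theorem norm_loopDisc_one (b : ℝ) : ‖loopDisc 1 b‖ = 1 := by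
  rw [loopDisc_one, Complex.norm_exp_ofReal_mul_I]

variable {m n : ℕ}

/-- The sum of the values `v k` over the positions `k` of the letter `i` in the word `w`. -/
def letterSum (w : Fin n → Fin m) (v : Fin n → NNReal) (i : Fin m) : NNReal :=
  ∑ k, if w k = i then v k else 0

/-- The maximum of the values `v k` over the positions `k` of the letter `i` in the word `w`. -/
def letterSup (w : Fin n → Fin m) (v : Fin n → NNReal) (i : Fin m) : NNReal :=
  Finset.univ.sup fun k => if w k = i then v k else 0

theorem sup_univ_fin_succ (f : Fin (n + 1) → NNReal) :
    Finset.univ.sup f = f 0 ⊔ Finset.univ.sup fun k : Fin n => f k.succ := by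
  refine eq_of_forall_ge_iff fun c => ?_
  simp only [Finset.sup_le_iff, sup_le_iff, Finset.mem_univ, true_imp_iff, Fin.forall_fin_succ]

theorem sup_univ_castSucc (f : Fin (n + 1) → NNReal) :
    Finset.univ.sup f = (Finset.univ.sup fun k : Fin n => f k.castSucc) ⊔ f (Fin.last n) := by
  refine eq_of_forall_ge_iff fun c => ?_
  simp only [Finset.sup_le_iff, sup_le_iff, Finset.mem_univ, true_imp_iff, Fin.forall_fin_succ']

theorem sup_univ_add {p q : ℕ} (f : Fin (p + q) → NNReal) :
    Finset.univ.sup f = (Finset.univ.sup fun k : Fin p => f (Fin.castAdd q k)) ⊔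
      Finset.univ.sup fun k : Fin q => f (Fin.natAdd p k) := by
  refine eq_of_forall_ge_iff fun c => ?_
  simp only [Finset.sup_le_iff, sup_le_iff, Finset.mem_univ, true_imp_iff]
  exact ⟨fun h => ⟨fun _ => h _, fun _ => h _⟩, fun h => Fin.addCases h.1 h.2⟩

section Letter

variable {p q : ℕ} (i : Fin m)

theorem letterSum_cons (j : Fin m) (w : Fin n → Fin m) (v : Fin (n + 1) → NNReal) :
    letterSum (Fin.cons j w : Fin (n + 1) → Fin m) v i =
      (if j = i then v 0 else 0) + letterSum w (fun k => v k.succ) i := by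
  simp [letterSum, Fin.sum_univ_succ]

theorem letterSup_cons (j : Fin m) (w : Fin n → Fin m) (v : Fin (n + 1) → NNReal) :
    letterSup (Fin.cons j w : Fin (n + 1) → Fin m) v i =
      (if j = i then v 0 else 0) ⊔ letterSup w (fun k => v k.succ) i := by
  rw [letterSup, sup_univ_fin_succ]
  simp [letterSup]

theorem letterSum_snoc (j : Fin m) (w : Fin n → Fin m) (v : Fin (n + 1) → NNReal) :
    letterSum (Fin.snoc w j : Fin (n + 1) → Fin m) v i =
      letterSum w (fun k => v k.castSucc) i + (if j = i then v (Fin.last n) else 0) := by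
  simp [letterSum, Fin.sum_univ_castSucc]

theorem letterSup_snoc (j : Fin m) (w : Fin n → Fin m) (v : Fin (n + 1) → NNReal) :
    letterSup (Fin.snoc w j : Fin (n + 1) → Fin m) v i =
      letterSup w (fun k => v k.castSucc) i ⊔ (if j = i then v (Fin.last n) else 0) := by
  rw [letterSup, sup_univ_castSucc]
  simp [letterSup]

theorem letterSum_append (w : Fin p → Fin m) (w' : Fin q → Fin m) (v : Fin (p + q) → NNReal) :
    letterSum (Fin.append w w') v i = letterSum w (fun k => v (Fin.castAdd q k)) i +
      letterSum w' (fun k => v (Fin.natAdd p k)) i := by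
  simp [letterSum, Fin.sum_univ_add]

theorem letterSup_append (w : Fin p → Fin m) (w' : Fin q → Fin m) (v : Fin (p + q) → NNReal) :
    letterSup (Fin.append w w') v i = letterSup w (fun k => v (Fin.castAdd q k)) i ⊔
      letterSup w' (fun k => v (Fin.natAdd p k)) i := by
  rw [letterSup, sup_univ_add]
  simp [letterSup]

variable {i}

theorem letterSum_congr {w : Fin n → Fin m} {v v' : Fin n → NNReal}
    (h : ∀ k, w k = i → v k = v' k) : letterSum w v i = letterSum w v' i :=
  Finset.sum_congr rfl fun k _ => by split_ifs with hk; exacts [h k hk, rfl]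

theorem letterSup_congr {w : Fin n → Fin m} {v v' : Fin n → NNReal}
    (h : ∀ k, w k = i → v k = v' k) : letterSup w v i = letterSup w v' i :=
  Finset.sup_congr rfl fun k _ => by split_ifs with hk; exacts [h k hk, rfl]

theorem letterSum_eq_zero {w : Fin n → Fin m} {v : Fin n → NNReal}
    (h : ∀ k, w k = i → v k = 0) : letterSum w v i = 0 :=
  Finset.sum_eq_zero fun k _ => by split_ifs with hk; exacts [h k hk, rfl]

theorem letterSup_eq_zero {w : Fin n → Fin m} {v : Fin n → NNReal}
    (h : ∀ k, w k = i → v k = 0) : letterSup w v i = 0 :=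
  (Finset.sup_congr rfl fun k _ => by split_ifs with hk; exacts [h k hk, rfl]).trans
    (Finset.sup_bot _)

theorem letterSup_le_one {w : Fin n → Fin m} {v : Fin n → NNReal} (h : ∀ k, v k ≤ 1) :
    letterSup w v i ≤ 1 :=
  Finset.sup_le fun k _ => by split_ifs; exacts [h k, zero_le_one]

theorem letterSup_eq_one {w : Fin n → Fin m} {v : Fin n → NNReal} (h : ∀ k, v k ≤ 1) {k : Fin n}
    (hk : w k = i) (hv : v k = 1) : letterSup w v i = 1 :=
  le_antisymm (letterSup_le_one h) (by
    have : (if w k = i then v k else 0) ≤ letterSup w v i :=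
      Finset.le_sup (f := fun k => if w k = i then v k else 0) (Finset.mem_univ k)
    rwa [if_pos hk, hv] at this)

theorem letterSum_comp_equiv (e : Equiv.Perm (Fin n)) (w : Fin n → Fin m) (v : Fin n → NNReal) :
    letterSum (w ∘ e) (v ∘ e) i = letterSum w v i :=
  Equiv.sum_comp e fun k => if w k = i then v k else 0

theorem letterSup_comp_equiv (e : Equiv.Perm (Fin n)) (w : Fin n → Fin m) (v : Fin n → NNReal) :
    letterSup (w ∘ e) (v ∘ e) i = letterSup w v i := by
  refine eq_of_forall_ge_iff fun c => ?_
  simp only [letterSup, Finset.sup_le_iff, Finset.mem_univ, true_imp_iff, Function.comp]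
  exact e.forall_congr_right (q := fun k => (if w k = i then v k else 0) ≤ c)

theorem letterSup_le_letterSum (w : Fin n → Fin m) (v : Fin n → NNReal) :
    letterSup w v i ≤ letterSum w v i :=
  Finset.sup_le fun _ hk =>
    Finset.single_le_sum (f := fun k => if w k = i then v k else 0) (fun _ _ => zero_le) hk

/-- The number of occurrences of a letter controls the difference of `letterSum` and `letterSup`. -/
theorem letterSum_of_count (w : Fin n → Fin m) (v : Fin n → NNReal) (hv : ∀ k, v k ≤ 1) :
    ((List.ofFn w).count i = 0 → letterSum w v i = 0) ∧
    ((List.ofFn w).count i ≤ 1 → letterSum w v i = letterSup w v i) ∧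
    ((List.ofFn w).count i ≤ 2 → letterSum w v i ≤ letterSup w v i + 1) := by
  induction n with
  | zero => simp [letterSum, letterSup]
  | succ n ih =>
    obtain ⟨j, w, rfl⟩ : ∃ j w', w = Fin.cons j w' := ⟨_, _, (Fin.cons_self_tail w).symm⟩
    obtain ⟨h0, h1, h2⟩ := ih w (fun k => v k.succ) fun _ => hv _
    have hle := letterSup_le_letterSum (i := i) w fun k => v k.succ
    rw [List.ofFn_cons, letterSum_cons, letterSup_cons]
    by_cases hj : j = i
    · subst hj
      rw [if_pos rfl, List.count_cons_self]
      refine ⟨fun h => absurd h (by omega), fun h => ?_, fun h => ?_⟩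
      · have h0 := h0 (by omega)
        rw [h0] at hle ⊢
        rw [le_zero_iff.1 hle, add_zero, sup_eq_left.2 zero_le]
      · rw [h1 (by omega)]
        rcases le_total (v 0) (letterSup w (fun k => v k.succ) j) with h' | h'
        · rw [sup_eq_right.2 h', add_comm]
          gcongr
          exact hv 0
        · rw [sup_eq_left.2 h']
          gcongr
          exact letterSup_le_one fun _ => hv _
    · rw [if_neg hj, List.count_cons_of_ne hj, zero_add, sup_eq_right.2 zero_le]
      exact ⟨h0, h1, h2⟩

end Letter

/-- The coordinates of the point attached to a word `w` and values `v k` for its positions. A letter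
with a single position of value `u` gives the loop `exp (-2 π I u)`, or, for the coordinates in `E`,
its lift `1 - u` to the real line. A letter with two positions gives a map from a triangle to the
disc which collapses the sides on which the two values agree or the larger one is `1`. -/
def coord (E : Finset (Fin m)) (w : Fin n → Fin m) (v : Fin n → NNReal) (i : Fin m) : ℂ :=
  if i ∈ E then ((1 - letterSup w v i : ℝ) : ℂ)
  else loopDisc (1 - letterSum w v i + letterSup w v i) (1 - letterSup w v i)

theorem coord_congr' {k : ℕ} {E : Finset (Fin m)} {w : Fin n → Fin m} {v : Fin n → NNReal} {i : Fin m}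
    {w' : Fin k → Fin m} {v' : Fin k → NNReal} (h1 : letterSum w v i = letterSum w' v' i)
    (h2 : letterSup w v i = letterSup w' v' i) : coord E w v i = coord E w' v' i := by
  rw [coord, coord, h1, h2]

theorem coord_congr {E : Finset (Fin m)} {w : Fin n → Fin m} {v v' : Fin n → NNReal} {i : Fin m}
    (h : ∀ k, w k = i → v k = v' k) : coord E w v i = coord E w v' i :=
  coord_congr' (letterSum_congr h) (letterSup_congr h)

theorem coord_of_sup_eq_one {E : Finset (Fin m)} {w : Fin n → Fin m} {v : Fin n → NNReal} {i : Fin m}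
    (hi : i ∉ E) (h : letterSup w v i = 1) : coord E w v i = 1 := by
  rw [coord, if_neg hi, h, NNReal.coe_one, sub_self, loopDisc_zero_right]

theorem coord_of_notMem {E : Finset (Fin m)} {w : Fin n → Fin m} {v : Fin n → NNReal} {i : Fin m}
    (h : ∀ k, w k ≠ i) : coord E w v i = 1 := by
  rw [coord, letterSum_eq_zero fun k hk => absurd hk (h k),
    letterSup_eq_zero fun k hk => absurd hk (h k)]
  split_ifs
  · simp
  · rw [NNReal.coe_zero, sub_zero, add_zero, loopDisc_self]

/-- The singular simplex attached to a word. The positions of the word correspond to the partial sums of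
barycentric coordinates; the coordinates in `E` are lifted to the real line. -/
def wordSimplex (E : Finset (Fin m)) (w : Fin n → Fin m) :
    C(stdSimplex ℝ (Fin (n + 1)), Fin m → ℂ) :=
  ⟨fun τ i => coord E w (fun k => partialSum k τ) i, continuous_pi fun i => by
    have h1 : Continuous fun τ : stdSimplex ℝ (Fin (n + 1)) =>
        letterSum w (fun k => partialSum k τ) i :=
      continuous_finsetSum _ fun k _ => by
        split_ifs
        exacts [continuous_partialSum k, continuous_const]
    have h2 : Continuous fun τ : stdSimplex ℝ (Fin (n + 1)) =>
        letterSup w (fun k => partialSum k τ) i :=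
      Continuous.finset_sup_apply fun k _ => by
        split_ifs
        exacts [continuous_partialSum k, continuous_const]
    have h1' := NNReal.continuous_coe.comp h1
    have h2' := NNReal.continuous_coe.comp h2
    by_cases hi : i ∈ E
    · simp only [coord, if_pos hi]
      exact Complex.continuous_ofReal.comp (continuous_const.sub h2')
    · simp only [coord, if_neg hi]
      exact continuous_loopDisc.comp (((continuous_const.sub h1').add h2').prodMk
        (continuous_const.sub h2'))⟩

theorem wordSimplex_apply (E : Finset (Fin m)) (w : Fin n → Fin m)
    (τ : stdSimplex ℝ (Fin (n + 1))) (i : Fin m) :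
    wordSimplex E w τ i = coord E w (fun k => partialSum k τ) i := rfl

variable {E : Finset (Fin m)}

theorem wordSimplex_back {p q : ℕ} (w : Fin p → Fin m) (w' : Fin q → Fin m) :
    (wordSimplex E (Fin.append w w')).comp (simplexMap (backFace (rfl : p + q = p + q))) =
      wordSimplex E w' := by
  ext τ i
  refine coord_congr' ?_ ?_
  · rw [letterSum_append, letterSum_eq_zero fun k _ => partialSum_back_castAdd k τ, zero_add]
    exact letterSum_congr fun k _ => partialSum_back_natAdd k τ
  · rw [letterSup_append, letterSup_eq_zero fun k _ => partialSum_back_castAdd k τ,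
      sup_eq_right.2 zero_le]
    exact letterSup_congr fun k _ => partialSum_back_natAdd k τ

theorem wordSimplex_front {p q : ℕ} (w : Fin p → Fin m) (w' : Fin q → Fin m)
    (h : ∀ k l, w k ≠ w' l) (hE : ∀ l, w' l ∉ E) :
    (wordSimplex E (Fin.append w w')).comp (simplexMap (frontFace (rfl : p + q = p + q))) =
      wordSimplex E w := by
  ext τ i
  by_cases hi : ∃ l, w' l = i
  · obtain ⟨l, rfl⟩ := hi
    rw [wordSimplex_apply, coord_of_notMem fun k => h k l]
    refine coord_of_sup_eq_one (hE l) (letterSup_eq_one (fun k => partialSum_le_one k _)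
      (k := Fin.natAdd p l) (Fin.append_right _ _ _) (partialSum_front_natAdd l τ))
  · push Not at hi
    refine coord_congr' ?_ ?_
    · rw [letterSum_append, letterSum_eq_zero (w := w') fun k hk => absurd hk (hi k), add_zero]
      exact letterSum_congr fun k _ => partialSum_front_castAdd k τ
    · rw [letterSup_append, letterSup_eq_zero (w := w') fun k hk => absurd hk (hi k),
        sup_eq_left.2 zero_le]
      exact letterSup_congr fun k _ => partialSum_front_castAdd k τ

theorem wordSimplex_δ_zero (j : Fin m) (w : Fin n → Fin m) :
    (wordSimplex E (Fin.cons j w : Fin (n + 1) → Fin m)).comp (simplexMap (SimplexCategory.δ 0)) =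
      wordSimplex E w := by
  ext τ i
  refine coord_congr' ?_ ?_
  · rw [letterSum_cons, partialSum_δ_zero_zero, ite_self, zero_add]
    exact letterSum_congr fun k _ => partialSum_δ_zero_succ k τ
  · rw [letterSup_cons, partialSum_δ_zero_zero, ite_self, sup_eq_right.2 zero_le]
    exact letterSup_congr fun k _ => partialSum_δ_zero_succ k τ

/-- The coordinates of the last face that do not belong to the last letter. -/
theorem wordSimplex_δ_last_apply_of_ne {i j : Fin m} (h : j ≠ i) (w : Fin n → Fin m)
    (τ : stdSimplex ℝ (Fin (n + 1))) :
    wordSimplex E (Fin.snoc w j : Fin (n + 1) → Fin m)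
      (simplexMap (SimplexCategory.δ (Fin.last (n + 1))) τ) i = wordSimplex E w τ i := by
  refine coord_congr' ?_ ?_
  · rw [letterSum_snoc, if_neg h, add_zero]
    exact letterSum_congr fun k _ => partialSum_δ_last_castSucc k τ
  · rw [letterSup_snoc, if_neg h, sup_eq_left.2 zero_le]
    exact letterSup_congr fun k _ => partialSum_δ_last_castSucc k τ

theorem letterSup_δ_last (j : Fin m) (w : Fin n → Fin m) (τ : stdSimplex ℝ (Fin (n + 1))) :
    letterSup (Fin.snoc w j : Fin (n + 1) → Fin m) (fun k => partialSum k
      (simplexMap (SimplexCategory.δ (Fin.last (n + 1))) τ)) j = 1 :=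
  letterSup_eq_one (fun k => partialSum_le_one k _) (k := Fin.last n) (Fin.snoc_last _ _)
    (partialSum_δ_last_last τ)

theorem wordSimplex_δ_last {j : Fin m} (hj : j ∉ E) (w : Fin n → Fin m) (h : ∀ k, w k ≠ j) :
    (wordSimplex E (Fin.snoc w j : Fin (n + 1) → Fin m)).comp
      (simplexMap (SimplexCategory.δ (Fin.last (n + 1)))) = wordSimplex E w := by
  ext τ i
  by_cases hi : j = i
  · subst hi
    rw [wordSimplex_apply, coord_of_notMem h]
    exact coord_of_sup_eq_one hj (letterSup_δ_last j w τ)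
  · exact wordSimplex_δ_last_apply_of_ne hi w τ

theorem wordSimplex_δ_last_independent {j : Fin m} (hj : j ∉ E) (w : Fin n → Fin m) {k : Fin n}
    (hk : w k = j) (τ τ' : stdSimplex ℝ (Fin (n + 1)))
    (h : ∀ l ≠ k, partialSum l τ = partialSum l τ') :
    (wordSimplex E (Fin.snoc w j : Fin (n + 1) → Fin m)).comp
      (simplexMap (SimplexCategory.δ (Fin.last (n + 1)))) τ =
    (wordSimplex E (Fin.snoc w j : Fin (n + 1) → Fin m)).comp
      (simplexMap (SimplexCategory.δ (Fin.last (n + 1)))) τ' := by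
  ext i
  by_cases hi : j = i
  · subst hi
    exact (coord_of_sup_eq_one hj (letterSup_δ_last j w τ)).trans
      (coord_of_sup_eq_one hj (letterSup_δ_last j w τ')).symm
  · rw [ContinuousMap.comp_apply, ContinuousMap.comp_apply, wordSimplex_δ_last_apply_of_ne hi,
      wordSimplex_δ_last_apply_of_ne hi]
    refine coord_congr fun l hl => h l ?_
    rintro rfl
    exact hi (hk.symm.trans hl)

theorem wordSimplex_front_independent {p q : ℕ} (w : Fin p → Fin m) (w' : Fin q → Fin m) {k : Fin p}
    {l : Fin q} (hkl : w k = w' l) (hE : ∀ l, w' l ∉ E) (τ τ' : stdSimplex ℝ (Fin (p + 1)))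
    (h : ∀ j ≠ k, partialSum j τ = partialSum j τ') :
    (wordSimplex E (Fin.append w w')).comp (simplexMap (frontFace (rfl : p + q = p + q))) τ =
    (wordSimplex E (Fin.append w w')).comp (simplexMap (frontFace (rfl : p + q = p + q))) τ' := by
  ext i
  have key : ∀ τ, w' l = i → (wordSimplex E (Fin.append w w')).comp
      (simplexMap (frontFace (rfl : p + q = p + q))) τ i = 1 := by
    rintro τ rfl
    exact coord_of_sup_eq_one (hE l) (letterSup_eq_one (fun k => partialSum_le_one k _)
      (k := Fin.natAdd p l) (Fin.append_right _ _ _) (partialSum_front_natAdd l τ))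
  by_cases hi : w' l = i
  · rw [key τ hi, key τ' hi]
  · refine coord_congr fun j => ?_
    refine Fin.addCases (fun j hj => ?_) (fun j _ => ?_) j
    · rw [Fin.append_left] at hj
      rw [partialSum_front_castAdd, partialSum_front_castAdd]
      refine h j ?_
      rintro rfl
      exact hi (hkl.symm.trans hj)
    · rw [partialSum_front_natAdd, partialSum_front_natAdd]

theorem wordSimplex_δ_swap (w : Fin (n + 1) → Fin m) (k : Fin n) :
    (wordSimplex E (w ∘ Equiv.swap k.castSucc k.succ)).comp
      (simplexMap (SimplexCategory.δ k.succ.castSucc)) =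
    (wordSimplex E w).comp (simplexMap (SimplexCategory.δ k.succ.castSucc)) := by
  ext τ i
  have hv : (fun l => partialSum l (simplexMap (SimplexCategory.δ k.succ.castSucc) τ)) ∘
      (Equiv.swap k.castSucc k.succ) =
      fun l => partialSum l (simplexMap (SimplexCategory.δ k.succ.castSucc) τ) := by
    funext l
    rw [Function.comp_apply]
    by_cases h1 : l = k.castSucc
    · subst h1
      rw [Equiv.swap_apply_left, partialSum_δ_castSucc le_rfl, partialSum_δ_succ le_rfl]
    · by_cases h2 : l = k.succ
      · subst h2
        rw [Equiv.swap_apply_right, partialSum_δ_castSucc le_rfl, partialSum_δ_succ le_rfl]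
      · rw [Equiv.swap_apply_of_ne_of_ne h1 h2]
  refine coord_congr' ?_ ?_
  · exact (congrArg (fun v => letterSum _ v i) hv).symm.trans (letterSum_comp_equiv _ _ _)
  · exact (congrArg (fun v => letterSup _ v i) hv).symm.trans (letterSup_comp_equiv _ _ _)

theorem count_ofFn (w : Fin n → Fin m) (i : Fin m) :
    (List.ofFn w).count i = (Finset.univ.filter fun k => w k = i).card := by
  induction n with
  | zero => simp
  | succ n ih =>
    rw [List.ofFn_succ, List.count_cons, ih, Fin.card_filter_univ_succ]
    simp only [beq_iff_eq]
    split_ifs <;> omega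

theorem wordSimplex_δ_independent (w : Fin (n + 1) → Fin m) {k : Fin n} (hk : w k.castSucc = w k.succ)
    (hE : w k.succ ∉ E) (hc : (List.ofFn w).count (w k.succ) ≤ 2)
    (τ τ' : stdSimplex ℝ (Fin (n + 1))) (h : ∀ l ≠ k, partialSum l τ = partialSum l τ') :
    (wordSimplex E w).comp (simplexMap (SimplexCategory.δ k.succ.castSucc)) τ =
    (wordSimplex E w).comp (simplexMap (SimplexCategory.δ k.succ.castSucc)) τ' := by
  have hne : k.castSucc ≠ k.succ := (Fin.castSucc_lt_succ).ne
  have hpos : Finset.univ.filter (fun l => w l = w k.succ) = {k.castSucc, k.succ} := by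
    symm
    refine Finset.eq_of_subset_of_card_le ?_ ?_
    · intro l hl
      rw [Finset.mem_insert, Finset.mem_singleton] at hl
      rcases hl with rfl | rfl <;> simp [hk]
    · rwa [← count_ofFn, Finset.card_pair hne]
  ext i
  by_cases hi : w k.succ = i
  · subst hi
    have key : ∀ τ, (wordSimplex E w).comp (simplexMap (SimplexCategory.δ k.succ.castSucc)) τ
        (w k.succ) = 1 := by
      intro τ
      have hs : ∀ v : Fin (n + 1) → NNReal,
          letterSum w v (w k.succ) = v k.castSucc + v k.succ := by
        intro v
        rw [letterSum, ← Finset.sum_filter, hpos, Finset.sum_pair hne]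
      have hM : ∀ v : Fin (n + 1) → NNReal,
          letterSup w v (w k.succ) = v k.castSucc ⊔ v k.succ := by
        intro v
        refine eq_of_forall_ge_iff fun c => ?_
        simp only [letterSup, Finset.sup_le_iff, Finset.mem_univ, true_imp_iff, sup_le_iff]
        refine ⟨fun h => ⟨by simpa [hk] using h k.castSucc, by simpa using h k.succ⟩,
          fun h l => ?_⟩
        split_ifs with hl
        · have : l ∈ ({k.castSucc, k.succ} : Finset _) := by rw [← hpos]; simpa using hl
          rw [Finset.mem_insert, Finset.mem_singleton] at this
          rcases this with rfl | rfl
          exacts [h.1, h.2]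
        · exact zero_le
      change coord E w _ _ = 1
      rw [coord, if_neg hE, hs, hM, partialSum_δ_castSucc le_rfl, partialSum_δ_succ le_rfl, sup_idem,
        NNReal.coe_add, sub_add_eq_add_sub, add_sub_add_right_eq_sub, loopDisc_self]
    rw [key τ, key τ']
  · refine coord_congr fun l hl => ?_
    rcases lt_trichotomy l k.succ with hlt | rfl | hgt
    · obtain ⟨l, rfl⟩ : ∃ l', l = Fin.castSucc l' :=
        ⟨l.castPred (ne_of_lt (hlt.trans_le (Fin.le_last _))), by simp⟩
      have hlk : l ≤ k := by rw [Fin.castSucc_lt_succ_iff] at hlt; exact hlt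
      rw [partialSum_δ_castSucc hlk, partialSum_δ_castSucc hlk]
      refine h l ?_
      rintro rfl
      exact hi (hk.symm.trans hl)
    · exact absurd hl hi
    · obtain ⟨l, rfl⟩ : ∃ l', l = Fin.succ l' :=
        ⟨l.pred (ne_of_gt ((Fin.zero_le _).trans_lt hgt)), by simp⟩
      have hlk : k < l := Fin.succ_lt_succ_iff.1 hgt
      rw [partialSum_δ_succ hlk.le, partialSum_δ_succ hlk.le]
      exact h l hlk.ne'

end

end MomentAngle

/-! ### The map from the cochains of the small simplices to `B(K)` -/

namespace MomentAngle

open SingularCochains SimplicialComplexOn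

noncomputable section

variable {m n : ℕ}

section Words

variable {M : Type} [AddCommGroup M]

theorem sum_words_cons (f : (Fin (n + 1) → Fin m) → M) :
    ∑ w, f w = ∑ j : Fin m, ∑ w : Fin n → Fin m, f (Fin.cons j w) := by
  rw [← Fintype.sum_prod_type', ← (Fin.consEquiv fun _ => Fin m).sum_comp]
  rfl

theorem sum_words_snoc (f : (Fin (n + 1) → Fin m) → M) :
    ∑ w, f w = ∑ j : Fin m, ∑ w : Fin n → Fin m, f (Fin.snoc w j) := by
  rw [← Fintype.sum_prod_type', ← (Fin.snocEquiv fun _ => Fin m).sum_comp]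
  rfl

theorem sum_words_append {p q : ℕ} (f : (Fin (p + q) → Fin m) → M) :
    ∑ w, f w = ∑ w : Fin p → Fin m, ∑ w' : Fin q → Fin m, f (Fin.append w w') := by
  rw [← Fintype.sum_prod_type', ← (Fin.appendEquiv p q).sum_comp]
  rfl

theorem swap_word_eq_iff (w : Fin (n + 1) → Fin m) (k : Fin n) :
    w ∘ Equiv.swap k.castSucc k.succ = w ↔ w k.castSucc = w k.succ := by
  constructor
  · intro h
    have := congrFun h k.succ
    rwa [Function.comp_apply, Equiv.swap_apply_right] at this
  · intro h
    funext l
    rw [Function.comp_apply]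
    by_cases h1 : l = k.castSucc
    · subst h1; rw [Equiv.swap_apply_left, h]
    · by_cases h2 : l = k.succ
      · subst h2; rw [Equiv.swap_apply_right, h]
      · rw [Equiv.swap_apply_of_ne_of_ne h1 h2]

/-- The boundary formula for word simplices: against coefficients that change sign when two distinct
neighbouring letters are swapped, all inner faces cancel. -/
theorem sum_value_d {𝒰 : Set (Set (Fin m → ℂ))} {E : Finset (Fin m)}
    (γ : (dga ℤ (small 𝒰)).cx.X n) (c : (Fin (n + 1) → Fin m) → M)
    (hsmall : ∀ w, c w ≠ 0 → ∃ U ∈ 𝒰, ∀ τ, wordSimplex E w τ ∈ U)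
    (hswap : ∀ w (k : Fin n), w k.castSucc ≠ w k.succ →
      c (w ∘ Equiv.swap k.castSucc k.succ) = - c w)
    (hdeg : ∀ w (k : Fin n), w k.castSucc = w k.succ → c w ≠ 0 →
      w k.succ ∉ E ∧ (List.ofFn w).count (w k.succ) ≤ 2) :
    ∑ w, value ((dga ℤ (small 𝒰)).cx.d n (n + 1) γ) (wordSimplex E w) • c w =
      (-(-1) ^ n : ℤ) • (∑ j, ∑ w : Fin n → Fin m, value γ (wordSimplex E w) •
          c (Fin.cons j w : Fin (n + 1) → Fin m) +
        (-1 : ℤ) ^ (n + 1) • ∑ j, ∑ w : Fin n → Fin m,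
          value γ ((wordSimplex E (Fin.snoc w j : Fin (n + 1) → Fin m)).comp
            (simplexMap (SimplexCategory.δ (Fin.last (n + 1))))) •
              c (Fin.snoc w j : Fin (n + 1) → Fin m)) := by
  have h1 : ∀ w, value ((dga ℤ (small 𝒰)).cx.d n (n + 1) γ) (wordSimplex E w) • c w =
      (-(-1) ^ n : ℤ) • ∑ i : Fin (n + 2), (-1 : ℤ) ^ (i : ℕ) •
        (value γ ((wordSimplex E w).comp (simplexMap (SimplexCategory.δ i))) • c w) := by
    intro w
    by_cases hw : c w = 0
    · simp [hw]
    · rw [value_d _ (hsmall w hw), mul_smul, Finset.sum_smul]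
      simp only [mul_smul]
  have inner : ∀ k : Fin n, ∑ w, (value γ ((wordSimplex E w).comp
      (simplexMap (SimplexCategory.δ k.succ.castSucc))) • c w) = 0 := by
    intro k
    refine Finset.sum_involution (fun w _ => w ∘ Equiv.swap k.castSucc k.succ) (fun w _ => ?_)
      (fun w _ h => ?_) (fun w _ => Finset.mem_univ _) (fun w _ => ?_)
    · rw [wordSimplex_δ_swap]
      by_cases h : w k.castSucc = w k.succ
      · by_cases hw : c w = 0
        · rw [(swap_word_eq_iff w k).2 h, hw]; simp
        · obtain ⟨hE, hc⟩ := hdeg w k h hw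
          rw [value_eq_zero_of_independent γ k (wordSimplex_δ_independent w h hE hc)]; simp
      · rw [hswap w k h, smul_neg, add_neg_cancel]
    · intro he
      have he := (swap_word_eq_iff w k).1 he
      refine h ?_
      by_cases hw : c w = 0
      · rw [hw, smul_zero]
      · obtain ⟨hE, hc⟩ := hdeg w k he hw
        rw [value_eq_zero_of_independent γ k (wordSimplex_δ_independent w he hE hc), zero_smul]
    · funext l
      simp
  rw [Finset.sum_congr rfl fun w _ => h1 w, ← Finset.smul_sum, Finset.sum_comm]
  congr 1
  simp only [← Finset.smul_sum]
  rw [Fin.sum_univ_castSucc, Fin.sum_univ_succ]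
  simp only [Fin.castSucc_zero, Fin.val_zero, pow_zero, one_smul, inner, smul_zero,
    Finset.sum_const_zero, add_zero, Fin.val_last]
  rw [sum_words_cons, sum_words_snoc]
  simp only [wordSimplex_δ_zero]

end Words

/-- The polydisc with discs in the coordinates belonging to `σ` and circles in the others. -/
def polydisc (σ : Finset (Fin m)) : Set (Fin m → ℂ) :=
  {z | (∀ i, z i ∈ Metric.closedBall (0 : ℂ) 1) ∧ ∀ i, i ∉ σ → z i ∈ Metric.sphere (0 : ℂ) 1}

/-- The polydiscs whose union is the moment-angle complex of `K`. -/
def polydiscs (K : SimplicialComplexOn m) : Set (Set (Fin m → ℂ)) := polydisc '' K.faces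

theorem polydiscs_mono {K L : SimplicialComplexOn m} (h : L ≤ K) :
    ∀ U ∈ polydiscs L, ∃ V ∈ polydiscs K, U ⊆ V :=
  fun U hU => ⟨U, Set.image_mono h hU, subset_rfl⟩

/-- The singular simplices that lie in one of the polydiscs of `K`. -/
def smallFunctor (m : ℕ) : SimplicialComplexOn m ⥤ SSet.{0} where
  obj K := small (polydiscs K)
  map f := smallIncl (polydiscs_mono (leOfHom f))
  map_id _ := rfl
  map_comp _ _ := rfl

/-- The sign `(-1) ^ (n (n + 1) / 2)`, which relates the sign conventions for cochains to those for
`A(K)`. -/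
def sgn (n : ℕ) : ℤ := ∏ i ∈ Finset.range n, (-1) ^ (i + 1)

theorem sgn_zero : sgn 0 = 1 := rfl

theorem sgn_succ (n : ℕ) : sgn (n + 1) = (-1) ^ (n + 1) * sgn n := by
  rw [sgn, Finset.prod_range_succ, mul_comm]; rfl

theorem sgn_add (p q : ℕ) : sgn (p + q) = sgn p * sgn q * (-1) ^ (p * q) := by
  induction q with
  | zero => simp [sgn_zero]
  | succ q ih =>
    rw [← add_assoc, sgn_succ, ih, sgn_succ]
    ring

variable {K L : SimplicialComplexOn m}

theorem wordSimplex_mem {w : Fin n → Fin m} (h : ∀ j, (List.ofFn w).count j ≤ 2)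
    (τ : stdSimplex ℝ (Fin (n + 1))) : wordSimplex ∅ w τ ∈ polydisc (repeated (List.ofFn w)) := by
  have hv : ∀ k : Fin n, partialSum k τ ≤ 1 := fun k => partialSum_le_one k τ
  refine ⟨fun i => ?_, fun i hi => ?_⟩
  · rw [mem_closedBall_zero_iff, wordSimplex_apply, coord, if_neg (Finset.notMem_empty i)]
    have h2 := (letterSum_of_count (i := i) w _ hv).2.2 (h i)
    have h1 := letterSup_le_letterSum (i := i) w fun k => partialSum k τ
    rw [← NNReal.coe_le_coe] at h1 h2
    rw [NNReal.coe_add, NNReal.coe_one] at h2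
    exact norm_loopDisc_le (by linarith) (by linarith) _
  · have hc : (List.ofFn w).count i ≤ 1 := by
      by_contra hc
      exact hi (by simp only [repeated, Finset.mem_filter, Finset.mem_univ, true_and]; omega)
    rw [mem_sphere_zero_iff_norm, wordSimplex_apply, coord, if_neg (Finset.notMem_empty i),
      (letterSum_of_count (i := i) w _ hv).2.1 hc, sub_add_cancel]
    exact norm_loopDisc_one _

theorem bMk_listMono_ne_zero {l : List (Fin m)} (h : K.bMk ℤ (K.listMono ℤ l) ≠ 0) :
    (∀ j, l.count j ≤ 2) ∧ repeated l ∈ K.faces := by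
  refine ⟨fun j => ?_, ?_⟩
  · by_contra hj
    exact h (bMk_eq_zero_iff.2 (listMono_mem_idealB (j := j) (by omega)))
  · by_contra hj
    exact h (by rw [listMono_eq_zero hj, map_zero])

theorem wordSimplex_small {w : Fin n → Fin m} (h : K.bMk ℤ (K.listMono ℤ (List.ofFn w)) ≠ 0) :
    ∃ U ∈ polydiscs K, ∀ τ, wordSimplex ∅ w τ ∈ U :=
  ⟨_, ⟨_, (bMk_listMono_ne_zero h).2, rfl⟩, wordSimplex_mem (bMk_listMono_ne_zero h).1⟩

theorem listMono_swap {w : Fin (n + 1) → Fin m} {k : Fin n} (h : w k.castSucc ≠ w k.succ) :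
    K.listMono ℤ (List.ofFn (w ∘ Equiv.swap k.castSucc k.succ)) = - K.listMono ℤ (List.ofFn w) := by
  induction n with
  | zero => exact k.elim0
  | succ n ih =>
    rw [List.ofFn_succ, List.ofFn_succ (f := w), listMono_cons, listMono_cons]
    induction k using Fin.cases with
    | zero =>
      rw [List.ofFn_succ, List.ofFn_succ (f := fun i => w i.succ), listMono_cons, listMono_cons]
      have h0 : (w ∘ Equiv.swap (Fin.castSucc (0 : Fin (n + 1))) (Fin.succ 0)) 0 = w 1 := by simp
      have h1 : (w ∘ Equiv.swap (Fin.castSucc (0 : Fin (n + 1))) (Fin.succ 0)) (Fin.succ 0) = w 0 := by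
        simp
      have h2 : ∀ i : Fin n, (w ∘ Equiv.swap (Fin.castSucc (0 : Fin (n + 1))) (Fin.succ 0))
          i.succ.succ = w i.succ.succ := by
        intro i
        rw [Function.comp_apply, Equiv.swap_apply_of_ne_of_ne]
        · simp [Fin.ext_iff]
        · simp [Fin.ext_iff]
      simp only [h0, h1, h2]
      exact letterOp_anticomm h.symm _
    | succ k =>
      have h0 : (w ∘ Equiv.swap k.succ.castSucc k.succ.succ) 0 = w 0 := by
        rw [Function.comp_apply, Equiv.swap_apply_of_ne_of_ne]
        · simp [Fin.ext_iff]
        · simp [Fin.ext_iff]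
      have h1 : (fun i : Fin (n + 1) => (w ∘ Equiv.swap k.succ.castSucc k.succ.succ) i.succ) =
          (fun i => w i.succ) ∘ Equiv.swap k.castSucc k.succ := by
        funext i
        simp only [Function.comp_apply]
        by_cases e1 : i = k.castSucc
        · subst e1
          rw [Equiv.swap_apply_left, Fin.succ_castSucc, Equiv.swap_apply_left]
        · by_cases e2 : i = k.succ
          · subst e2
            rw [Equiv.swap_apply_right, Equiv.swap_apply_right, Fin.succ_castSucc]
          · rw [Equiv.swap_apply_of_ne_of_ne e1 e2, Equiv.swap_apply_of_ne_of_ne]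
            · rw [← Fin.succ_castSucc]; exact fun h => e1 (Fin.succ_injective _ h)
            · exact fun h => e2 (Fin.succ_injective _ h)
      rw [h0, h1, ih (w := fun i => w i.succ) (k := k) h, map_neg]

/-- The value of the comparison map on a cochain. -/
def wordSum (K : SimplicialComplexOn m) (γ : (dga ℤ (small (polydiscs K))).cx.X n) : K.BRing ℤ :=
  sgn n • ∑ w : Fin n → Fin m, value γ (wordSimplex ∅ w) • K.bMk ℤ (K.listMono ℤ (List.ofFn w))

theorem wordSum_mem (γ : (dga ℤ (small (polydiscs K))).cx.X n) : wordSum K γ ∈ K.gradeB ℤ n := by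
  refine Submodule.smul_mem _ _ (Submodule.sum_mem _ fun w _ => Submodule.smul_mem _ _ ⟨_, ?_, rfl⟩)
  have := listMono_mem (R := ℤ) (K := K) (List.ofFn w)
  rwa [List.length_ofFn] at this

/-- The first faces contribute the operators `letterOp` and the last faces multiplication by `s j`;
the difference of the two is the differential. -/
theorem wordSum_d (γ : (dga ℤ (small (polydiscs K))).cx.X n) :
    wordSum K ((dga ℤ (small (polydiscs K))).cx.d n (n + 1) γ) = K.dB ℤ (wordSum K γ) := by
  rw [wordSum, sum_value_d γ (fun w => K.bMk ℤ (K.listMono ℤ (List.ofFn w)))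
    (fun w => wordSimplex_small) (fun w k h => by rw [listMono_swap h, map_neg])
    (fun w k _ hw => ⟨Finset.notMem_empty _, (bMk_listMono_ne_zero hw).1 _⟩)]
  have h1 : ∀ (w : Fin n → Fin m) (j : Fin m),
      value γ ((wordSimplex ∅ (Fin.snoc w j : Fin (n + 1) → Fin m)).comp
        (simplexMap (SimplexCategory.δ (Fin.last (n + 1))))) •
          K.bMk ℤ (K.listMono ℤ (List.ofFn (Fin.snoc w j : Fin (n + 1) → Fin m))) =
      (-1 : ℤ) ^ n • value γ (wordSimplex ∅ w) •
        K.bMk ℤ (K.s ℤ j * K.listMono ℤ (List.ofFn w)) := by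
    intro w j
    by_cases h : ∃ k, w k = j
    · obtain ⟨k, hk⟩ := h
      rw [value_eq_zero_of_independent γ k
        (wordSimplex_δ_last_independent (Finset.notMem_empty j) w hk), zero_smul,
        bMk_eq_zero_iff.2 (s_mul_listMono_mem_idealB (by rw [List.mem_ofFn]; exact ⟨k, hk⟩)),
        smul_zero, smul_zero]
    · push Not at h
      have hl : List.ofFn (Fin.snoc w j : Fin (n + 1) → Fin m) = List.ofFn w ++ [j] := by
        rw [List.ofFn_succ', List.concat_eq_append]
        simp
      rw [wordSimplex_δ_last (Finset.notMem_empty j) w h, hl, listMono_concat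
        (by rw [List.mem_ofFn]; rintro ⟨k, hk⟩; exact h k hk), List.length_ofFn, map_smul,
        smul_comm]
  simp only [h1, List.ofFn_cons]
  have h2 : K.dB ℤ (wordSum K γ) = sgn n • ∑ w : Fin n → Fin m, value γ (wordSimplex ∅ w) •
      K.bMk ℤ (K.dA ℤ (K.listMono ℤ (List.ofFn w))) := by
    rw [wordSum, map_smul, map_sum]
    exact congrArg _ (Finset.sum_congr rfl fun w _ => by rw [map_smul]; rfl)
  have h3 : ∑ w : Fin n → Fin m, value γ (wordSimplex ∅ w) •
      K.bMk ℤ (K.dA ℤ (K.listMono ℤ (List.ofFn w))) =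
      ∑ j, ∑ w : Fin n → Fin m, value γ (wordSimplex ∅ w) •
        K.bMk ℤ (K.listMono ℤ (j :: List.ofFn w)) -
      ∑ j, ∑ w : Fin n → Fin m, value γ (wordSimplex ∅ w) •
        K.bMk ℤ (K.s ℤ j * K.listMono ℤ (List.ofFn w)) := by
    rw [Finset.sum_comm, Finset.sum_comm (s := Finset.univ (α := Fin m)),
      ← Finset.sum_sub_distrib]
    refine Finset.sum_congr rfl fun w _ => ?_
    rw [dA_listMono, map_sum, Finset.smul_sum, ← Finset.sum_sub_distrib]
    exact Finset.sum_congr rfl fun j _ => by rw [map_sub, smul_sub]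
  rw [h2, h3, sgn_succ]
  simp only [← Finset.smul_sum]
  rcases neg_one_pow_eq_or ℤ n with h | h <;> simp [pow_succ, h, sub_eq_add_neg]

theorem wordSum_one : wordSum K (dga ℤ (small (polydiscs K))).one = 1 := by
  have h : ∀ w : Fin 0 → Fin m, K.bMk ℤ (K.listMono ℤ (List.ofFn w)) = 1 := fun w => by
    rw [List.ofFn_zero, listMono_nil, map_one]
  have hs : ∀ w : Fin 0 → Fin m, ∃ U ∈ polydiscs K, ∀ τ, wordSimplex ∅ w τ ∈ U := fun w => by
    have hr : repeated ([] : List (Fin m)) = ∅ := by simp [repeated]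
    have := wordSimplex_mem (w := w) (by simp)
    rw [List.ofFn_zero, hr] at this
    exact ⟨_, ⟨_, K.empty_mem, rfl⟩, this⟩
  simp only [wordSum, sgn_zero, one_smul, h, Finset.univ_unique, Finset.sum_singleton]
  rw [value_of_mem _ (hs _), toFun_one, one_smul]

theorem wordSum_mul {p q n : ℕ} (h : p + q = n) (a : (dga ℤ (small (polydiscs K))).cx.X p)
    (b : (dga ℤ (small (polydiscs K))).cx.X q) :
    wordSum K ((dga ℤ (small (polydiscs K))).mul h a b) = wordSum K a * wordSum K b := by
  subst h
  have key : ∀ (w : Fin p → Fin m) (w' : Fin q → Fin m),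
      value ((dga ℤ (small (polydiscs K))).mul rfl a b) (wordSimplex ∅ (Fin.append w w')) •
        K.bMk ℤ (K.listMono ℤ (List.ofFn (Fin.append w w'))) =
      (-1 : ℤ) ^ (p * q) • ((value a (wordSimplex ∅ w) • K.bMk ℤ (K.listMono ℤ (List.ofFn w))) *
        (value b (wordSimplex ∅ w') • K.bMk ℤ (K.listMono ℤ (List.ofFn w')))) := by
    intro w w'
    rw [smul_mul_smul_comm, ← map_mul]
    by_cases hw : ∃ k l, w k = w' l
    · obtain ⟨k, l, hkl⟩ := hw
      rw [bMk_eq_zero_iff.2 (listMono_mul_mem_idealB (j := w k)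
        (by rw [List.mem_ofFn]; exact ⟨k, rfl⟩) (by rw [List.mem_ofFn]; exact ⟨l, hkl.symm⟩)),
        smul_zero, smul_zero]
      by_cases hs : ∃ U ∈ polydiscs K, ∀ τ, wordSimplex ∅ (Fin.append w w') τ ∈ U
      · rw [value_mul _ _ _ hs, value_eq_zero_of_independent a k
          (wordSimplex_front_independent w w' hkl fun _ => Finset.notMem_empty _), zero_mul,
          mul_zero, zero_smul]
      · rw [value, dif_neg hs, zero_smul]
    · push Not at hw
      rw [List.ofFn_fin_append, listMono_append (by
        simp only [List.mem_ofFn]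
        rintro _ ⟨k, rfl⟩ ⟨l, hl⟩
        exact hw k l hl.symm)]
      by_cases hz : K.bMk ℤ (K.listMono ℤ (List.ofFn w) * K.listMono ℤ (List.ofFn w')) = 0
      · rw [hz, smul_zero, smul_zero, smul_zero]
      · rw [value_mul _ _ _ (wordSimplex_small (K := K) (by
          rw [List.ofFn_fin_append, listMono_append (by
            simp only [List.mem_ofFn]
            rintro _ ⟨k, rfl⟩ ⟨l, hl⟩
            exact hw k l hl.symm)]
          exact hz)), wordSimplex_back, wordSimplex_front w w' hw fun _ => Finset.notMem_empty _,
          mul_smul]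
  rw [wordSum, sum_words_append, wordSum, wordSum, smul_mul_smul_comm, Finset.sum_mul_sum]
  simp only [key, ← Finset.smul_sum]
  rw [smul_smul, sgn_add, mul_assoc, ← mul_pow, neg_one_mul, neg_neg, one_pow, mul_one]

theorem bRestrict_wordSum (h : L ≤ K) (γ : (dga ℤ (small (polydiscs K))).cx.X n) :
    wordSum L ((pull ℤ (smallIncl (polydiscs_mono h))).f n γ) = bRestrict ℤ h (wordSum K γ) := by
  rw [wordSum, wordSum, map_smul, map_sum]
  congr 1
  refine Finset.sum_congr rfl fun w _ => ?_
  rw [map_smul, bRestrict_mk, aRestrict_listMono]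
  by_cases hw : L.bMk ℤ (L.listMono ℤ (List.ofFn w)) = 0
  · rw [hw, smul_zero, smul_zero]
  · rw [value_incl _ _ (wordSimplex_small hw)]

theorem wordSum_add (a b : (dga ℤ (small (polydiscs K))).cx.X n) :
    wordSum K (a + b) = wordSum K a + wordSum K b := by
  simp only [wordSum, value_add, add_smul, Finset.sum_add_distrib, smul_add]

/-- The comparison map for a single simplicial complex: the values of a cochain on the word simplices,
as coefficients of monomials of `B(K)`. -/
def comparison (K : SimplicialComplexOn m) : dga ℤ (small (polydiscs K)) ⟶ dgaB ℤ K where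
  toHom := CochainComplex.ofHom (fun n => ModuleCat.ofHom (AddMonoidHom.toIntLinearMap
      (AddMonoidHom.mk' (fun γ : normalizedCochains ℤ (small (polydiscs K)) n =>
        (⟨wordSum K γ, wordSum_mem γ⟩ : K.gradeB ℤ n)) fun a b => Subtype.ext (wordSum_add a b))))
    (fun n => ModuleCat.hom_ext (LinearMap.ext fun γ => valB_injective
      ((valB_d n _).trans (wordSum_d γ).symm)))
  map_one := Subtype.ext wordSum_one
  map_mul h a b := Subtype.ext (wordSum_mul h a b)

theorem valB_comparison (γ : (dga ℤ (small (polydiscs K))).cx.X n) :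
    valB ((comparison K).toHom.f n γ) = wordSum K γ := rfl

/-- The natural comparison map. -/
def comparisonNat (m : ℕ) : (smallFunctor m).op ⋙ SingularCochains.functor ℤ ⟶ functorB ℤ m where
  app K := comparison K.unop
  naturality _ _ f := DGA.hom_ext fun _ γ => Subtype.ext
    (bRestrict_wordSum (leOfHom f.unop) γ)

end

end MomentAngle

/-! ### Normalization and homotopy invariance -/

namespace SingularCochains

noncomputable section

open AlgebraicTopology

section Pairing

variable {A B : Type}

/-- The homomorphism from the free abelian group on `A` to `ℤ` given by a function on `A`. -/
def pairing (β : A → ℤ) : (ModuleCat.free ℤ).obj A ⟶ ModuleCat.of ℤ ℤ :=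
  ModuleCat.freeDesc (R := ℤ) (M := ModuleCat.of ℤ ℤ) (↾β)

/-- The function on `A` given by a homomorphism from the free abelian group on `A` to `ℤ`. -/
def evaluation (φ : (ModuleCat.free ℤ).obj A ⟶ ModuleCat.of ℤ ℤ) (x : A) : ℤ :=
  φ (ModuleCat.freeMk (R := ℤ) x)

theorem evaluation_pairing (β : A → ℤ) : evaluation (pairing β) = β :=
  funext fun x => by rw [evaluation, pairing, ModuleCat.freeDesc_apply]; rfl

theorem evaluation_injective {φ ψ : (ModuleCat.free ℤ).obj A ⟶ ModuleCat.of ℤ ℤ}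
    (h : evaluation φ = evaluation ψ) : φ = ψ :=
  ModuleCat.free_hom_ext fun x => congrFun h x

theorem pairing_evaluation (φ : (ModuleCat.free ℤ).obj A ⟶ ModuleCat.of ℤ ℤ) :
    pairing (evaluation φ) = φ :=
  evaluation_injective (evaluation_pairing _)

theorem evaluation_map (f : A ⟶ B) (φ : (ModuleCat.free ℤ).obj B ⟶ ModuleCat.of ℤ ℤ) (x : A) :
    evaluation ((ModuleCat.free ℤ).map f ≫ φ) x = evaluation φ (f x) :=
  (ModuleCat.comp_apply _ _ _).trans (congrArg φ (ModuleCat.free_map_apply _ _))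

theorem evaluation_add (φ ψ : (ModuleCat.free ℤ).obj A ⟶ ModuleCat.of ℤ ℤ) (x : A) :
    evaluation (φ + ψ) x = evaluation φ x + evaluation ψ x := rfl

theorem evaluation_zsmul (c : ℤ) (φ : (ModuleCat.free ℤ).obj A ⟶ ModuleCat.of ℤ ℤ) (x : A) :
    evaluation (c • φ) x = c * evaluation φ x := rfl

theorem evaluation_zero (x : A) :
    evaluation (0 : (ModuleCat.free ℤ).obj A ⟶ ModuleCat.of ℤ ℤ) x = 0 := rfl

theorem evaluation_sum {ι : Type} (s : Finset ι)
    (φ : ι → ((ModuleCat.free ℤ).obj A ⟶ ModuleCat.of ℤ ℤ)) (x : A) :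
    evaluation (∑ i ∈ s, φ i) x = ∑ i ∈ s, evaluation (φ i) x := by
  induction s using Finset.cons_induction with
  | empty => rfl
  | cons a s ha ih => rw [Finset.sum_cons, Finset.sum_cons, evaluation_add, ih]

end Pairing

variable {S T : SSet.{0}}

/-- The boundary of unnormalized chains. -/
def boundary (S : SSet.{0}) (n : ℕ) :
    (ModuleCat.free ℤ).obj (S _⦋n + 1⦌) ⟶ (ModuleCat.free ℤ).obj (S _⦋n⦌) :=
  ∑ i : Fin (n + 2), (-1 : ℤ) ^ (i : ℕ) • (ModuleCat.free ℤ).map (S.δ i)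

theorem coboundaryFun_eq {n : ℕ} (β : S _⦋n⦌ → ℤ) :
    coboundaryFun ℤ S n β = (-(-1) ^ n : ℤ) • evaluation (boundary S n ≫ pairing β) := by
  funext x
  rw [coboundaryFun_apply, Pi.smul_apply, smul_eq_mul, boundary, Preadditive.sum_comp,
    evaluation_sum]
  refine congrArg _ (Finset.sum_congr rfl fun i _ => ?_)
  rw [Preadditive.zsmul_comp, evaluation_zsmul, evaluation_map, evaluation_pairing]

/-- The simplicial free abelian group on a simplicial set. -/
def freeSimplicial : SSet.{0} ⥤ SimplicialObject (ModuleCat.{0} ℤ) :=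
  (SimplicialObject.whiskering _ _).obj (ModuleCat.free ℤ)

theorem chains_d (S : SSet.{0}) (n : ℕ) :
    ((alternatingFaceMapComplex (ModuleCat.{0} ℤ)).obj (freeSimplicial.obj S)).d (n + 1) n =
      boundary S n :=
  alternatingFaceMapComplex_obj_d (freeSimplicial.obj S) n

/-- The Dold-Kan projector of the chains onto a complement of the degenerate chains. -/
def normalizer (S : SSet.{0}) (n : ℕ) :
    (ModuleCat.free ℤ).obj (S _⦋n⦌) ⟶ (ModuleCat.free ℤ).obj (S _⦋n⦌) :=
  (DoldKan.PInfty (X := freeSimplicial.obj S)).f n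

theorem normalizer_boundary (S : SSet.{0}) (n : ℕ) :
    normalizer S (n + 1) ≫ boundary S n = boundary S n ≫ normalizer S n := by
  rw [← chains_d]
  exact (DoldKan.PInfty (X := freeSimplicial.obj S)).comm (n + 1) n

theorem σ_normalizer (S : SSet.{0}) {n : ℕ} (j : Fin (n + 1)) :
    (ModuleCat.free ℤ).map (S.σ j) ≫ normalizer S (n + 1) = 0 :=
  DoldKan.σ_comp_PInfty (freeSimplicial.obj S) j

theorem PInfty_comp_of_degeneraciesVanish {X : SimplicialObject (ModuleCat.{0} ℤ)} {n : ℕ}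
    {M : ModuleCat.{0} ℤ} (φ : X _⦋n⦌ ⟶ M) (h : DoldKan.DegeneraciesVanish φ) :
    DoldKan.PInfty.f n ≫ φ = φ := by
  have h1 := (DoldKan.degeneraciesVanish_iff_QInfty_f_comp φ).1 h
  have h2 := DoldKan.PInfty_f_add_QInfty_f (X := X) n =≫ φ
  rw [Preadditive.add_comp, h1, add_zero] at h2
  exact h2.trans (Category.id_comp φ)

theorem normalizer_comp {n : ℕ} {M : ModuleCat.{0} ℤ}
    (φ : (ModuleCat.free ℤ).obj (S _⦋n + 1⦌) ⟶ M)
    (h : ∀ j, (ModuleCat.free ℤ).map (S.σ j) ≫ φ = 0) : normalizer S (n + 1) ≫ φ = φ :=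
  PInfty_comp_of_degeneraciesVanish (X := freeSimplicial.obj S) φ h

theorem map_normalizer (i : T ⟶ S) (n : ℕ) :
    (ModuleCat.free ℤ).map (i.app (op ⦋n⦌)) ≫ normalizer S n =
      normalizer T n ≫ (ModuleCat.free ℤ).map (i.app (op ⦋n⦌)) :=
  DoldKan.PInfty_f_naturality n (freeSimplicial.map i)

/-- If a normalized cochain is the coboundary of a cochain `β`, then `β` can be chosen normalized.
Vanishing of `β` on a simplicial subset can be preserved. -/
theorem exists_normalized {n : ℕ} (i : T ⟶ S) (γ : (dga ℤ S).cx.X (n + 1)) (β : S _⦋n⦌ → ℤ)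
    (hβ : coboundaryFun ℤ S n β = toFun γ) (hi : ∀ x, β (i.app _ x) = 0) :
    ∃ β' : (dga ℤ S).cx.X n, (dga ℤ S).cx.d n (n + 1) β' = γ ∧ (pull ℤ i).f n β' = 0 := by
  have h1 : evaluation (normalizer S n ≫ pairing β) ∈ normalizedCochains ℤ S n := by
    intro x hx
    cases n with
    | zero => simp at hx
    | succ n =>
      rw [SSet.degenerate_eq_iUnion_range_σ] at hx
      obtain ⟨j, y, rfl⟩ := Set.mem_iUnion.1 hx
      rw [← evaluation_map, ← Category.assoc, σ_normalizer, Limits.zero_comp, evaluation_zero]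
  obtain ⟨β', hβ'⟩ := exists_toFun h1
  refine ⟨β', toFun_injective ?_, toFun_injective (funext fun x => ?_)⟩
  · have h3 : normalizer S (n + 1) ≫ pairing (toFun γ) = pairing (toFun γ) := by
      refine normalizer_comp _ fun j => evaluation_injective (funext fun x => ?_)
      rw [evaluation_map, evaluation_pairing, toFun_degenerate γ (S.σ_mem_degenerate _ _),
        evaluation_zero]
    have h5 : pairing (toFun γ) = (-(-1) ^ n : ℤ) • (boundary S n ≫ pairing β) := by
      refine evaluation_injective ?_
      rw [evaluation_pairing, ← hβ, coboundaryFun_eq]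
      rfl
    rw [toFun_d, hβ', coboundaryFun_eq, pairing_evaluation, ← Category.assoc,
      ← normalizer_boundary, Category.assoc, ← evaluation_pairing (toFun γ), ← h3, h5,
      Preadditive.comp_zsmul]
    rfl
  · rw [toFun_pull, hβ', ← evaluation_map, ← Category.assoc, map_normalizer, Category.assoc]
    have : (ModuleCat.free ℤ).map (i.app (op ⦋n⦌)) ≫ pairing β = 0 := by
      refine evaluation_injective (funext fun x => ?_)
      rw [evaluation_map, evaluation_pairing, hi, evaluation_zero]
    rw [this, Limits.comp_zero, evaluation_zero]
    rfl

section Homotopy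

variable {X Y : SimplicialObject (ModuleCat.{0} ℤ)} {f g : X ⟶ Y}

theorem homotopy_comm_zero (H : SimplicialObject.Homotopy f g) :
    ((alternatingFaceMapComplex (ModuleCat.{0} ℤ)).map f).f 0 = H.toChainHomotopy.hom 0 1 ≫
      ((alternatingFaceMapComplex (ModuleCat.{0} ℤ)).obj Y).d 1 0 +
        ((alternatingFaceMapComplex (ModuleCat.{0} ℤ)).map g).f 0 := by
  have h := H.toChainHomotopy.comm 0
  rw [Homotopy.prevD_chainComplex, Homotopy.dNext_zero_chainComplex, zero_add] at h
  exact h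

theorem homotopy_comm_succ (H : SimplicialObject.Homotopy f g) (n : ℕ) :
    ((alternatingFaceMapComplex (ModuleCat.{0} ℤ)).map f).f (n + 1) =
      ((alternatingFaceMapComplex (ModuleCat.{0} ℤ)).obj X).d (n + 1) n ≫
        H.toChainHomotopy.hom n (n + 1) + H.toChainHomotopy.hom (n + 1) (n + 2) ≫
      ((alternatingFaceMapComplex (ModuleCat.{0} ℤ)).obj Y).d (n + 2) (n + 1) +
        ((alternatingFaceMapComplex (ModuleCat.{0} ℤ)).map g).f (n + 1) := by
  have h := H.toChainHomotopy.comm (n + 1)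
  rw [Homotopy.prevD_chainComplex, Homotopy.dNext_succ_chainComplex] at h
  exact h

end Homotopy

/-- The chain homotopy given by a simplicial homotopy. -/
def prism {f g : S ⟶ T} (H : SimplicialObject.Homotopy f g) (n : ℕ) :
    (ModuleCat.free ℤ).obj (S _⦋n⦌) ⟶ (ModuleCat.free ℤ).obj (T _⦋n + 1⦌) :=
  (H.whiskerRight (ModuleCat.free ℤ)).toChainHomotopy.hom n (n + 1)

theorem prism_zero {f g : S ⟶ T} (H : SimplicialObject.Homotopy f g) :
    (ModuleCat.free ℤ).map (f.app (op ⦋0⦌)) =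
      prism H 0 ≫ boundary T 0 + (ModuleCat.free ℤ).map (g.app (op ⦋0⦌)) := by
  rw [← chains_d]
  exact homotopy_comm_zero (H.whiskerRight (ModuleCat.free ℤ))

theorem prism_succ {f g : S ⟶ T} (H : SimplicialObject.Homotopy f g) (n : ℕ) :
    (ModuleCat.free ℤ).map (f.app (op ⦋n + 1⦌)) =
      boundary S n ≫ prism H n + prism H (n + 1) ≫ boundary T (n + 1) +
        (ModuleCat.free ℤ).map (g.app (op ⦋n + 1⦌)) := by
  rw [← chains_d, ← chains_d]
  exact homotopy_comm_succ (H.whiskerRight (ModuleCat.free ℤ)) n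

/-- Simplicially homotopic maps induce the same map on cohomology. -/
theorem isCoboundary_of_simplicialHomotopy {n : ℕ} {f g : S ⟶ T}
    (H : SimplicialObject.Homotopy f g)
    (γ : (dga ℤ T).cx.X n) (hγ : (dga ℤ T).cx.d n (n + 1) γ = 0) :
    IsCoboundary (dga ℤ S).cx n ((pull ℤ f).f n γ - (pull ℤ g).f n γ) := by
  have hb : boundary T n ≫ pairing (toFun γ) = 0 := by
    refine evaluation_injective (funext fun x => ?_)
    have h := congrFun (coboundaryFun_eq (toFun γ)) x
    rw [← toFun_d, hγ, map_zero, Pi.smul_apply, Pi.zero_apply, smul_eq_mul] at h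
    exact ((mul_eq_zero.1 h.symm).resolve_left (by simp))
  cases n with
  | zero =>
    have h := prism_zero H =≫ pairing (toFun γ)
    rw [Preadditive.add_comp, Category.assoc, hb, Limits.comp_zero, zero_add] at h
    have : (pull ℤ f).f 0 γ = (pull ℤ g).f 0 γ := toFun_injective (funext fun x => by
      have := congrFun (congrArg evaluation h) x
      rwa [evaluation_map, evaluation_map, evaluation_pairing] at this)
    rw [this, sub_self]
    exact isCoboundary_zero 0
  | succ n =>
    have h := prism_succ H n =≫ pairing (toFun γ)
    rw [Preadditive.add_comp, Preadditive.add_comp, Category.assoc, Category.assoc, hb,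
      Limits.comp_zero, add_zero] at h
    have hβ : coboundaryFun ℤ S n ((-(-1) ^ n : ℤ) • evaluation (prism H n ≫ pairing (toFun γ))) =
        toFun ((pull ℤ f).f (n + 1) γ - (pull ℤ g).f (n + 1) γ) := by
      rw [map_smul, coboundaryFun_eq, pairing_evaluation, smul_smul]
      funext x
      have := congrFun (congrArg evaluation h) x
      rw [evaluation_add, evaluation_map, evaluation_map, evaluation_pairing] at this
      rw [map_sub, Pi.smul_apply, Pi.sub_apply, toFun_pull, toFun_pull, this, add_sub_cancel_right,
        neg_mul_neg, ← mul_pow, neg_one_mul, neg_neg, one_pow, one_smul]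
    let e : (⊥ : S.Subcomplex).toSSet ⟶ S := (⊥ : S.Subcomplex).ι
    obtain ⟨β', h1, -⟩ := exists_normalized e _ _ hβ (fun x => x.2.elim)
    exact ⟨n, β', h1⟩

/-! ### Homotopies of continuous maps -/

section Topology

variable {X Y : Type} [TopologicalSpace X] [TopologicalSpace Y] {𝒰 : Set (Set X)} {𝒱 : Set (Set Y)}

open MonoidalCategory CartesianMonoidalCategory

/-- The second barycentric coordinate of the map to the `1`-simplex given by a simplex of `Δ[1]`. -/
def heightOf {Δ : SimplexCategoryᵒᵖ} (φ : Δ[1].obj Δ) :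
    C(stdSimplex ℝ (Fin (Δ.unop.len + 1)), ℝ) :=
  ⟨fun τ => simplexMap (SSet.stdSimplex.objEquiv φ) τ (1 : Fin 2), by
    exact (continuous_apply (1 : Fin 2)).comp
      (continuous_subtype_val.comp (simplexMap (SSet.stdSimplex.objEquiv φ)).continuous)⟩

theorem heightOf_apply {Δ : SimplexCategoryᵒᵖ} (φ : Δ[1].obj Δ)
    (τ : stdSimplex ℝ (Fin (Δ.unop.len + 1))) : heightOf φ τ =
      ∑ j, if (SSet.stdSimplex.objEquiv φ).toOrderHom j = (1 : Fin 2) then τ j else 0 := by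
  change FunOnFinite.linearMap ℝ ℝ _ τ.1 (1 : Fin 2) = _
  rw [FunOnFinite.linearMap_apply_apply, Finset.sum_filter]
  rfl

theorem heightOf_mem {Δ : SimplexCategoryᵒᵖ} (φ : Δ[1].obj Δ)
    (τ : stdSimplex ℝ (Fin (Δ.unop.len + 1))) : heightOf φ τ ∈ Set.Icc (0 : ℝ) 1 := by
  rw [heightOf_apply]
  refine ⟨Finset.sum_nonneg fun j _ => ?_, ?_⟩
  · split_ifs
    exacts [τ.2.1 j, le_rfl]
  · rw [← τ.2.2]
    refine Finset.sum_le_sum fun j _ => ?_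
    split_ifs
    exacts [le_rfl, τ.2.1 j]

theorem heightOf_map {Δ Δ' : SimplexCategoryᵒᵖ} (f : Δ ⟶ Δ') (φ : Δ[1].obj Δ) :
    heightOf (Δ[1].map f φ) = (heightOf φ).comp (simplexMap f.unop) := by
  have h := simplexMap_comp f.unop (SSet.stdSimplex.objEquiv φ)
  refine ContinuousMap.ext fun τ => ?_
  exact congrArg (fun g => (g τ : Fin 2 → ℝ) 1) h.symm

/-- The map of simplicial sets given by a homotopy that is compatible with `𝒰` and `𝒱`. -/
def smallHomotopyMap (F : C(X × ℝ, Y))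
    (h : ∀ U ∈ 𝒰, ∃ V ∈ 𝒱, ∀ x ∈ U, ∀ t ∈ Set.Icc (0 : ℝ) 1, F (x, t) ∈ V) :
    small 𝒰 ⊗ Δ[1] ⟶ small 𝒱 where
  app Δ := ↾fun p : (small 𝒰).obj Δ × Δ[1].obj Δ => ⟨F.comp (p.1.1.prodMk (heightOf p.2)), by
    obtain ⟨U, hU, hx⟩ := p.1.2
    obtain ⟨V, hV, hF⟩ := h U hU
    exact ⟨V, hV, fun τ => hF _ (hx τ) _ (heightOf_mem _ τ)⟩⟩
  naturality Δ Δ' f := by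
    refine TypeCat.Hom.ext (TypeCat.Fun.ext (funext fun p => Subtype.ext ?_))
    refine ContinuousMap.ext fun τ => ?_
    exact congrArg (fun r => F (p.1.1 (simplexMap f.unop τ), r))
      (DFunLike.congr_fun (heightOf_map f p.2) τ)

theorem isCoboundary_of_homotopy {n : ℕ} (F : C(X × ℝ, Y))
    (h : ∀ U ∈ 𝒰, ∃ V ∈ 𝒱, ∀ x ∈ U, ∀ t ∈ Set.Icc (0 : ℝ) 1, F (x, t) ∈ V) {f g : C(X, Y)}
    (hf : ∀ U ∈ 𝒰, ∃ V ∈ 𝒱, Set.MapsTo f U V) (hg : ∀ U ∈ 𝒰, ∃ V ∈ 𝒱, Set.MapsTo g U V)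
    (h0 : ∀ x, F (x, 0) = f x) (h1 : ∀ x, F (x, 1) = g x)
    (γ : (dga ℤ (small 𝒱)).cx.X n) (hγ : (dga ℤ (small 𝒱)).cx.d n (n + 1) γ = 0) :
    IsCoboundary (dga ℤ (small 𝒰)).cx n
      ((pull ℤ (smallMap f hf)).f n γ - (pull ℤ (smallMap g hg)).f n γ) := by
  refine isCoboundary_of_simplicialHomotopy
    (SSet.Homotopy.toSimplicialObjectHomotopy (?_ : SSet.Homotopy _ _)) γ hγ
  have key : ∀ (Δ : SimplexCategoryᵒᵖ) (k : Fin 2) (φ : Δ[1].obj Δ),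
      (∀ j, (SSet.stdSimplex.objEquiv φ).toOrderHom j = k) → ∀ τ, heightOf φ τ = k.val := by
    intro Δ k φ hφ τ
    rw [heightOf_apply]
    simp only [hφ]
    fin_cases k
    · simp
    · simp only [Fin.mk_one, if_true, Nat.cast_one]
      exact τ.2.2
  refine { h := smallHomotopyMap F h, h₀ := ?_, h₁ := ?_, rel := ?_ }
  · refine NatTrans.ext (funext fun Δ => TypeCat.Hom.ext (TypeCat.Fun.ext (funext fun x =>
      Subtype.ext (ContinuousMap.ext fun τ => ?_))))
    refine Eq.trans (congrArg (fun r : ℝ => F (x.1 τ, r)) ?_) (h0 (x.1 τ))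
    exact (key Δ 0 _ (fun j => rfl) τ).trans Nat.cast_zero
  · refine NatTrans.ext (funext fun Δ => TypeCat.Hom.ext (TypeCat.Fun.ext (funext fun x =>
      Subtype.ext (ContinuousMap.ext fun τ => ?_))))
    refine Eq.trans (congrArg (fun r : ℝ => F (x.1 τ, r)) ?_) (h1 (x.1 τ))
    exact (key Δ 1 _ (fun j => rfl) τ).trans Nat.cast_one
  · exact NatTrans.ext (funext fun Δ => TypeCat.Hom.ext (TypeCat.Fun.ext (funext fun x =>
      x.1.2.elim)))

end Topology

end

end SingularCochains

/-! ### Barycentric subdivision -/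

namespace Subdivision

variable {E E' : Type} {k : ℕ}

/-- The transpose of the boundary of ordered simplices: a function on `k`-simplices, given as tuples of
`k + 1` vertices, yields a function on `(k + 1)`-simplices. -/
def bd (φ : (Fin (k + 1) → E) → ℤ) (v : Fin (k + 2) → E) : ℤ :=
  ∑ i : Fin (k + 2), (-1) ^ (i : ℕ) * φ fun j => v (i.succAbove j)

/-- The simplicial set whose `n`-simplices are tuples of `n + 1` points. -/
def tuples (E : Type) : SSet.{0} where
  obj Δ := Fin (Δ.unop.len + 1) → E
  map f := ↾fun v => v ∘ f.unop.toOrderHom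

theorem bd_smul (c : ℤ) (φ : (Fin (k + 1) → E) → ℤ) : bd (c • φ) = c • bd φ :=
  funext fun v => by simp only [bd, Pi.smul_apply, smul_eq_mul, Finset.mul_sum, mul_left_comm]

theorem bd_bd (φ : (Fin (k + 1) → E) → ℤ) : bd (bd φ) = 0 := by
  have h := SingularCochains.coboundaryFun_comp (R := ℤ) (tuples E) k φ
  have h2 : (-(-1) ^ (k + 1) : ℤ) • (-(-1) ^ k : ℤ) • bd (bd φ) = 0 :=
    (congrArg ((-(-1) ^ (k + 1) : ℤ) • ·) (bd_smul _ (bd φ))).symm.trans h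
  exact ((smul_eq_zero.1 h2).resolve_left (by simp) |> smul_eq_zero.1).resolve_left (by simp)

theorem bd_sub (φ ψ : (Fin (k + 1) → E) → ℤ) : bd (φ - ψ) = bd φ - bd ψ :=
  funext fun v => by simp [bd, mul_sub, Finset.sum_sub_distrib]

/-- The transpose of the cone operator with apex `p`. -/
def cone (p : E) (φ : (Fin (k + 2) → E) → ℤ) (v : Fin (k + 1) → E) : ℤ :=
  φ (Fin.cons p v : Fin (k + 2) → E)

theorem cone_bd (p : E) (φ : (Fin (k + 2) → E) → ℤ) : cone p (bd φ) = φ - bd (cone p φ) := by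
  funext v
  rw [cone, bd, Fin.sum_univ_succ, Pi.sub_apply, bd, sub_eq_add_neg, ← Finset.sum_neg_distrib]
  congr 1
  · simp
  · refine Finset.sum_congr rfl fun i _ => ?_
    rw [Fin.val_succ, pow_succ, mul_neg_one, neg_mul, cone]
    congr 3
    funext j
    refine Fin.cases ?_ (fun j => ?_) j
    · simp
    · simp

theorem cone_bd_zero (p : E) (φ : (Fin 1 → E) → ℤ) (v : Fin 1 → E) :
    cone p (bd φ) v = φ v - φ fun _ => p := by
  rw [cone, bd, Fin.sum_univ_two]
  have h : (fun j : Fin 1 => (Fin.cons p v : Fin 2 → E) ((1 : Fin 2).succAbove j)) = fun _ => p := by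
    funext j
    rw [Subsingleton.elim j 0]
    rfl
  rw [h]
  simp [sub_eq_add_neg]

variable (b : ∀ {k : ℕ}, (Fin (k + 1) → E) → E)

/-- The transpose of the barycentric subdivision operator, for a notion `b` of barycentres. -/
noncomputable def sd {k : ℕ} : ((Fin (k + 1) → E) → ℤ) → (Fin (k + 1) → E) → ℤ :=
  Nat.rec (motive := fun k => ((Fin (k + 1) → E) → ℤ) → (Fin (k + 1) → E) → ℤ)
    (fun φ v => φ v) (fun _ f φ v => bd (f (cone (b v) φ)) v) k

/-- The transpose of the chain homotopy between barycentric subdivision and the identity. -/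
noncomputable def sdHomotopy {k : ℕ} : ((Fin (k + 2) → E) → ℤ) → (Fin (k + 1) → E) → ℤ :=
  Nat.rec (motive := fun k => ((Fin (k + 2) → E) → ℤ) → (Fin (k + 1) → E) → ℤ)
    (fun φ v => cone (b v) φ v) (fun _ f φ v => cone (b v) φ v - bd (f (cone (b v) φ)) v) k

theorem sd_succ (φ : (Fin (k + 2) → E) → ℤ) (v : Fin (k + 2) → E) :
    sd b φ v = bd (sd b (cone (b v) φ)) v := rfl

theorem sdHomotopy_succ (φ : (Fin (k + 3) → E) → ℤ) (v : Fin (k + 2) → E) :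
    sdHomotopy b φ v = cone (b v) φ v - bd (sdHomotopy b (cone (b v) φ)) v := rfl

theorem sd_sub (φ ψ : (Fin (k + 1) → E) → ℤ) : sd b (φ - ψ) = sd b φ - sd b ψ := by
  funext v
  induction k with
  | zero => rfl
  | succ k ih =>
    rw [Pi.sub_apply, sd_succ, sd_succ, sd_succ, ← Pi.sub_apply, ← bd_sub]
    exact congrArg (fun ψ => bd ψ v) (funext fun v' => ih _ _ v')

theorem sd_zero : sd b (0 : (Fin (k + 1) → E) → ℤ) = 0 := by
  have := sd_sub b (0 : (Fin (k + 1) → E) → ℤ) 0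
  rwa [sub_self, sub_self] at this

theorem sdHomotopy_sub (φ ψ : (Fin (k + 2) → E) → ℤ) :
    sdHomotopy b (φ - ψ) = sdHomotopy b φ - sdHomotopy b ψ := by
  funext v
  induction k with
  | zero => rfl
  | succ k ih =>
    have h : sdHomotopy b (cone (b v) (φ - ψ)) =
        sdHomotopy b (cone (b v) φ) - sdHomotopy b (cone (b v) ψ) := funext fun v' => ih _ _ v'
    rw [Pi.sub_apply, sdHomotopy_succ, sdHomotopy_succ, sdHomotopy_succ, h, bd_sub, Pi.sub_apply]
    simp only [cone, Pi.sub_apply]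
    ring

theorem sdHomotopy_zero : sdHomotopy b (0 : (Fin (k + 2) → E) → ℤ) = 0 := by
  have := sdHomotopy_sub b (0 : (Fin (k + 2) → E) → ℤ) 0
  rwa [sub_self, sub_self] at this

theorem sd_bd (φ : (Fin (k + 1) → E) → ℤ) : sd b (bd φ) = bd (sd b φ) := by
  funext v
  induction k with
  | zero =>
    rw [sd_succ]
    have h : sd b (cone (b v) (bd φ)) = sd b φ - fun _ => φ fun _ => b v :=
      funext fun u => cone_bd_zero _ _ _
    rw [h, bd_sub, Pi.sub_apply, sub_eq_self, bd, Fin.sum_univ_two]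
    simp
  | succ k ih =>
    rw [sd_succ, cone_bd, sd_sub, bd_sub, show sd b (bd (cone (b v) φ)) = bd (sd b (cone (b v) φ))
      from funext fun u => ih _ u, bd_bd, sub_zero]

theorem sdHomotopy_bd_zero (φ : (Fin 1 → E) → ℤ) (v : Fin 1 → E) (hb : b v = v 0) :
    sdHomotopy b (bd φ) v = φ v - sd b φ v := by
  refine (cone_bd_zero _ _ _).trans (congrArg (fun u => φ v - φ u) (funext fun j => ?_))
  rw [Subsingleton.elim j 0]
  exact hb

theorem sdHomotopy_bd (hb : ∀ v : Fin 1 → E, b v = v 0) (φ : (Fin (k + 2) → E) → ℤ) :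
    sdHomotopy b (bd φ) = φ - sd b φ - bd (sdHomotopy b φ) := by
  funext v
  induction k with
  | zero =>
    have h : sdHomotopy b (bd (cone (b v) φ)) = cone (b v) φ - sd b (cone (b v) φ) :=
      funext fun u => sdHomotopy_bd_zero b _ u (hb u)
    rw [sdHomotopy_succ, cone_bd, sdHomotopy_sub, h]
    simp only [bd_sub, Pi.sub_apply, sd_succ]
    ring
  | succ k ih =>
    rw [sdHomotopy_succ, cone_bd, sdHomotopy_sub, show sdHomotopy b (bd (cone (b v) φ)) =
      _ from funext fun u => ih _ u]
    simp only [bd_sub, Pi.sub_apply, sd_succ, bd_bd, Pi.zero_apply]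
    ring

section Naturality

variable {b} (b' : ∀ {k : ℕ}, (Fin (k + 1) → E') → E') (g : E → E')

theorem bd_comp (φ : (Fin (k + 1) → E') → ℤ) (v : Fin (k + 2) → E) :
    bd (fun u => φ (g ∘ u)) v = bd φ (g ∘ v) := rfl

theorem cone_comp (p : E) (φ : (Fin (k + 2) → E') → ℤ) :
    cone p (fun u => φ (g ∘ u)) = fun u => cone (g p) φ (g ∘ u) := by
  funext u
  simp only [cone]
  congr 1
  funext j
  exact Fin.cases rfl (fun j => rfl) j

variable (hg : ∀ {k : ℕ} (v : Fin (k + 1) → E), g (b v) = b' (g ∘ v))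
include hg

theorem sd_comp (φ : (Fin (k + 1) → E') → ℤ) (v : Fin (k + 1) → E) :
    sd b (fun u => φ (g ∘ u)) v = sd b' φ (g ∘ v) := by
  induction k with
  | zero => rfl
  | succ k ih =>
    rw [sd_succ, sd_succ, ← bd_comp, cone_comp, hg]
    exact congrArg (fun ψ => bd ψ v) (funext fun u => ih _ u)

theorem sdHomotopy_comp (φ : (Fin (k + 2) → E') → ℤ) (v : Fin (k + 1) → E) :
    sdHomotopy b (fun u => φ (g ∘ u)) v = sdHomotopy b' φ (g ∘ v) := by
  induction k with
  | zero =>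
    refine (congrFun (cone_comp g _ φ) v).trans ?_
    rw [hg]
    rfl
  | succ k ih =>
    rw [sdHomotopy_succ, sdHomotopy_succ, ← bd_comp, cone_comp, hg]
    exact congrArg (fun ψ => cone _ φ (g ∘ v) - bd ψ v) (funext fun u => ih _ u)

end Naturality

section Metric

variable {E : Type} [MetricSpace E] {b : ∀ {k : ℕ}, (Fin (k + 1) → E) → E}
  (hb : ∀ {k : ℕ} (v : Fin (k + 1) → E) (q : E),
    dist (b v) q ≤ (∑ j, dist (v j) q) / (k + 1))

/-- The point `p` lies in every closed ball that contains all vertices of `v`. -/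
def InBalls (v : Fin (k + 1) → E) (p : E) : Prop :=
  ∀ (q : E) (r : ℝ), (∀ i, dist (v i) q ≤ r) → dist p q ≤ r

theorem InBalls.mono {l : ℕ} {v : Fin (k + 1) → E} {u : Fin (l + 1) → E} {p : E} (h : InBalls u p)
    (hu : ∀ i, InBalls v (u i)) : InBalls v p :=
  fun q r hr => h q r fun i => hu i q r hr

theorem inBalls_vertex (v : Fin (k + 1) → E) (i : Fin (k + 1)) : InBalls v (v i) :=
  fun _ _ hr => hr i

include hb

theorem inBalls_barycentre (v : Fin (k + 1) → E) : InBalls v (b v) := by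
  intro q r hr
  refine (hb v q).trans ?_
  rw [div_le_iff₀ (by positivity)]
  refine (Finset.sum_le_sum fun i _ => hr i).trans (le_of_eq ?_)
  rw [Finset.sum_const, Finset.card_univ, Fintype.card_fin, nsmul_eq_mul]
  push_cast
  ring

theorem barycentre_zero (v : Fin 1 → E) : b v = v 0 := by
  refine dist_le_zero.1 ((hb v (v 0)).trans (le_of_eq ?_))
  simp

theorem dist_barycentre_le (v : Fin (k + 1) → E) {D : ℝ} (hv : ∀ i j, dist (v i) (v j) ≤ D)
    (i : Fin (k + 1)) : dist (b v) (v i) ≤ k / (k + 1) * D := by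
  refine (hb v _).trans ?_
  rw [div_mul_eq_mul_div]
  refine div_le_div_of_nonneg_right ?_ (by positivity)
  rw [Fin.sum_univ_succAbove _ i, dist_self, zero_add]
  refine (Finset.sum_le_sum fun j _ => hv _ _).trans (le_of_eq ?_)
  rw [Finset.sum_const, Finset.card_univ, Fintype.card_fin, nsmul_eq_mul]

/-- The simplices of the barycentric subdivision of a `k`-simplex of diameter at most `D` have
diameter at most `k / (k + 1) * D`. -/
theorem sd_eq_zero {φ : (Fin (k + 1) → E) → ℤ} {v : Fin (k + 1) → E} {D : ℝ}
    (hv : ∀ i j, dist (v i) (v j) ≤ D)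
    (hφ : ∀ u : Fin (k + 1) → E, (∀ i, InBalls v (u i)) →
      (∀ i j, dist (u i) (u j) ≤ k / (k + 1) * D) → φ u = 0) : sd b φ v = 0 := by
  induction k with
  | zero =>
    refine hφ v (inBalls_vertex v) fun i j => ?_
    rw [Subsingleton.elim (α := Fin 1) i j, dist_self]
    simp
  | succ k ih =>
    have hD : 0 ≤ D := dist_nonneg.trans (hv 0 0)
    rw [sd_succ, bd]
    refine Finset.sum_eq_zero fun i _ => ?_
    rw [ih (fun _ _ => hv _ _), mul_zero]
    intro u hu hu'
    have hu2 : ∀ j, InBalls v (u j) := fun j => (hu j).mono fun l => inBalls_vertex v _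
    have hd : ∀ j, dist (b v) (u j) ≤ ((k + 1 : ℕ) : ℝ) / ((k + 1 : ℕ) + 1) * D := fun j => by
      rw [dist_comm]
      exact hu2 j _ _ fun l => by rw [dist_comm]; exact dist_barycentre_le hb v hv l
    refine hφ _ (fun j => ?_) fun j l => ?_
    · exact Fin.cases (inBalls_barycentre hb v) (fun j => hu2 j) j
    · refine Fin.cases ?_ (fun j => ?_) j
      · refine Fin.cases ?_ (fun l => hd l) l
        rw [dist_self]
        positivity
      · refine Fin.cases ?_ (fun l => ?_) l
        · rw [dist_comm]; exact hd j
        · refine (hu' j l).trans (mul_le_mul_of_nonneg_right ?_ hD)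
          push_cast
          rw [div_le_div_iff₀ (by positivity) (by positivity)]
          nlinarith

theorem iterate_sd_eq_zero {φ : (Fin (k + 1) → E) → ℤ} (N : ℕ) {D : ℝ}
    (hφ : ∀ u : Fin (k + 1) → E, (∀ i j, dist (u i) (u j) ≤ (k / (k + 1)) ^ N * D) → φ u = 0)
    {v : Fin (k + 1) → E} (hv : ∀ i j, dist (v i) (v j) ≤ D) : (sd b)^[N] φ v = 0 := by
  induction N generalizing φ with
  | zero => exact hφ v (by simpa using hv)
  | succ N ih =>
    rw [Function.iterate_succ_apply]
    refine ih fun u hu => sd_eq_zero hb hu fun u' _ hu' => hφ u' ?_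
    rw [pow_succ', mul_assoc]
    exact hu'

end Metric

end Subdivision

/-! ### Small simplices -/

namespace SingularCochains

noncomputable section

open Subdivision

variable {k l n : ℕ}

/-- The affine map from a standard simplex to a standard simplex with given vertices. -/
def affineMap (v : Fin (k + 1) → stdSimplex ℝ (Fin (n + 1))) :
    C(stdSimplex ℝ (Fin (k + 1)), stdSimplex ℝ (Fin (n + 1))) :=
  ⟨fun τ => ⟨∑ j, τ j • (v j).1, (convex_stdSimplex ℝ _).sum_mem (fun j _ => τ.2.1 j) τ.2.2
    fun j _ => (v j).2⟩, by
    refine Continuous.subtype_mk (continuous_finsetSum _ fun j _ => ?_) _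
    exact ((continuous_apply j).comp continuous_subtype_val).smul continuous_const⟩

theorem affineMap_coe (v : Fin (k + 1) → stdSimplex ℝ (Fin (n + 1)))
    (τ : stdSimplex ℝ (Fin (k + 1))) : (affineMap v τ).1 = ∑ j, τ j • (v j).1 := rfl

theorem affineMap_apply (v : Fin (k + 1) → stdSimplex ℝ (Fin (n + 1)))
    (τ : stdSimplex ℝ (Fin (k + 1))) (i : Fin (n + 1)) :
    affineMap v τ i = ∑ j, τ j * v j i := by
  change (affineMap v τ).1 i = _
  rw [affineMap_coe, Finset.sum_apply]
  rfl

theorem dist_affineMap_le (v : Fin (k + 1) → stdSimplex ℝ (Fin (n + 1)))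
    (τ : stdSimplex ℝ (Fin (k + 1))) (q : stdSimplex ℝ (Fin (n + 1))) :
    dist (affineMap v τ) q ≤ ∑ j, τ j * dist (v j) q := by
  rw [Subtype.dist_eq, dist_eq_norm, affineMap_coe]
  have h : ∑ j, τ j • (v j).1 - q.1 = ∑ j, τ j • ((v j).1 - q.1) := by
    simp only [smul_sub, Finset.sum_sub_distrib, ← Finset.sum_smul]
    rw [show ∑ j, τ j = 1 from τ.2.2, one_smul]
  rw [h]
  refine (norm_sum_le _ _).trans (Finset.sum_le_sum fun j _ => ?_)
  rw [norm_smul, Real.norm_eq_abs, Subtype.dist_eq, dist_eq_norm]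
  exact le_of_eq (congrArg (· * _) (abs_of_nonneg (τ.2.1 j)))

theorem affineMap_comp (v : Fin (k + 1) → stdSimplex ℝ (Fin (n + 1)))
    (u : Fin (l + 1) → stdSimplex ℝ (Fin (k + 1))) :
    (affineMap v).comp (affineMap u) = affineMap (affineMap v ∘ u) := by
  refine ContinuousMap.ext fun τ => Subtype.ext (funext fun i => ?_)
  change affineMap v (affineMap u τ) i = affineMap (affineMap v ∘ u) τ i
  simp only [affineMap_apply, Finset.sum_mul, Function.comp_apply, Finset.mul_sum]
  rw [Finset.sum_comm]
  exact Finset.sum_congr rfl fun j _ => Finset.sum_congr rfl fun j' _ => mul_assoc _ _ _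

/-- The vertices of the standard simplex. -/
def vertices (n : ℕ) (i : Fin (n + 1)) : stdSimplex ℝ (Fin (n + 1)) :=
  ⟨Pi.single i 1, single_mem_stdSimplex ℝ i⟩

theorem vertices_apply (i j : Fin (n + 1)) : vertices n i j = if j = i then 1 else 0 :=
  Pi.single_apply i (1 : ℝ) j

theorem affineMap_vertices (v : Fin (k + 1) → stdSimplex ℝ (Fin (n + 1))) (i : Fin (k + 1)) :
    affineMap v (vertices k i) = v i := by
  refine Subtype.ext (funext fun j => ?_)
  change affineMap v (vertices k i) j = v i j
  simp [affineMap_apply, vertices_apply]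

theorem affineMap_vertices_self : affineMap (vertices n) = ContinuousMap.id _ := by
  refine ContinuousMap.ext fun τ => Subtype.ext (funext fun j => ?_)
  change affineMap (vertices n) τ j = τ j
  simp [affineMap_apply, vertices_apply]

theorem simplexMap_apply {a b : ℕ} (f : ⦋a⦌ ⟶ ⦋b⦌) (τ : stdSimplex ℝ (Fin (a + 1)))
    (i : Fin (b + 1)) :
    simplexMap f τ i = ∑ j : Fin (a + 1), if f.toOrderHom j = i then τ j else 0 := by
  change FunOnFinite.linearMap ℝ ℝ _ τ.1 i = _
  rw [FunOnFinite.linearMap_apply_apply, Finset.sum_filter]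
  rfl

theorem affineMap_comp_simplexMap {a : ℕ} (v : Fin (k + 1) → stdSimplex ℝ (Fin (n + 1)))
    (f : ⦋a⦌ ⟶ ⦋k⦌) :
    (affineMap v).comp (simplexMap f) = affineMap fun j : Fin (a + 1) => v (f.toOrderHom j) := by
  refine ContinuousMap.ext fun τ => Subtype.ext (funext fun i => ?_)
  change affineMap v (simplexMap f τ) i = affineMap (fun j : Fin (a + 1) => v (f.toOrderHom j)) τ i
  simp only [affineMap_apply, simplexMap_apply, Finset.sum_mul]
  rw [Finset.sum_comm]
  refine Finset.sum_congr rfl fun j _ => ?_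
  simp

theorem simplexMap_eq_affineMap {a : ℕ} (f : ⦋a⦌ ⟶ ⦋n⦌) :
    simplexMap f = affineMap fun j : Fin (a + 1) => vertices n (f.toOrderHom j) := by
  rw [← affineMap_comp_simplexMap, affineMap_vertices_self, ContinuousMap.id_comp]

/-- The barycentre of the standard simplex. -/
def centre (k : ℕ) : stdSimplex ℝ (Fin (k + 1)) :=
  ⟨fun _ => ((k : ℝ) + 1)⁻¹, fun _ => by positivity, by
    rw [Finset.sum_const, Finset.card_univ, Fintype.card_fin, nsmul_eq_mul]
    push_cast
    exact mul_inv_cancel₀ (by positivity)⟩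

/-- The barycentre of a tuple of points. -/
def bary {k : ℕ} (v : Fin (k + 1) → stdSimplex ℝ (Fin (n + 1))) : stdSimplex ℝ (Fin (n + 1)) :=
  affineMap v (centre k)

theorem dist_bary_le {k : ℕ} (v : Fin (k + 1) → stdSimplex ℝ (Fin (n + 1)))
    (q : stdSimplex ℝ (Fin (n + 1))) : dist (bary v) q ≤ (∑ j, dist (v j) q) / (k + 1) := by
  refine (dist_affineMap_le v _ q).trans (le_of_eq ?_)
  rw [div_eq_inv_mul, Finset.mul_sum]
  rfl

theorem affineMap_bary (v : Fin (k + 1) → stdSimplex ℝ (Fin (n + 1))) {l : ℕ}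
    (u : Fin (l + 1) → stdSimplex ℝ (Fin (k + 1))) :
    affineMap v (bary u) = bary (affineMap v ∘ u) :=
  DFunLike.congr_fun (affineMap_comp v u) _

variable {X : Type} [TopologicalSpace X] {𝒰 : Set (Set X)}

theorem value_zero (x : C(stdSimplex ℝ (Fin (n + 1)), X)) :
    value (0 : (dga ℤ (small 𝒰)).cx.X n) x = 0 := by
  unfold value
  split_ifs
  · rw [map_zero]; rfl
  · rfl

/-- The values of a cochain on the affine simplices in the domain of a singular simplex `x`. -/
def affineValue (γ : (dga ℤ (small 𝒰)).cx.X k) (x : C(stdSimplex ℝ (Fin (n + 1)), X))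
    (v : Fin (k + 1) → stdSimplex ℝ (Fin (n + 1))) : ℤ :=
  value γ (x.comp (affineMap v))

theorem bd_affineValue (γ : (dga ℤ (small 𝒰)).cx.X k) (hγ : (dga ℤ (small 𝒰)).cx.d k (k + 1) γ = 0)
    {x : C(stdSimplex ℝ (Fin (n + 1)), X)} (hx : ∃ U ∈ 𝒰, ∀ τ, x τ ∈ U) :
    bd (affineValue γ x) = 0 := by
  funext v
  have h := value_d γ (x := x.comp (affineMap v)) (hx.imp fun U hU => ⟨hU.1, fun τ => hU.2 _⟩)
  rw [hγ, value_zero] at h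
  refine Eq.trans ?_ ((mul_eq_zero.1 h.symm).resolve_left (by simp))
  refine Finset.sum_congr rfl fun i _ => ?_
  rw [ContinuousMap.comp_assoc, affineMap_comp_simplexMap]
  rfl

theorem iterate_sd_comp {m : ℕ} (v : Fin (m + 1) → stdSimplex ℝ (Fin (n + 1))) (N : ℕ)
    (φ : (Fin (k + 1) → stdSimplex ℝ (Fin (n + 1))) → ℤ) :
    (sd bary)^[N] (fun u : Fin (k + 1) → stdSimplex ℝ (Fin (m + 1)) => φ (affineMap v ∘ u)) =
      fun u => (sd bary)^[N] φ (affineMap v ∘ u) := by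
  induction N generalizing φ with
  | zero => rfl
  | succ N ih =>
    rw [Function.iterate_succ_apply, Function.iterate_succ_apply, ← ih]
    exact congrArg _ (funext fun u => sd_comp (b := bary) bary _ (affineMap_bary v) φ u)

theorem iterate_sd_zero (N : ℕ) :
    (sd bary)^[N] (0 : (Fin (k + 1) → stdSimplex ℝ (Fin (n + 1))) → ℤ) = 0 := by
  induction N with
  | zero => rfl
  | succ N ih => rw [Function.iterate_succ_apply, sd_zero, ih]

theorem bd_iterate_sd (N : ℕ) (φ : (Fin (k + 1) → stdSimplex ℝ (Fin (n + 1))) → ℤ) :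
    bd ((sd bary)^[N] φ) = (sd bary)^[N] (bd φ) := by
  induction N generalizing φ with
  | zero => rfl
  | succ N ih => rw [Function.iterate_succ_apply, Function.iterate_succ_apply, ih, sd_bd]

section Small

variable {𝒱 : Set (Set X)}

/-- Every simplex of a sufficiently fine subdivision is subordinate to `𝒱`. -/
theorem exists_iterate_sd_eq_zero (h : ∀ V ∈ 𝒱, ∃ U ∈ 𝒰, V ⊆ U)
    (hcover : ∀ U ∈ 𝒰, ∀ p ∈ U, ∃ V ∈ 𝒱, ∃ O, IsOpen O ∧ p ∈ O ∧ O ∩ U ⊆ V)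
    (γ : (dga ℤ (small 𝒰)).cx.X k) (hγ : (pull ℤ (smallIncl h)).f k γ = 0)
    {x : C(stdSimplex ℝ (Fin (n + 1)), X)} (hx : ∃ U ∈ 𝒰, ∀ τ, x τ ∈ U) :
    ∃ N, ∀ i ≥ N, (sd bary)^[i] (affineValue γ x) = 0 := by
  obtain ⟨U, hU, hx⟩ := hx
  choose V hV O hO hp hOV using fun τ => hcover U hU (x τ) (hx τ)
  obtain ⟨δ, hδ, hL⟩ := lebesgue_number_lemma_of_metric (s := Set.univ)
    (c := fun τ => x ⁻¹' (O τ)) isCompact_univ (fun τ => (hO τ).preimage x.continuous)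
    (fun τ _ => Set.mem_iUnion.2 ⟨τ, hp τ⟩)
  let D := Metric.diam (Set.univ : Set (stdSimplex ℝ (Fin (n + 1))))
  have hD : ∀ p q : stdSimplex ℝ (Fin (n + 1)), dist p q ≤ D := fun p q =>
    Metric.dist_le_diam_of_mem isCompact_univ.isBounded trivial trivial
  have hc0 : (0 : ℝ) ≤ k / (k + 1) := by positivity
  have hc1 : (k : ℝ) / (k + 1) < 1 := (div_lt_one (by positivity)).2 (by linarith)
  have ht : Filter.Tendsto (fun i : ℕ => ((k : ℝ) / (k + 1)) ^ i * D) Filter.atTop (nhds 0) := by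
    have := (tendsto_pow_atTop_nhds_zero_of_lt_one hc0 hc1).mul_const D
    rwa [zero_mul] at this
  obtain ⟨N, hN⟩ := Filter.eventually_atTop.1 (ht.eventually (gt_mem_nhds hδ))
  refine ⟨N, fun i hi => funext fun v => iterate_sd_eq_zero dist_bary_le i (fun u hu => ?_)
    fun _ _ => hD _ _⟩
  obtain ⟨τ₀, hτ⟩ := hL (u 0) trivial
  have hsmall : ∃ V ∈ 𝒱, ∀ τ, (x.comp (affineMap u)) τ ∈ V := by
    refine ⟨V τ₀, hV τ₀, fun τ => hOV τ₀ ⟨hτ ?_, hx _⟩⟩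
    rw [Metric.mem_ball]
    refine ((dist_affineMap_le u τ _).trans ?_).trans_lt (hN i hi)
    refine (Finset.sum_le_sum fun j _ => mul_le_mul_of_nonneg_left (hu j 0) (τ.2.1 j)).trans ?_
    rw [← Finset.sum_mul]
    exact le_of_eq ((congrArg (· * _) τ.2.2).trans (one_mul _))
  rw [affineValue, ← value_incl h γ hsmall, hγ, value_zero]

/-- A cocycle that vanishes on all simplices subordinate to `𝒱` is the coboundary of a cochain with
the same property. -/
theorem exists_primitive_of_small (h : ∀ V ∈ 𝒱, ∃ U ∈ 𝒰, V ⊆ U)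
    (hcover : ∀ U ∈ 𝒰, ∀ p ∈ U, ∃ V ∈ 𝒱, ∃ O, IsOpen O ∧ p ∈ O ∧ O ∩ U ⊆ V)
    (γ : (dga ℤ (small 𝒰)).cx.X (n + 1)) (hd : (dga ℤ (small 𝒰)).cx.d (n + 1) (n + 2) γ = 0)
    (hγ : (pull ℤ (smallIncl h)).f (n + 1) γ = 0) :
    ∃ β : (dga ℤ (small 𝒰)).cx.X n, (dga ℤ (small 𝒰)).cx.d n (n + 1) β = γ ∧
      (pull ℤ (smallIncl h)).f n β = 0 := by
  let b : C(stdSimplex ℝ (Fin (n + 1)), X) → ℕ → ℤ := fun x i =>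
    sdHomotopy bary ((sd bary)^[i] (affineValue γ x)) (vertices n)
  have hb : ∀ x : (small 𝒰) _⦋n + 1⦌, ∀ (j : Fin (n + 2)) (i : ℕ),
      b ((small 𝒰).δ j x).1 i = sdHomotopy bary ((sd bary)^[i] (affineValue γ x.1))
        fun l => vertices (n + 1) (j.succAbove l) := by
    intro x j i
    have h1 : affineValue γ ((small 𝒰).δ j x).1 =
        fun u => affineValue γ x.1 (affineMap (fun l => vertices (n + 1) (j.succAbove l)) ∘ u) := by
      funext u
      rw [affineValue, affineValue, small_δ_val, ContinuousMap.comp_assoc, ← affineMap_comp,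
        simplexMap_eq_affineMap]
      rfl
    change sdHomotopy bary ((sd bary)^[i] (affineValue γ ((small 𝒰).δ j x).1)) _ = _
    rw [h1, iterate_sd_comp]
    refine (sdHomotopy_comp (b := bary) bary _ (affineMap_bary _) _ _).trans ?_
    exact congrArg _ (funext fun l => affineMap_vertices _ _)
  refine exists_normalized (smallIncl h) γ
    ((-(-1) ^ n : ℤ) • fun x => ∑ᶠ i, b x.1 i) ?_ fun x => ?_
  · funext x
    obtain ⟨N, hN⟩ := exists_iterate_sd_eq_zero h hcover γ hγ x.2
    have hsum : ∀ j : Fin (n + 2), ∑ᶠ i, b ((small 𝒰).δ j x).1 i =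
        ∑ i ∈ Finset.range N, b ((small 𝒰).δ j x).1 i := by
      intro j
      refine finsum_eq_sum_of_support_subset _ fun i hi => ?_
      rw [Finset.coe_range, Set.mem_Iio]
      by_contra hi'
      refine hi ?_
      rw [hb, hN i (not_lt.1 hi'), sdHomotopy_zero]
      rfl
    rw [coboundaryFun_apply]
    simp only [Pi.smul_apply, smul_eq_mul, mul_left_comm _ (-(-1) ^ n : ℤ), ← Finset.mul_sum]
    rw [← mul_assoc, neg_mul_neg, ← mul_pow, neg_one_mul, neg_neg, one_pow, one_mul]
    simp only [hsum, Finset.mul_sum]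
    rw [Finset.sum_comm]
    have hstep : ∀ i, ∑ j : Fin (n + 2), (-1) ^ (j : ℕ) * b ((small 𝒰).δ j x).1 i =
        (sd bary)^[i] (affineValue γ x.1) (vertices (n + 1)) -
          (sd bary)^[i + 1] (affineValue γ x.1) (vertices (n + 1)) := by
      intro i
      have := congrFun (sdHomotopy_bd (b := bary) (barycentre_zero dist_bary_le)
        ((sd bary)^[i] (affineValue γ x.1))) (vertices (n + 1))
      rw [bd_iterate_sd, bd_affineValue γ hd x.2, iterate_sd_zero, sdHomotopy_zero,
        Pi.zero_apply, Pi.sub_apply, Pi.sub_apply, eq_comm, sub_eq_zero] at this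
      rw [Function.iterate_succ_apply', this]
      exact Finset.sum_congr rfl fun j _ => by rw [hb]
    rw [Finset.sum_congr rfl fun i _ => hstep i, Finset.sum_range_sub', hN N le_rfl,
      Pi.zero_apply, sub_zero]
    change value γ (x.1.comp (affineMap (vertices (n + 1)))) = _
    rw [affineMap_vertices_self, ContinuousMap.comp_id, value_val]
  · have h0 : affineValue γ ((smallIncl h).app _ x).1 =
        (0 : (Fin (n + 2) → stdSimplex ℝ (Fin (n + 1))) → ℤ) := by
      funext v
      have hsmall : ∃ V ∈ 𝒱, ∀ τ, (x.1.comp (affineMap v)) τ ∈ V :=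
        x.2.imp fun V hV => ⟨hV.1, fun τ => hV.2 _⟩
      refine (value_incl h γ hsmall).symm.trans ?_
      rw [hγ, value_zero]
      rfl
    have : ∀ i, b ((smallIncl h).app _ x).1 i = 0 := fun i => by
      change sdHomotopy bary ((sd bary)^[i] (affineValue γ ((smallIncl h).app _ x).1)) _ = 0
      rw [h0, iterate_sd_zero, sdHomotopy_zero]
      rfl
    rw [Pi.smul_apply, smul_eq_mul]
    simp only [this, finsum_zero, mul_zero]

/-- Extension of cochains by zero. -/
theorem surjective_pull_smallIncl {n : ℕ} (h : ∀ V ∈ 𝒱, ∃ U ∈ 𝒰, V ⊆ U) :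
    Function.Surjective ((pull ℤ (smallIncl h)).f n) := by
  intro γ
  have hmem : (fun x : (small 𝒰) _⦋n⦌ => value γ x.1) ∈ normalizedCochains ℤ (small 𝒰) n := by
    intro x hx
    cases n with
    | zero => simp at hx
    | succ n =>
      rw [SSet.degenerate_eq_iUnion_range_σ] at hx
      obtain ⟨j, y, rfl⟩ := Set.mem_iUnion.1 hx
      refine value_degenerate γ j ?_
      have h2 : (small 𝒰).σ j ((small 𝒰).δ j.castSucc ((small 𝒰).σ j y)) = (small 𝒰).σ j y := by
        rw [(small 𝒰).δ_comp_σ_self_apply]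
      exact congrArg Subtype.val h2
  obtain ⟨γ', hγ'⟩ := exists_toFun hmem
  refine ⟨γ', toFun_injective (funext fun x => ?_)⟩
  rw [toFun_pull, hγ']
  exact value_val γ x

/-- Cochains may be restricted to the simplices that are subordinate to a relatively open cover. -/
theorem inducesIso_smallIncl (h : ∀ V ∈ 𝒱, ∃ U ∈ 𝒰, V ⊆ U)
    (hcover : ∀ U ∈ 𝒰, ∀ p ∈ U, ∃ V ∈ 𝒱, ∃ O, IsOpen O ∧ p ∈ O ∧ O ∩ U ⊆ V) :
    InducesIso (pull ℤ (smallIncl h)) := by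
  have key : ∀ (n : ℕ) (γ : (dga ℤ (small 𝒰)).cx.X n), (dga ℤ (small 𝒰)).cx.d n (n + 1) γ = 0 →
      (pull ℤ (smallIncl h)).f n γ = 0 → ∃ (i : ℕ) (β : (dga ℤ (small 𝒰)).cx.X i),
        (dga ℤ (small 𝒰)).cx.d i n β = γ ∧ (pull ℤ (smallIncl h)).f i β = 0 := by
    intro n γ hd hγ
    cases n with
    | zero =>
      refine ⟨0, 0, ?_, map_zero _⟩
      rw [map_zero]
      refine toFun_injective (funext fun x => ?_)
      obtain ⟨U, hU, hx⟩ := x.2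
      obtain ⟨V, hV, O, -, hp, hOV⟩ := hcover U hU _ (hx (vertices 0 0))
      have hs : ∃ V ∈ 𝒱, ∀ τ, x.1 τ ∈ V := ⟨V, hV, fun τ => by
        have : τ = vertices 0 0 := by
          refine Subtype.ext (funext fun i => ?_)
          have h1 : ∑ j, τ j = 1 := τ.2.2
          rw [Fin.sum_univ_one] at h1
          rw [Subsingleton.elim (α := Fin 1) i 0]
          refine h1.trans ?_
          exact (vertices_apply (n := 0) 0 0).symm
        rw [this]
        exact hOV ⟨hp, hx _⟩⟩
      refine Eq.symm ((value_val γ x).symm.trans ((value_incl h γ hs).symm.trans ?_))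
      rw [hγ, value_zero]
      rfl
    | succ n =>
      obtain ⟨β, h1, h2⟩ := exists_primitive_of_small h hcover γ hd hγ
      exact ⟨n, β, h1, h2⟩
  constructor
  · rintro n γ hγ ⟨i, β₀, hβ₀⟩
    obtain ⟨β, rfl⟩ := surjective_pull_smallIncl h β₀
    obtain ⟨j, η, h1, -⟩ := key n (γ - (dga ℤ (small 𝒰)).cx.d i n β)
      (by rw [map_sub, hγ, d_d_apply, sub_zero]) (by rw [map_sub, hom_d_apply, hβ₀, sub_self])
    have : γ = (dga ℤ (small 𝒰)).cx.d j n η + (dga ℤ (small 𝒰)).cx.d i n β := by rw [h1]; abel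
    rw [this]
    exact (isCoboundary_d _).add (isCoboundary_d _)
  · intro n γ₀ hγ₀
    obtain ⟨γ, rfl⟩ := surjective_pull_smallIncl h γ₀
    obtain ⟨η, h1, h2⟩ := exists_primitive_of_small h hcover ((dga ℤ (small 𝒰)).cx.d n (n + 1) γ)
      (d_d_apply _ _ _ _) (by rw [hom_d_apply, hγ₀])
    refine ⟨γ - η, by rw [map_sub, h1, sub_self], ?_⟩
    rw [map_sub, h2, sub_zero, sub_self]
    exact isCoboundary_zero _

end Small

end

end SingularCochains

/-! ### From the moment-angle complex to the simplices in polydiscs -/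

namespace SingularCochains

noncomputable section

section

variable {S T : SSet.{0}} {n : ℕ}

theorem pull_pull {T' : SSet.{0}} (f : S ⟶ T) (g : T ⟶ T') (γ : (dga ℤ T').cx.X n) :
    (pull ℤ f).f n ((pull ℤ g).f n γ) = (pull ℤ (f ≫ g)).f n γ :=
  toFun_injective (funext fun _ => rfl)

theorem pull_id (γ : (dga ℤ S).cx.X n) : (pull ℤ (𝟙 S)).f n γ = γ :=
  toFun_injective (funext fun _ => rfl)

theorem inducesIso_pull_of_inverse (f : S ⟶ T) (g : T ⟶ S) (h1 : f ≫ g = 𝟙 S) (h2 : g ≫ f = 𝟙 T) :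
    InducesIso (pull ℤ f) where
  inj n γ _ hc := by
    have := hc.map (pull ℤ g)
    rwa [pull_pull, h2, pull_id] at this
  surj n γ hγ := ⟨(pull ℤ g).f n γ, by rw [← hom_d_apply, hγ, map_zero], by
    rw [pull_pull, h1, pull_id, sub_self]
    exact isCoboundary_zero n⟩

end

variable {X Y : Type} [TopologicalSpace X] [TopologicalSpace Y] {𝒰 : Set (Set X)} {𝒱 : Set (Set Y)}

theorem inducesIso_of_homotopy {f : C(X, Y)} {g : C(Y, X)}
    (hf : ∀ U ∈ 𝒰, ∃ V ∈ 𝒱, Set.MapsTo f U V) (hg : ∀ V ∈ 𝒱, ∃ U ∈ 𝒰, Set.MapsTo g V U)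
    (F : C(X × ℝ, X)) (hF : ∀ U ∈ 𝒰, ∃ V ∈ 𝒰, ∀ x ∈ U, ∀ t ∈ Set.Icc (0 : ℝ) 1, F (x, t) ∈ V)
    (hF0 : ∀ x, F (x, 0) = x) (hF1 : ∀ x, F (x, 1) = g (f x))
    (G : C(Y × ℝ, Y)) (hG : ∀ U ∈ 𝒱, ∃ V ∈ 𝒱, ∀ x ∈ U, ∀ t ∈ Set.Icc (0 : ℝ) 1, G (x, t) ∈ V)
    (hG0 : ∀ x, G (x, 0) = x) (hG1 : ∀ x, G (x, 1) = f (g x)) :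
    InducesIso (pull ℤ (smallMap f hf)) := by
  have hX : ∀ U ∈ 𝒰, ∃ V ∈ 𝒰, Set.MapsTo (ContinuousMap.id X) U V :=
    fun V hV => ⟨V, hV, Set.mapsTo_id V⟩
  have hY : ∀ U ∈ 𝒱, ∃ V ∈ 𝒱, Set.MapsTo (ContinuousMap.id Y) U V :=
    fun V hV => ⟨V, hV, Set.mapsTo_id V⟩
  have hgf : ∀ U ∈ 𝒰, ∃ V ∈ 𝒰, Set.MapsTo (g.comp f) U V := by
    intro V hV
    obtain ⟨U, hU, h⟩ := hf V hV
    obtain ⟨V', hV', h'⟩ := hg U hU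
    exact ⟨V', hV', h'.comp h⟩
  have hfg : ∀ U ∈ 𝒱, ∃ V ∈ 𝒱, Set.MapsTo (f.comp g) U V := by
    intro V hV
    obtain ⟨U, hU, h⟩ := hg V hV
    obtain ⟨V', hV', h'⟩ := hf U hU
    exact ⟨V', hV', h'.comp h⟩
  constructor
  · intro n γ hγ hc
    have h1 := isCoboundary_of_homotopy G hG hY hfg hG0 hG1 γ hγ
    have e1 : (pull ℤ (smallMap (ContinuousMap.id Y) hY)).f n γ = γ :=
      toFun_injective (funext fun _ => rfl)
    have e2 : (pull ℤ (smallMap (f.comp g) hfg)).f n γ =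
        (pull ℤ (smallMap g hg)).f n ((pull ℤ (smallMap f hf)).f n γ) :=
      toFun_injective (funext fun _ => rfl)
    have h2 := h1.add (hc.map (pull ℤ (smallMap g hg)))
    rwa [e1, e2, sub_add_cancel] at h2
  · intro n γ hγ
    refine ⟨(pull ℤ (smallMap g hg)).f n γ, by rw [← hom_d_apply, hγ, map_zero], ?_⟩
    have h1 := (isCoboundary_of_homotopy F hF hX hgf hF0 hF1 γ hγ).neg
    have e1 : (pull ℤ (smallMap (ContinuousMap.id X) hX)).f n γ = γ :=
      toFun_injective (funext fun _ => rfl)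
    have e2 : (pull ℤ (smallMap (g.comp f) hgf)).f n γ =
        (pull ℤ (smallMap f hf)).f n ((pull ℤ (smallMap g hg)).f n γ) :=
      toFun_injective (funext fun _ => rfl)
    rwa [e1, e2, neg_sub] at h1

theorem small_mem {W : Set X} (h : ∀ U ∈ 𝒰, U ⊆ W) {Δ : SimplexCategoryᵒᵖ} (x : (small 𝒰).obj Δ)
    (τ : stdSimplex ℝ (Fin (Δ.unop.len + 1))) : x.1 τ ∈ W := by
  obtain ⟨U, hU, hx⟩ := x.2
  exact h U hU (hx τ)

/-- The singular simplices subordinate to a family of subsets of `W`, as singular simplices of the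
subspace `W`. -/
def toSingular {W : Set X} (h : ∀ U ∈ 𝒰, U ⊆ W) : small 𝒰 ⟶ TopCat.toSSet.obj (TopCat.of W) where
  app Δ := ↾fun x => (TopCat.toSSetObjEquiv (TopCat.of W) Δ).symm
    ⟨fun τ => ⟨x.1 τ, small_mem h x τ⟩, x.1.continuous.subtype_mk _⟩
  naturality _ _ _ := rfl

/-- The singular simplices of a subspace `W`, as simplices in the ambient space. -/
def ofSingular (W : Set X) : TopCat.toSSet.obj (TopCat.of W) ⟶ small {W} where
  app Δ := ↾fun x => ⟨⟨fun τ => (TopCat.toSSetObjEquiv (TopCat.of W) Δ x τ).1,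
    continuous_subtype_val.comp (TopCat.toSSetObjEquiv (TopCat.of W) Δ x).continuous⟩,
    W, rfl, fun τ => (TopCat.toSSetObjEquiv (TopCat.of W) Δ x τ).2⟩
  naturality _ _ _ := rfl

theorem inducesIso_toSingular (W : Set X) :
    InducesIso (pull ℤ (toSingular fun _ hU => (Set.mem_singleton_iff.1 hU).le :
      small {W} ⟶ TopCat.toSSet.obj (TopCat.of W))) :=
  inducesIso_pull_of_inverse _ (ofSingular W) rfl rfl

end

end SingularCochains

namespace MomentAngle

open SingularCochains SimplicialComplexOn

noncomputable section

variable {m n : ℕ} {K L M N : SimplicialComplexOn m}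

theorem polydisc_subset {σ : Finset (Fin m)} (h : σ ∈ K.faces) :
    polydisc σ ⊆ K.momentAngleComplex :=
  Set.subset_biUnion_of_mem (u := fun σ => polydisc σ) h

theorem mem_momentAngleComplex {z : Fin m → ℂ} :
    z ∈ K.momentAngleComplex ↔ ∃ σ ∈ K.faces, z ∈ polydisc σ := by
  simp only [momentAngleComplex, Set.mem_iUnion, exists_prop]
  rfl

/-- The points of the moment-angle complex whose coordinates outside `σ` are close to the circle. -/
def thickening (K : SimplicialComplexOn m) (σ : Finset (Fin m)) : Set (Fin m → ℂ) :=
  {z | z ∈ K.momentAngleComplex ∧ ∀ i, i ∉ σ → 1 / 2 < ‖z i‖}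

theorem polydisc_subset_thickening {σ : Finset (Fin m)} (h : σ ∈ K.faces) :
    polydisc σ ⊆ thickening K σ := fun z hz =>
  ⟨polydisc_subset h hz, fun i hi => by rw [mem_sphere_zero_iff_norm.1 (hz.2 i hi)]; norm_num⟩

/-- The factor by which a coordinate of absolute value `r` is multiplied at time `t` of the radial
deformation that pushes the points with `r ≥ 1 / 2` to the circle. -/
def radialFactor (r t : ℝ) : ℝ := 1 + t * ((max r (1 / 2))⁻¹ - 1)

/-- The radial deformation, applied to every coordinate. -/
def radial (m : ℕ) : C((Fin m → ℂ) × ℝ, Fin m → ℂ) :=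
  ⟨fun p i => (radialFactor ‖p.1 i‖ p.2 : ℂ) * p.1 i, by
    refine continuous_pi fun i => Continuous.mul (Complex.continuous_ofReal.comp ?_) (by fun_prop)
    unfold radialFactor
    refine continuous_const.add (continuous_snd.mul (Continuous.sub (Continuous.inv₀ ?_ ?_)
      continuous_const))
    · fun_prop
    · intro p
      exact (lt_max_of_lt_right (by norm_num)).ne'⟩

theorem norm_radial (z : Fin m → ℂ) {t : ℝ} (h0 : 0 ≤ t) (h1 : t ≤ 1) (i : Fin m) :
    ‖radial m (z, t) i‖ = radialFactor ‖z i‖ t * ‖z i‖ := by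
  have h : 0 ≤ radialFactor ‖z i‖ t := by
    have : 0 < (max ‖z i‖ (1 / 2))⁻¹ := inv_pos.2 (lt_max_of_lt_right (by norm_num))
    unfold radialFactor
    nlinarith
  change ‖(radialFactor ‖z i‖ t : ℂ) * z i‖ = _
  rw [norm_mul, Complex.norm_real, Real.norm_eq_abs, abs_of_nonneg h]

theorem norm_radial_bounds (z : Fin m → ℂ) {t : ℝ} (h0 : 0 ≤ t) (h1 : t ≤ 1) (i : Fin m)
    (hz : ‖z i‖ ≤ 1) : ‖z i‖ ≤ ‖radial m (z, t) i‖ ∧ ‖radial m (z, t) i‖ ≤ 1 := by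
  rw [norm_radial z h0 h1, radialFactor]
  have hm : 0 < max ‖z i‖ (1 / 2) := lt_max_of_lt_right (by norm_num)
  have hm1 : max ‖z i‖ (1 / 2) ≤ 1 := max_le hz (by norm_num)
  have h2 : 1 ≤ (max ‖z i‖ (1 / 2))⁻¹ := (one_le_inv₀ hm).2 hm1
  have h3 : (max ‖z i‖ (1 / 2))⁻¹ * ‖z i‖ ≤ 1 := by
    rw [inv_mul_le_iff₀ hm, mul_one]
    exact le_max_left _ _
  have hn := norm_nonneg (z i)
  constructor
  · nlinarith [mul_nonneg (mul_nonneg h0 (sub_nonneg.2 h2)) hn]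
  · have : (1 + t * ((max ‖z i‖ (1 / 2))⁻¹ - 1)) * ‖z i‖ =
        (1 - t) * ‖z i‖ + t * ((max ‖z i‖ (1 / 2))⁻¹ * ‖z i‖) := by ring
    rw [this]
    nlinarith

theorem radial_zero (z : Fin m → ℂ) : radial m (z, 0) = z := by
  funext i
  change (radialFactor ‖z i‖ 0 : ℂ) * z i = z i
  simp [radialFactor]

theorem radial_mem_polydisc {σ : Finset (Fin m)} {z : Fin m → ℂ} (hz : z ∈ polydisc σ) {t : ℝ}
    (h0 : 0 ≤ t) (h1 : t ≤ 1) : radial m (z, t) ∈ polydisc σ := by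
  have hb := fun i => norm_radial_bounds z h0 h1 i (mem_closedBall_zero_iff.1 (hz.1 i))
  refine ⟨fun i => mem_closedBall_zero_iff.2 (hb i).2, fun i hi => ?_⟩
  have := hb i
  rw [mem_sphere_zero_iff_norm.1 (hz.2 i hi)] at this
  exact mem_sphere_zero_iff_norm.2 (le_antisymm this.2 this.1)

theorem radial_mem_thickening {σ : Finset (Fin m)} {z : Fin m → ℂ} (hz : z ∈ thickening K σ) {t : ℝ}
    (h0 : 0 ≤ t) (h1 : t ≤ 1) : radial m (z, t) ∈ thickening K σ := by
  obtain ⟨τ, hτ, hz'⟩ := mem_momentAngleComplex.1 hz.1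
  refine ⟨polydisc_subset hτ (radial_mem_polydisc hz' h0 h1), fun i hi => ?_⟩
  exact (hz.2 i hi).trans_le
    (norm_radial_bounds z h0 h1 i (mem_closedBall_zero_iff.1 (hz'.1 i))).1

theorem radial_one_mem {σ : Finset (Fin m)} {z : Fin m → ℂ} (hz : z ∈ thickening K σ) :
    radial m (z, 1) ∈ polydisc σ := by
  obtain ⟨τ, hτ, hz'⟩ := mem_momentAngleComplex.1 hz.1
  have hb := fun i => norm_radial_bounds z zero_le_one le_rfl i (mem_closedBall_zero_iff.1 (hz'.1 i))
  refine ⟨fun i => mem_closedBall_zero_iff.2 (hb i).2, fun i hi => mem_sphere_zero_iff_norm.2 ?_⟩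
  have := hz.2 i hi
  rw [norm_radial z zero_le_one le_rfl, radialFactor, one_mul, max_eq_left this.le,
    add_sub_cancel, inv_mul_cancel₀ (by linarith)]

/-- The simplices that lie in a polydisc compute the cohomology of the moment-angle complex. -/
theorem inducesIso_polydiscs (K : SimplicialComplexOn m)
    (h : ∀ U ∈ polydiscs K, ∃ V ∈ ({K.momentAngleComplex} : Set (Set (Fin m → ℂ))), U ⊆ V) :
    InducesIso (pull ℤ (smallIncl h)) := by
  let 𝒱 : Set (Set (Fin m → ℂ)) := thickening K '' K.faces
  have h1 : ∀ U ∈ polydiscs K, ∃ V ∈ 𝒱, U ⊆ V := by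
    rintro _ ⟨σ, hσ, rfl⟩
    exact ⟨_, ⟨σ, hσ, rfl⟩, polydisc_subset_thickening hσ⟩
  have h2 : ∀ U ∈ 𝒱, ∃ V ∈ ({K.momentAngleComplex} : Set (Set (Fin m → ℂ))), U ⊆ V := by
    rintro _ ⟨σ, hσ, rfl⟩
    exact ⟨_, rfl, fun z hz => hz.1⟩
  have i2 : InducesIso (pull ℤ (smallIncl h2)) := by
    refine inducesIso_smallIncl h2 ?_
    rintro _ rfl z hz
    obtain ⟨σ, hσ, hz'⟩ := mem_momentAngleComplex.1 hz
    refine ⟨_, ⟨σ, hσ, rfl⟩, {z | ∀ i, i ∉ σ → 1 / 2 < ‖z i‖}, ?_,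
      (polydisc_subset_thickening hσ hz').2, fun z hz => ⟨hz.2, hz.1⟩⟩
    simp only [Set.ofPred_forall]
    exact isOpen_iInter_of_finite fun i => isOpen_iInter_of_finite fun _ =>
      isOpen_lt continuous_const (by fun_prop)
  have i1 : InducesIso (pull ℤ (smallIncl h1)) := by
    refine inducesIso_of_homotopy (f := ContinuousMap.id _)
      (g := (radial m).comp ((ContinuousMap.id _).prodMk (ContinuousMap.const _ 1))) h1 ?_ (radial m) ?_
      radial_zero (fun _ => rfl) (radial m) ?_ radial_zero (fun _ => rfl)
    · rintro _ ⟨σ, hσ, rfl⟩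
      exact ⟨_, ⟨σ, hσ, rfl⟩, fun z hz => radial_one_mem hz⟩
    · rintro _ ⟨σ, hσ, rfl⟩
      exact ⟨_, ⟨σ, hσ, rfl⟩, fun z hz t ht => radial_mem_polydisc hz ht.1 ht.2⟩
    · rintro _ ⟨σ, hσ, rfl⟩
      exact ⟨_, ⟨σ, hσ, rfl⟩, fun z hz t ht => radial_mem_thickening hz ht.1 ht.2⟩
  exact i2.comp i1

theorem toSingular_polydiscs (K : SimplicialComplexOn m) :
    ∀ U ∈ polydiscs K, U ⊆ K.momentAngleComplex := by
  rintro _ ⟨σ, hσ, rfl⟩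
  exact polydisc_subset hσ

/-- The simplices that lie in a polydisc, as singular simplices of the moment-angle complex. -/
def smallToSingular (m : ℕ) : smallFunctor m ⟶ momentAngleFunctor m ⋙ TopCat.toSSet where
  app K := toSingular (toSingular_polydiscs K)
  naturality _ _ _ := rfl

/-- The restriction of cochains to the simplices that lie in a polydisc. -/
def restrictToSmall (m : ℕ) :
    functorCochains ℤ m ⟶ (smallFunctor m).op ⋙ SingularCochains.functor ℤ :=
  Functor.whiskerRight (NatTrans.op (smallToSingular m)) (SingularCochains.functor ℤ)

theorem restrictToSmall_isQuasiIso (K : (SimplicialComplexOn m)ᵒᵖ) :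
    DGA.IsQuasiIso ((restrictToSmall m).app K) := by
  refine InducesIso.quasiIso ?_
  exact (inducesIso_toSingular K.unop.momentAngleComplex).comp
    (inducesIso_polydiscs K.unop fun U hU => ⟨_, rfl, toSingular_polydiscs K.unop U hU⟩)

theorem polydisc_inter (σ τ : Finset (Fin m)) : polydisc σ ∩ polydisc τ = polydisc (σ ∩ τ) := by
  ext z
  simp only [polydisc, Set.mem_inter_iff, Set.mem_ofPred_eq, Finset.mem_inter, not_and_or]
  constructor
  · rintro ⟨⟨h1, h2⟩, -, h3⟩
    exact ⟨h1, fun i hi => hi.elim (h2 i) (h3 i)⟩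
  · rintro ⟨h1, h2⟩
    exact ⟨⟨h1, fun i hi => h2 i (Or.inl hi)⟩, h1, fun i hi => h2 i (Or.inr hi)⟩

/-- The Mayer-Vietoris square of the cochains of small simplices. -/
theorem small_isMayerVietoris (hL : L ≤ K) (hM : M ≤ K) (hNL : N ≤ L) (hNM : N ≤ M)
    (hLM : K.faces ⊆ L.faces ∪ M.faces) (hN : N.faces = L.faces ∩ M.faces) :
    IsMayerVietoris (pull ℤ (smallIncl (polydiscs_mono hL))) (pull ℤ (smallIncl (polydiscs_mono hM)))
      (pull ℤ (smallIncl (polydiscs_mono hNL))) (pull ℤ (smallIncl (polydiscs_mono hNM))) where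
  comm := by
    refine HomologicalComplex.hom_ext _ _ fun n => ModuleCat.hom_ext (LinearMap.ext fun γ => ?_)
    exact toFun_injective (funext fun _ => rfl)
  ext n γ h1 h2 := by
    refine toFun_injective (funext fun x => ?_)
    obtain ⟨_, ⟨σ, hσ, rfl⟩, hx⟩ := x.2
    refine Eq.trans (value_val γ x).symm ?_
    rcases hLM hσ with hσ | hσ
    · refine (value_incl (polydiscs_mono hL) γ ⟨_, ⟨σ, hσ, rfl⟩, hx⟩).symm.trans ?_
      rw [h1, value_zero]
      rfl
    · refine (value_incl (polydiscs_mono hM) γ ⟨_, ⟨σ, hσ, rfl⟩, hx⟩).symm.trans ?_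
      rw [h2, value_zero]
      rfl
  glue n b c hbc := by
    classical
    have agree : ∀ x : C(stdSimplex ℝ (Fin (n + 1)), Fin m → ℂ),
        (∃ U ∈ polydiscs L, ∀ τ, x τ ∈ U) → (∃ U ∈ polydiscs M, ∀ τ, x τ ∈ U) →
        value b x = value c x := by
      rintro x ⟨_, ⟨σ, hσ, rfl⟩, hxσ⟩ ⟨_, ⟨τ, hτ, rfl⟩, hxτ⟩
      have hx : ∃ U ∈ polydiscs N, ∀ τ, x τ ∈ U := by
        refine ⟨_, ⟨σ ∩ τ, ?_, rfl⟩, fun p => ?_⟩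
        · rw [hN]
          exact ⟨L.down_closed hσ Finset.inter_subset_left,
            M.down_closed hτ Finset.inter_subset_right⟩
        · rw [← polydisc_inter]
          exact ⟨hxσ p, hxτ p⟩
      rw [← value_incl (polydiscs_mono hNL) b hx, hbc, value_incl _ _ hx]
    have hmem : (fun x : (small (polydiscs K)) _⦋n⦌ =>
        if ∃ U ∈ polydiscs L, ∀ τ, x.1 τ ∈ U then value b x.1 else value c x.1) ∈
        normalizedCochains ℤ (small (polydiscs K)) n := by
      intro x hx
      cases n with
      | zero => simp at hx
      | succ n =>
        rw [SSet.degenerate_eq_iUnion_range_σ] at hx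
        obtain ⟨j, y, rfl⟩ := Set.mem_iUnion.1 hx
        have h2 : (small (polydiscs K)).σ j ((small (polydiscs K)).δ j.castSucc
            ((small (polydiscs K)).σ j y)) = (small (polydiscs K)).σ j y := by
          rw [(small (polydiscs K)).δ_comp_σ_self_apply]
        refine (apply_ite (· = (0 : ℤ)) _ _ _).mpr ?_
        split_ifs
        · exact value_degenerate b j (congrArg Subtype.val h2)
        · exact value_degenerate c j (congrArg Subtype.val h2)
    obtain ⟨γ, hγ⟩ := exists_toFun hmem
    refine ⟨γ, toFun_injective (funext fun x => ?_), toFun_injective (funext fun x => ?_)⟩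
    · rw [toFun_pull, hγ]
      exact (if_pos x.2).trans (value_val b x)
    · rw [toFun_pull, hγ]
      refine Eq.trans ?_ (value_val c x)
      change (if ∃ U ∈ polydiscs L, ∀ τ, x.1 τ ∈ U then value b x.1 else value c x.1) = _
      split_ifs with h
      · exact agree _ h x.2
      · rfl
  surj n := surjective_pull_smallIncl _

end

end MomentAngle

/-! ### Lifting simplices along the universal covering of a circle factor -/

namespace SingularCochains

noncomputable section

variable {X : Type} [TopologicalSpace X] {𝒰 : Set (Set X)} {n : ℕ}

theorem value_comp_degenerate {R : Type} [CommRing R] (γ : (dga R (small 𝒰)).cx.X n) {k : ℕ}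
    (h : k < n) (g : ⦋n⦌ ⟶ ⦋k⦌) (y : C(stdSimplex ℝ (Fin (k + 1)), X)) :
    value γ (y.comp (simplexMap g)) = 0 := by
  obtain _ | n := n
  · omega
  · have hg : ¬ Function.Injective g.toOrderHom := by
      intro hinj
      have := SimplexCategory.mono_iff_injective.2 hinj
      have := SimplexCategory.le_of_mono g
      omega
    obtain ⟨i, g', rfl⟩ := SimplexCategory.eq_σ_comp_of_not_injective g hg
    refine value_degenerate γ i ?_
    rw [ContinuousMap.comp_assoc, ContinuousMap.comp_assoc, simplexMap_comp, simplexMap_comp,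
      Category.assoc, SimplexCategory.δ_comp_σ_self_assoc]

/-- A function on singular simplices that vanishes on the degenerate ones defines a cochain. -/
theorem exists_value {R : Type} [CommRing R] (f : C(stdSimplex ℝ (Fin (n + 1)), X) → R)
    (hf : ∀ (k : ℕ) (g : ⦋n⦌ ⟶ ⦋k⦌) (y : C(stdSimplex ℝ (Fin (k + 1)), X)), k < n →
      (∃ U ∈ 𝒰, ∀ τ, y τ ∈ U) → f (y.comp (simplexMap g)) = 0) :
    ∃ γ : (dga R (small 𝒰)).cx.X n, ∀ x, (∃ U ∈ 𝒰, ∀ τ, x τ ∈ U) → value γ x = f x := by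
  obtain ⟨γ, hγ⟩ := exists_toFun (R := R) (S := small 𝒰) (n := n) (f := fun x => f x.1) (by
    rintro x ⟨k, hk, g, y, rfl⟩
    exact hf k g y.1 hk y.2)
  exact ⟨γ, fun x hx => by rw [value_of_mem _ hx, hγ]; rfl⟩

theorem cochain_ext {R : Type} [CommRing R] {γ γ' : (dga R (small 𝒰)).cx.X n}
    (h : ∀ x, (∃ U ∈ 𝒰, ∀ τ, x τ ∈ U) → value γ x = value γ' x) : γ = γ' :=
  toFun_injective (funext fun x => by rw [← value_val, ← value_val, h x.1 x.2])

/-- Simplices in the circle lift to the real line. -/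
theorem exists_lift_circle (x : C(stdSimplex ℝ (Fin (n + 1)), Circle)) :
    ∃ y : C(stdSimplex ℝ (Fin (n + 1)), ℝ), ∀ τ, Circle.exp (y τ) = x τ := by
  let v : stdSimplex ℝ (Fin (n + 1)) := ⟨Pi.single 0 1, single_mem_stdSimplex ℝ 0⟩
  let c : C(unitInterval × stdSimplex ℝ (Fin (n + 1)), stdSimplex ℝ (Fin (n + 1))) :=
    ⟨fun p => ⟨(1 - (p.1 : ℝ)) • v.1 + (p.1 : ℝ) • p.2.1, convex_stdSimplex ℝ _ v.2 p.2.2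
      (by linarith [p.1.2.2]) p.1.2.1 (by ring)⟩, by
      refine Continuous.subtype_mk ?_ _
      have h1 : Continuous fun p : unitInterval × stdSimplex ℝ (Fin (n + 1)) => (p.1 : ℝ) :=
        continuous_subtype_val.comp continuous_fst
      have h2 : Continuous fun p : unitInterval × stdSimplex ℝ (Fin (n + 1)) => p.2.1 :=
        continuous_subtype_val.comp continuous_snd
      exact ((continuous_const.sub h1).smul continuous_const).add (h1.smul h2)⟩
  have c0 : ∀ τ, c (0, τ) = v := fun τ => Subtype.ext (by simp [c])
  have c1 : ∀ τ, c (1, τ) = τ := fun τ => Subtype.ext (by simp [c])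
  obtain ⟨e, he⟩ := Circle.exp_surjective (x v)
  let H := Circle.isCoveringMap_exp.liftHomotopy (x.comp c) (ContinuousMap.const _ e)
    (fun τ => by rw [ContinuousMap.comp_apply, c0, ← he]; rfl)
  refine ⟨H.comp ((ContinuousMap.const _ 1).prodMk (ContinuousMap.id _)), fun τ => ?_⟩
  have := congrFun (Circle.isCoveringMap_exp.liftHomotopy_lifts (x.comp c) (ContinuousMap.const _ e)
    (fun τ => by rw [ContinuousMap.comp_apply, c0, ← he]; rfl)) (1, τ)
  rw [ContinuousMap.comp_apply, c1] at this
  exact this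

/-- Two real-valued functions on a simplex that agree modulo `ℤ` differ by an integer constant. -/
theorem exists_int_of_forall (y y' : C(stdSimplex ℝ (Fin (n + 1)), ℝ))
    (h : ∀ τ, ∃ k : ℤ, y' τ = y τ + k) : ∃ k : ℤ, ∀ τ, y' τ = y τ + k := by
  choose k hk using h
  have hc : Continuous k := by
    rw [Int.isClosedEmbedding_coe_real.isInducing.continuous_iff]
    have : (fun z : ℤ => (z : ℝ)) ∘ k = fun τ => y' τ - y τ :=
      funext fun τ => by rw [Function.comp_apply, hk]; ring
    rw [this]
    exact y'.continuous.sub y.continuous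
  obtain ⟨v⟩ : Nonempty (stdSimplex ℝ (Fin (n + 1))) := inferInstance
  exact ⟨k v, fun τ => by rw [hk, PreconnectedSpace.constant inferInstance hc (x := τ) (y := v)]⟩

end

end SingularCochains

namespace MomentAngle

open SingularCochains

noncomputable section

variable {m n : ℕ}

/-- The translation of the `i`-th coordinate by an integer. -/
def shift (i : Fin m) (k : ℤ) : C(Fin m → ℂ, Fin m → ℂ) :=
  ⟨fun z => Function.update z i (z i + k),
    continuous_id.update i ((continuous_apply i).add continuous_const)⟩

/-- The map which, on the `i`-th coordinate, is the universal covering of the unit circle by the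
real line. -/
def wrap (i : Fin m) : C(Fin m → ℂ, Fin m → ℂ) :=
  ⟨fun z => Function.update z i (Complex.exp (2 * Real.pi * Complex.I * z i)),
    continuous_id.update i (by fun_prop)⟩

theorem shift_same (i : Fin m) (k : ℤ) (z : Fin m → ℂ) : shift i k z i = z i + k :=
  Function.update_self _ _ _

theorem shift_of_ne {i j : Fin m} (h : j ≠ i) (k : ℤ) (z : Fin m → ℂ) : shift i k z j = z j :=
  Function.update_of_ne h _ _

theorem wrap_same (i : Fin m) (z : Fin m → ℂ) :
    wrap i z i = Complex.exp (2 * Real.pi * Complex.I * z i) :=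
  Function.update_self _ _ _

theorem wrap_of_ne {i j : Fin m} (h : j ≠ i) (z : Fin m → ℂ) : wrap i z j = z j :=
  Function.update_of_ne h _ _

theorem shift_shift (i : Fin m) (k l : ℤ) : (shift i k).comp (shift i l) = shift i (k + l) := by
  refine ContinuousMap.ext fun z => funext fun j => ?_
  rw [ContinuousMap.comp_apply]
  by_cases h : j = i
  · subst h
    rw [shift_same, shift_same, shift_same]
    push_cast
    ring
  · rw [shift_of_ne h, shift_of_ne h, shift_of_ne h]

theorem shift_zero (i : Fin m) : shift i 0 = ContinuousMap.id _ := by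
  refine ContinuousMap.ext fun z => funext fun j => ?_
  by_cases h : j = i
  · subst h
    rw [shift_same, Int.cast_zero, add_zero]
    rfl
  · rw [shift_of_ne h]
    rfl

theorem wrap_shift (i : Fin m) (k : ℤ) : (wrap i).comp (shift i k) = wrap i := by
  refine ContinuousMap.ext fun z => funext fun j => ?_
  rw [ContinuousMap.comp_apply]
  by_cases h : j = i
  · subst h
    rw [wrap_same, wrap_same, shift_same, mul_add, Complex.exp_add, mul_comm _ (k : ℂ),
      Complex.exp_int_mul_two_pi_mul_I, mul_one]
  · rw [wrap_of_ne h, wrap_of_ne h, shift_of_ne h]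

/-- The product of real lines (for the indices in `E`), discs (for the remaining indices in `σ`) and
circles. -/
def region (σ E : Finset (Fin m)) : Set (Fin m → ℂ) :=
  {z | (∀ i ∈ E, (z i).im = 0) ∧ (∀ i, i ∉ E → ‖z i‖ ≤ 1) ∧ ∀ i, i ∉ E → i ∉ σ → ‖z i‖ = 1}

variable {σ E : Finset (Fin m)} {i : Fin m}

theorem shift_mem (hi : i ∈ E) (k : ℤ) {z : Fin m → ℂ} (hz : z ∈ region σ E) :
    shift i k z ∈ region σ E := by
  have hne : ∀ {j}, j ∉ E → j ≠ i := fun hj h => hj (h ▸ hi)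
  refine ⟨fun j hj => ?_, fun j hj => ?_, fun j hj hj' => ?_⟩
  · by_cases h : j = i
    · subst h
      rw [shift_same, Complex.add_im, hz.1 j hj, Complex.intCast_im, add_zero]
    · rw [shift_of_ne h]
      exact hz.1 j hj
  · rw [shift_of_ne (hne hj)]
    exact hz.2.1 j hj
  · rw [shift_of_ne (hne hj)]
    exact hz.2.2 j hj hj'

theorem exp_two_pi_of_im_eq_zero {z : ℂ} (hz : z.im = 0) :
    Complex.exp (2 * Real.pi * Complex.I * z) = Circle.exp (2 * Real.pi * z.re) := by
  rw [Circle.coe_exp]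
  have : z = z.re := Complex.ext rfl (by simp [hz])
  conv_lhs => rw [this]
  push_cast
  ring_nf

theorem wrap_mem (hi : i ∉ E) {z : Fin m → ℂ} (hz : z ∈ region σ (insert i E)) :
    wrap i z ∈ region σ E := by
  have h1 : ‖wrap i z i‖ = 1 := by
    rw [wrap_same, exp_two_pi_of_im_eq_zero (hz.1 i (Finset.mem_insert_self i E)), Circle.norm_coe]
  refine ⟨fun j hj => ?_, fun j hj => ?_, fun j hj hj' => ?_⟩
  · have h : j ≠ i := fun h => hi (h ▸ hj)
    rw [wrap_of_ne h]
    exact hz.1 j (Finset.mem_insert_of_mem hj)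
  · by_cases h : j = i
    · subst h
      exact h1.le
    · rw [wrap_of_ne h]
      exact hz.2.1 j (by rw [Finset.mem_insert]; tauto)
  · by_cases h : j = i
    · subst h
      exact h1
    · rw [wrap_of_ne h]
      exact hz.2.2 j (by rw [Finset.mem_insert]; tauto) hj'

/-- Simplices lift along `wrap i`. -/
theorem exists_lift (hE : i ∉ E) (hσ : i ∉ σ) {x : C(stdSimplex ℝ (Fin (n + 1)), Fin m → ℂ)}
    (hx : ∀ τ, x τ ∈ region σ E) : ∃ y : C(stdSimplex ℝ (Fin (n + 1)), Fin m → ℂ),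
      (∀ τ, y τ ∈ region σ (insert i E)) ∧ (wrap i).comp y = x := by
  have hc : Continuous fun τ => x τ i := (continuous_apply i).comp x.continuous
  obtain ⟨y, hy⟩ := exists_lift_circle (⟨fun τ => ⟨x τ i, mem_sphere_zero_iff_norm.2
    ((hx τ).2.2 i hE hσ)⟩, hc.subtype_mk _⟩ : C(stdSimplex ℝ (Fin (n + 1)), Circle))
  have hy' : ∀ τ, (Circle.exp (y τ) : ℂ) = x τ i := fun τ => congrArg Subtype.val (hy τ)
  refine ⟨⟨fun τ => Function.update (x τ) i ((y τ / (2 * Real.pi) : ℝ) : ℂ), x.continuous.update i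
    (Complex.continuous_ofReal.comp (y.continuous.div_const _))⟩, fun τ => ?_, ?_⟩
  · rw [ContinuousMap.coe_mk]
    refine ⟨fun j hj => ?_, fun j hj => ?_, fun j hj hj' => ?_⟩
    · by_cases h : j = i
      · subst h
        rw [Function.update_self, Complex.ofReal_im]
      · rw [Function.update_of_ne h]
        exact (hx τ).1 j (Finset.mem_of_mem_insert_of_ne hj h)
    all_goals
      rw [Finset.mem_insert, not_or] at hj
      rw [Function.update_of_ne hj.1]
    exacts [(hx τ).2.1 j hj.2, (hx τ).2.2 j hj.2 hj']
  · refine ContinuousMap.ext fun τ => funext fun j => ?_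
    rw [ContinuousMap.comp_apply]
    by_cases h : j = i
    · subst h
      rw [wrap_same, ContinuousMap.coe_mk, Function.update_self,
        exp_two_pi_of_im_eq_zero (Complex.ofReal_im _), Complex.ofReal_re,
        mul_div_cancel₀ _ Real.two_pi_pos.ne', hy']
    · rw [wrap_of_ne h]
      exact Function.update_of_ne h _ _

/-- Two lifts of a simplex along `wrap i` differ by a translation. -/
theorem exists_shift_eq (hi : i ∈ E) {y y' : C(stdSimplex ℝ (Fin (n + 1)), Fin m → ℂ)}
    (hy : ∀ τ, y τ ∈ region σ E) (hy' : ∀ τ, y' τ ∈ region σ E)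
    (h : (wrap i).comp y = (wrap i).comp y') : ∃ k : ℤ, y' = (shift i k).comp y := by
  have hc : ∀ y : C(stdSimplex ℝ (Fin (n + 1)), Fin m → ℂ), Continuous fun τ => (y τ i).re :=
    fun y => Complex.continuous_re.comp ((continuous_apply i).comp y.continuous)
  have h' : ∀ τ j, wrap i (y τ) j = wrap i (y' τ) j := fun τ j => congrFun (DFunLike.congr_fun h τ) j
  obtain ⟨k, hk⟩ := exists_int_of_forall ⟨_, hc y⟩ ⟨_, hc y'⟩ (fun τ => by
    have h1 := h' τ i
    rw [wrap_same, wrap_same, Complex.exp_eq_exp_iff_exists_int] at h1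
    obtain ⟨k, hk⟩ := h1
    have h2 : y τ i = y' τ i + k := by
      have h0 : (2 * Real.pi * Complex.I : ℂ) ≠ 0 := Complex.two_pi_I_ne_zero
      refine mul_left_cancel₀ h0 ?_
      rw [hk]
      ring
    refine ⟨-k, ?_⟩
    have h3 := congrArg Complex.re h2
    rw [Complex.add_re, Complex.intCast_re] at h3
    change (y' τ i).re = (y τ i).re + ((-k : ℤ) : ℝ)
    push_cast
    linarith)
  refine ⟨k, ContinuousMap.ext fun τ => funext fun j => ?_⟩
  rw [ContinuousMap.comp_apply]
  by_cases hj : j = i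
  · subst hj
    rw [shift_same]
    refine Complex.ext ?_ ?_
    · rw [Complex.add_re, Complex.intCast_re]
      exact hk τ
    · rw [Complex.add_im, Complex.intCast_im, (hy τ).1 j hi, (hy' τ).1 j hi, add_zero]
  · rw [shift_of_ne hj]
    have := h' τ j
    rw [wrap_of_ne hj, wrap_of_ne hj] at this
    exact this.symm

end

end MomentAngle

/-! ### Cochains on the universal covering of a circle factor -/

namespace SingularCochains

noncomputable section

variable {X : Type} [TopologicalSpace X] {𝒰 : Set (Set X)} {n : ℕ}

theorem value_sub {R : Type} [CommRing R] (γ γ' : (dga R (small 𝒰)).cx.X n)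
    (x : C(stdSimplex ℝ (Fin (n + 1)), X)) : value (γ - γ') x = value γ x - value γ' x := by
  rw [eq_sub_iff_add_eq, ← value_add, sub_add_cancel]

/-- A linear right inverse of the operator `S ↦ (k ↦ S (k - 1) - S k)`. -/
theorem exists_antidifference :
    ∃ S : (ℤ → ℤ) → ℤ → ℤ, (∀ g k, S g (k - 1) - S g k = g k) ∧ ∀ k, S 0 k = 0 := by
  refine ⟨fun g k => ∑ l ∈ Finset.Ioc k 0, g l - ∑ l ∈ Finset.Ioc 0 k, g l, fun g k => ?_,
    fun k => by simp⟩
  rcases le_or_gt k 0 with h | h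
  · have h1 : Finset.Ioc (k - 1) 0 = insert k (Finset.Ioc k 0) := by
      ext l; simp only [Finset.mem_Ioc, Finset.mem_insert]; omega
    have h2 : Finset.Ioc 0 (k - 1) = ∅ := Finset.Ioc_eq_empty (by omega)
    have h3 : Finset.Ioc 0 k = ∅ := Finset.Ioc_eq_empty (by omega)
    simp only [h1, h2, h3]
    rw [Finset.sum_insert (by simp)]
    simp
  · have h1 : Finset.Ioc 0 k = insert k (Finset.Ioc 0 (k - 1)) := by
      ext l; simp only [Finset.mem_Ioc, Finset.mem_insert]; omega
    have h2 : Finset.Ioc (k - 1) 0 = ∅ := Finset.Ioc_eq_empty (by omega)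
    have h3 : Finset.Ioc k 0 = ∅ := Finset.Ioc_eq_empty (by omega)
    simp only [h1, h2, h3]
    rw [Finset.sum_insert (by simp)]
    simp

end

end SingularCochains

namespace MomentAngle

open SingularCochains

noncomputable section

variable {m n : ℕ}

/-- The singular cochains of `region σ E`. -/
abbrev regionCochains (σ E : Finset (Fin m)) : DGA ℤ := dga ℤ (small {region σ E})

variable {σ E : Finset (Fin m)} {i : Fin m}

theorem small_region {x : C(stdSimplex ℝ (Fin (n + 1)), Fin m → ℂ)}
    (h : ∀ τ, x τ ∈ region σ E) :
    ∃ U ∈ ({region σ E} : Set (Set (Fin m → ℂ))), ∀ τ, x τ ∈ U := ⟨_, rfl, h⟩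

theorem region_ext {α β : (regionCochains σ E).cx.X n}
    (h : ∀ x : C(stdSimplex ℝ (Fin (n + 1)), Fin m → ℂ), (∀ τ, x τ ∈ region σ E) →
      value α x = value β x) : α = β :=
  cochain_ext fun x ⟨_, hU, hx⟩ => h x (hU ▸ hx)

theorem exists_region_value (f : C(stdSimplex ℝ (Fin (n + 1)), Fin m → ℂ) → ℤ)
    (hf : ∀ (k : ℕ) (g : ⦋n⦌ ⟶ ⦋k⦌) (y : C(stdSimplex ℝ (Fin (k + 1)), Fin m → ℂ)), k < n →
      (∀ τ, y τ ∈ region σ E) → f (y.comp (simplexMap g)) = 0) :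
    ∃ γ : (regionCochains σ E).cx.X n, ∀ x, (∀ τ, x τ ∈ region σ E) → value γ x = f x := by
  obtain ⟨γ, h⟩ := exists_value (𝒰 := {region σ E}) f
    fun k g y hk ⟨_, hU, hy⟩ => hf k g y hk (hU ▸ hy)
  exact ⟨γ, fun x hx => h x (small_region hx)⟩

/-- Pull-back of cochains along `wrap i`. -/
def wrapPull (σ : Finset (Fin m)) (hi : i ∉ E) :
    (regionCochains σ E).cx ⟶ (regionCochains σ (insert i E)).cx :=
  pull ℤ (smallMap (wrap i) (by rintro _ rfl; exact ⟨_, rfl, fun _ => wrap_mem hi⟩))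

/-- Pull-back of cochains along `shift i k`. -/
def shiftPull (σ : Finset (Fin m)) (hi : i ∈ E) (k : ℤ) :
    (regionCochains σ E).cx ⟶ (regionCochains σ E).cx :=
  pull ℤ (smallMap (shift i k) (by rintro _ rfl; exact ⟨_, rfl, fun _ => shift_mem hi k⟩))

theorem value_wrapPull (hi : i ∉ E) (α : (regionCochains σ E).cx.X n)
    {x : C(stdSimplex ℝ (Fin (n + 1)), Fin m → ℂ)} (hx : ∀ τ, x τ ∈ region σ (insert i E)) :
    value ((wrapPull σ hi).f n α) x = value α ((wrap i).comp x) :=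
  value_map _ _ α (small_region hx)

theorem value_shiftPull (hi : i ∈ E) (k : ℤ) (α : (regionCochains σ E).cx.X n)
    {x : C(stdSimplex ℝ (Fin (n + 1)), Fin m → ℂ)} (hx : ∀ τ, x τ ∈ region σ E) :
    value ((shiftPull σ hi k).f n α) x = value α ((shift i k).comp x) :=
  value_map _ _ α (small_region hx)

theorem wrapPull_injective (hE : i ∉ E) (hσ : i ∉ σ) :
    Function.Injective ((wrapPull σ hE).f n) := by
  intro α β h
  refine region_ext fun x hx => ?_
  obtain ⟨y, hy, rfl⟩ := exists_lift hE hσ hx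
  rw [← value_wrapPull hE α hy, h, value_wrapPull hE β hy]

theorem shiftPull_wrapPull (hi : i ∉ E) (k : ℤ) (α : (regionCochains σ E).cx.X n) :
    (shiftPull σ (Finset.mem_insert_self i E) k).f n ((wrapPull σ hi).f n α) =
      (wrapPull σ hi).f n α := by
  refine region_ext fun x hx => ?_
  rw [value_shiftPull _ _ _ hx, value_wrapPull hi α fun τ => shift_mem (Finset.mem_insert_self i E) k
    (hx τ), value_wrapPull hi α hx, ← ContinuousMap.comp_assoc, wrap_shift]

theorem exists_shiftPull_sub (hi : i ∈ E) (η : (regionCochains σ E).cx.X n) :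
    ∃ ζ, (shiftPull σ hi (-1)).f n ζ - ζ = η := by
  obtain ⟨S, hS, hS0⟩ := exists_antidifference
  -- The integer part of the `i`-th coordinate of a vertex tells the translates of a simplex apart.
  let v : stdSimplex ℝ (Fin (n + 1)) := ⟨Pi.single 0 1, single_mem_stdSimplex ℝ 0⟩
  let k (x : C(stdSimplex ℝ (Fin (n + 1)), Fin m → ℂ)) : ℤ := ⌊(x v i).re⌋
  let g (x : C(stdSimplex ℝ (Fin (n + 1)), Fin m → ℂ)) (j : ℤ) : ℤ :=
    value η ((shift i (j - k x)).comp x)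
  obtain ⟨ζ, hζ⟩ := exists_region_value (σ := σ) (E := E) (n := n) (fun x => S (g x) (k x))
    (fun l f y hl _ => by
      have : g (y.comp (simplexMap f)) = 0 := funext fun j =>
        value_comp_degenerate η hl f ((shift i (j - k (y.comp (simplexMap f)))).comp y)
      rw [this, hS0])
  refine ⟨ζ, region_ext fun x hx => ?_⟩
  have hx' : ∀ τ, ((shift i (-1)).comp x) τ ∈ region σ E := fun τ => shift_mem hi _ (hx τ)
  have hk : k ((shift i (-1)).comp x) = k x - 1 := by
    change ⌊(shift i (-1) (x v) i).re⌋ = ⌊(x v i).re⌋ - 1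
    rw [shift_same, Complex.add_re, Complex.intCast_re, Int.floor_add_intCast, sub_eq_add_neg]
  have hg : g ((shift i (-1)).comp x) = g x := funext fun j => by
    change value η ((shift i (j - k ((shift i (-1)).comp x))).comp ((shift i (-1)).comp x)) = _
    rw [hk, ← ContinuousMap.comp_assoc, shift_shift]
    congr 3
    ring
  rw [value_sub, value_shiftPull hi _ _ hx, hζ _ hx', hζ _ hx, hg, hk, hS]
  change value η ((shift i (k x - k x)).comp x) = _
  rw [sub_self, shift_zero, ContinuousMap.id_comp]

theorem value_shift_of_invariant (hi : i ∈ E) {β : (regionCochains σ E).cx.X n}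
    (hβ : (shiftPull σ hi (-1)).f n β = β) {x : C(stdSimplex ℝ (Fin (n + 1)), Fin m → ℂ)}
    (hx : ∀ τ, x τ ∈ region σ E) (k : ℤ) : value β ((shift i k).comp x) = value β x := by
  have hx' : ∀ (l : ℤ) τ, ((shift i l).comp x) τ ∈ region σ E := fun l τ => shift_mem hi _ (hx τ)
  have step : ∀ l : ℤ, value β ((shift i (-1 + l)).comp x) = value β ((shift i l).comp x) :=
    fun l => by
      rw [← shift_shift, ContinuousMap.comp_assoc, ← value_shiftPull hi _ _ (hx' l), hβ]
  induction k using Int.induction_on with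
  | zero => rw [shift_zero, ContinuousMap.id_comp]
  | succ k ih =>
    have := step (k + 1)
    rw [neg_add_cancel_comm_assoc] at this
    rw [← this, ih]
  | pred k ih =>
    have := step (-k)
    rw [neg_add_eq_sub, sub_eq_add_neg, neg_add_eq_sub] at this
    rw [← ih, ← step (-k), neg_add_eq_sub]

/-- The cochains invariant under translations come from the quotient. -/
theorem exists_wrapPull_eq (hE : i ∉ E) (hσ : i ∉ σ)
    {β : (regionCochains σ (insert i E)).cx.X n}
    (hβ : (shiftPull σ (Finset.mem_insert_self i E) (-1)).f n β = β) :
    ∃ γ, (wrapPull σ hE).f n γ = β := by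
  classical
  have hi := Finset.mem_insert_self i E
  have key : ∀ y y' : C(stdSimplex ℝ (Fin (n + 1)), Fin m → ℂ),
      (∀ τ, y τ ∈ region σ (insert i E)) → (∀ τ, y' τ ∈ region σ (insert i E)) →
      (wrap i).comp y = (wrap i).comp y' → value β y = value β y' := by
    intro y y' hy hy' h
    obtain ⟨k, rfl⟩ := exists_shift_eq hi hy hy' h
    exact (value_shift_of_invariant hi hβ hy k).symm
  choose lift lift_mem wrap_lift using fun (x : C(stdSimplex ℝ (Fin (n + 1)), Fin m → ℂ))
    (hx : ∀ τ, x τ ∈ region σ E) => exists_lift hE hσ hx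
  obtain ⟨γ, hγ⟩ := exists_region_value (σ := σ) (E := E) (n := n)
    (fun x => if hx : ∀ τ, x τ ∈ region σ E then value β (lift x hx) else 0)
    (fun l f y hl hy => by
      have hyf : ∀ τ, (y.comp (simplexMap f)) τ ∈ region σ E := fun τ => hy _
      obtain ⟨y', hy', rfl⟩ := exists_lift hE hσ hy
      rw [dif_pos hyf, key _ (y'.comp (simplexMap f)) (lift_mem _ _) (fun τ => hy' _)
        ((wrap_lift _ _).trans (ContinuousMap.comp_assoc _ _ _))]
      exact value_comp_degenerate β hl f y')
  refine ⟨γ, region_ext fun x hx => ?_⟩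
  have hx' : ∀ τ, ((wrap i).comp x) τ ∈ region σ E := fun τ => wrap_mem hE (hx τ)
  rw [value_wrapPull hE γ hx, hγ _ hx', dif_pos hx']
  exact key _ _ (lift_mem _ _) hx (wrap_lift _ _)

end

end MomentAngle

/-! ### The periods of a cochain -/

namespace MomentAngle

open SingularCochains

noncomputable section

variable {m n : ℕ} {σ E : Finset (Fin m)} {i : Fin m}

/-- The standard basis vectors, with those indexed by `E` replaced by `0`. -/
def basisVec (E : Finset (Fin m)) (j : Fin m) : Fin m → ℤ := if j ∈ E then 0 else Pi.single j 1

/-- The exterior product of the basis vectors given by a word. -/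
def extWord (E : Finset (Fin m)) (w : Fin n → Fin m) : ExteriorAlgebra ℤ (Fin m → ℤ) :=
  ExteriorAlgebra.ιMulti ℤ n (fun k => basisVec E (w k))

theorem extWord_zero (w : Fin 0 → Fin m) : extWord E w = 1 := ExteriorAlgebra.ιMulti_zero_apply _

theorem extWord_cons (j : Fin m) (w : Fin n → Fin m) :
    extWord E (Fin.cons j w : Fin (n + 1) → Fin m) =
      ExteriorAlgebra.ι ℤ (basisVec E j) * extWord E w := by
  rw [extWord, ExteriorAlgebra.ιMulti_succ_apply]
  rfl

theorem injective_of_extWord_ne_zero {w : Fin n → Fin m} (h : extWord E w ≠ 0) :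
    Function.Injective w := by
  by_contra hw
  exact h (ExteriorAlgebra.ιMulti_eq_zero_of_not_inj fun hinj =>
    hw (Function.Injective.of_comp (f := basisVec E) hinj))

theorem notMem_of_extWord_ne_zero {w : Fin n → Fin m} (h : extWord E w ≠ 0) (k : Fin n) :
    w k ∉ E := by
  intro hk
  exact h (AlternatingMap.map_coord_zero _ k (if_pos hk))

theorem extWord_perm (w : Fin n → Fin m) (e : Equiv.Perm (Fin n)) :
    extWord E (w ∘ e) = Equiv.Perm.sign e • extWord E w :=
  AlternatingMap.map_perm (ExteriorAlgebra.ιMulti ℤ n) (fun k => basisVec E (w k)) e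

theorem extWord_snoc (j : Fin m) (w : Fin n → Fin m) :
    extWord E (Fin.snoc w j : Fin (n + 1) → Fin m) =
      (-1 : ℤ) ^ n • extWord E (Fin.cons j w : Fin (n + 1) → Fin m) := by
  rw [Fin.snoc_eq_cons_rotate]
  have := extWord_perm (E := E) (Fin.cons j w : Fin (n + 1) → Fin m) (finRotate (n + 1))
  rw [sign_finRotate, Nat.add_sub_cancel, Units.smul_def] at this
  exact this.trans (by simp)

/-- The effect on exterior words of setting the `i`-th basis vector to `0`. -/
theorem map_extWord (i : Fin m) (w : Fin n → Fin m) :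
    ExteriorAlgebra.map ((LinearMap.id : (Fin m → ℤ) →ₗ[ℤ] Fin m → ℤ) -
      (LinearMap.single ℤ (fun _ : Fin m => ℤ) i).comp (LinearMap.proj i)) (extWord E w) =
        extWord (insert i E) w := by
  rw [extWord, ExteriorAlgebra.map_apply_ιMulti, extWord]
  congr 1
  funext k
  rw [Function.comp_apply, basisVec, basisVec]
  by_cases hE : w k ∈ E
  · rw [if_pos hE, if_pos (Finset.mem_insert_of_mem hE), map_zero]
  · by_cases hi : w k = i
    · rw [if_neg hE, if_pos (by rw [hi]; exact Finset.mem_insert_self _ _), hi]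
      simp
    · rw [if_neg hE, if_neg (by rw [Finset.mem_insert]; tauto)]
      simp [Ne.symm hi]

theorem extContract_extWord (hi : i ∈ E) (w : Fin n → Fin m) :
    SimplicialComplexOn.extContract ℤ i (extWord E w) = 0 := by
  induction n with
  | zero => rw [extWord_zero, SimplicialComplexOn.extContract_one]
  | succ n ih =>
    rw [← Fin.cons_self_tail w, extWord_cons, SimplicialComplexOn.extContract_ι_mul, ih, mul_zero,
      sub_zero, basisVec]
    split_ifs with h
    · simp
    · have : i ≠ w 0 := fun h' => h (h' ▸ hi)
      simp [this]

theorem count_le_one_of_injective {w : Fin n → Fin m} (hw : Function.Injective w) (j : Fin m) :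
    (List.ofFn w).count j ≤ 1 :=
  List.nodup_iff_count_le_one.1 (List.nodup_ofFn.2 hw) j

theorem coord_of_injective {w : Fin n → Fin m} (hw : Function.Injective w) {j : Fin m} (hj : j ∉ E)
    (τ : stdSimplex ℝ (Fin (n + 1))) : wordSimplex E w τ j =
      Circle.exp (2 * Real.pi * (1 - letterSup w (fun k => partialSum k τ) j)) := by
  rw [wordSimplex_apply, coord, if_neg hj, (letterSum_of_count (i := j) w _
    fun k => partialSum_le_one k τ).2.1 (count_le_one_of_injective hw j), sub_add_cancel,
    loopDisc_one, Circle.coe_exp]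

theorem wordSimplex_mem_region {w : Fin n → Fin m} (hw : Function.Injective w)
    (τ : stdSimplex ℝ (Fin (n + 1))) : wordSimplex E w τ ∈ region σ E := by
  have h1 : ∀ j, j ∉ E → ‖wordSimplex E w τ j‖ = 1 := fun j hj => by
    rw [coord_of_injective hw hj, Circle.norm_coe]
  refine ⟨fun j hj => ?_, fun j hj => (h1 j hj).le, fun j hj _ => h1 j hj⟩
  rw [wordSimplex_apply, coord, if_pos hj, Complex.ofReal_im]

theorem wordSimplex_insert_apply_of_ne (w : Fin n → Fin m) {j : Fin m} (hj : j ≠ i)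
    (τ : stdSimplex ℝ (Fin (n + 1))) : wordSimplex (insert i E) w τ j = wordSimplex E w τ j := by
  simp only [wordSimplex_apply, coord, Finset.mem_insert, hj, false_or]

theorem wrap_comp_wordSimplex {w : Fin n → Fin m} (hw : Function.Injective w) (hi : i ∉ E) :
    (wrap i).comp (wordSimplex (insert i E) w) = wordSimplex E w := by
  refine ContinuousMap.ext fun τ => funext fun j => ?_
  rw [ContinuousMap.comp_apply]
  by_cases hj : j = i
  · subst hj
    have hmem := Finset.mem_insert_self j E
    have him : (wordSimplex (insert j E) w τ j).im = 0 := by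
      rw [wordSimplex_apply, coord, if_pos hmem, Complex.ofReal_im]
    rw [wrap_same, exp_two_pi_of_im_eq_zero him, coord_of_injective hw hi, wordSimplex_apply, coord,
      if_pos hmem, Complex.ofReal_re]
  · rw [wrap_of_ne hj, wordSimplex_insert_apply_of_ne w hj]

/-- The last face of the lift of a word simplex ends one sheet below the first one. -/
theorem wordSimplex_δ_last_shift {w : Fin n → Fin m} (hi : i ∈ E) (h : ∀ k, w k ≠ i) :
    (wordSimplex E (Fin.snoc w i : Fin (n + 1) → Fin m)).comp
      (simplexMap (SimplexCategory.δ (Fin.last (n + 1)))) =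
        (shift i (-1)).comp (wordSimplex E w) := by
  refine ContinuousMap.ext fun τ => funext fun j => ?_
  rw [ContinuousMap.comp_apply, ContinuousMap.comp_apply]
  by_cases hj : j = i
  · subst hj
    rw [shift_same, wordSimplex_apply, wordSimplex_apply, coord_of_notMem h, coord, if_pos hi,
      letterSup_δ_last]
    simp
  · rw [shift_of_ne hj, wordSimplex_δ_last_apply_of_ne (Ne.symm hj)]

/-- The periods of a cochain, that is, its values on the word simplices, as an element of the exterior
algebra. -/
def period (α : (regionCochains σ E).cx.X n) : ExteriorAlgebra ℤ (Fin m → ℤ) :=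
  ∑ w : Fin n → Fin m, value α (wordSimplex E w) • extWord E w

theorem extContract_period (hi : i ∈ E) (α : (regionCochains σ E).cx.X n) :
    SimplicialComplexOn.extContract ℤ i (period α) = 0 := by
  rw [period, map_sum]
  exact Finset.sum_eq_zero fun w _ => by rw [map_smul, extContract_extWord hi, smul_zero]

/-- The periods of the pull-back to the universal covering of a circle factor. -/
theorem period_wrapPull (hi : i ∉ E) (α : (regionCochains σ E).cx.X n) :
    period ((wrapPull σ hi).f n α) =
      ExteriorAlgebra.map ((LinearMap.id : (Fin m → ℤ) →ₗ[ℤ] Fin m → ℤ) -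
        (LinearMap.single ℤ (fun _ : Fin m => ℤ) i).comp (LinearMap.proj i)) (period α) := by
  rw [period, period, map_sum]
  refine Finset.sum_congr rfl fun w _ => ?_
  rw [map_zsmul, map_extWord]
  by_cases hw : extWord (insert i E) w = 0
  · rw [hw, smul_zero, smul_zero]
  · have hinj := injective_of_extWord_ne_zero hw
    rw [value_wrapPull hi α fun τ => wordSimplex_mem_region hinj τ, wrap_comp_wordSimplex hinj hi]

theorem extWord_insert {w : Fin n → Fin m} (h : ∀ k, w k ≠ i) :
    extWord (insert i E) w = extWord E w := by
  rw [extWord, extWord]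
  congr 1
  funext k
  simp only [basisVec, Finset.mem_insert, h k, false_or]

/-- The connecting map of the unwrapping of the `i`-th circle, in terms of periods: the first and the
last face of a word simplex with the letter `i` at an end, lifted to the covering, differ by a translation.
-/
theorem period_d_wrapPull (hi : i ∉ E) {α : (regionCochains σ E).cx.X (n + 1)}
    {β : (regionCochains σ (insert i E)).cx.X n}
    (h : (regionCochains σ (insert i E)).cx.d n (n + 1) β = (wrapPull σ hi).f (n + 1) α) :
    period α = (-1 : ℤ) ^ n • (ExteriorAlgebra.ι ℤ (Pi.single i 1) *
      period ((shiftPull σ (Finset.mem_insert_self i E) (-1)).f n β - β)) := by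
  have hmem := Finset.mem_insert_self i E
  have h1 : period α = ∑ w, value ((regionCochains σ (insert i E)).cx.d n (n + 1) β)
      (wordSimplex (insert i E) w) • extWord E w := by
    refine Finset.sum_congr rfl fun w _ => ?_
    by_cases hw : extWord E w = 0
    · rw [hw, smul_zero, smul_zero]
    · have hinj := injective_of_extWord_ne_zero hw
      rw [h, value_wrapPull hi α fun τ => wordSimplex_mem_region hinj τ,
        wrap_comp_wordSimplex hinj hi]
  rw [h1, sum_value_d β (fun w => extWord E w)
    (fun w hw => small_region (wordSimplex_mem_region (injective_of_extWord_ne_zero hw)))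
    (fun w k hk => by
      rw [extWord_perm, Equiv.Perm.sign_swap (Fin.castSucc_lt_succ).ne]
      simp)
    (fun w k hk hw => absurd (injective_of_extWord_ne_zero hw hk) (Fin.castSucc_lt_succ).ne)]
  have h2 : ∀ (j : Fin m) (w : Fin n → Fin m),
      value β (wordSimplex (insert i E) w) • extWord E (Fin.cons j w : Fin (n + 1) → Fin m) +
        (-1 : ℤ) ^ (n + 1) • value β ((wordSimplex (insert i E) (Fin.snoc w j : Fin (n + 1) → Fin m)).comp
            (simplexMap (SimplexCategory.δ (Fin.last (n + 1))))) •
              extWord E (Fin.snoc w j : Fin (n + 1) → Fin m) =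
      if j = i then - (ExteriorAlgebra.ι ℤ (Pi.single i 1) *
        (value ((shiftPull σ hmem (-1)).f n β - β) (wordSimplex (insert i E) w) •
          extWord (insert i E) w)) else 0 := by
    intro j w
    rw [extWord_snoc]
    by_cases hw : extWord E (Fin.cons j w : Fin (n + 1) → Fin m) = 0
    · rw [hw, smul_zero, smul_zero, smul_zero, smul_zero, add_zero]
      split_ifs with hj
      · subst hj
        by_cases hjw : ∃ k, w k = j
        · obtain ⟨k, hk⟩ := hjw
          by_cases hw' : extWord (insert j E) w = 0
          · rw [hw', smul_zero, mul_zero, neg_zero]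
          · exact absurd (hk ▸ hmem) (notMem_of_extWord_ne_zero hw' k)
        · push Not at hjw
          rw [extWord_cons, basisVec, if_neg hi] at hw
          rw [extWord_insert hjw, mul_smul_comm, hw, smul_zero, neg_zero]
      · rfl
    · have hinj := injective_of_extWord_ne_zero hw
      have hjw : ∀ k, w k ≠ j := fun k hk => by
        have := @hinj k.succ 0 (by rw [Fin.cons_succ, Fin.cons_zero, hk])
        exact Fin.succ_ne_zero k this
      have hinj' : Function.Injective w := fun a b hab =>
        Fin.succ_injective _ (hinj (by rw [Fin.cons_succ, Fin.cons_succ, hab]))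
      have hjE : j ∉ E := by simpa using notMem_of_extWord_ne_zero hw 0
      have hs : ∀ a : ExteriorAlgebra ℤ (Fin m → ℤ), ∀ r : ℤ,
          (-1 : ℤ) ^ (n + 1) • r • (-1 : ℤ) ^ n • a = -(r • a) := by
        intro a r
        rcases neg_one_pow_eq_or ℤ n with h | h <;> simp [pow_succ, h]
      rw [hs]
      split_ifs with hj
      · subst hj
        rw [wordSimplex_δ_last_shift hmem hjw, extWord_cons, basisVec, if_neg hi,
          extWord_insert hjw, value_sub, value_shiftPull hmem _ _ (wordSimplex_mem_region hinj'),
          mul_smul_comm, ← sub_eq_add_neg, ← sub_smul, ← neg_smul, neg_sub]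
      · rw [wordSimplex_δ_last (by rw [Finset.mem_insert]; tauto) w hjw, add_neg_cancel]
  have h3 := Finset.sum_congr (rfl : (Finset.univ : Finset (Fin m)) = _) fun j _ =>
    Finset.sum_congr (rfl : (Finset.univ : Finset (Fin n → Fin m)) = _) fun w _ => h2 j w
  simp only [Finset.sum_add_distrib, ← Finset.smul_sum] at h3
  rw [h3, Finset.sum_comm]
  simp only [Finset.sum_ite_eq', Finset.mem_univ, if_true]
  rw [Finset.sum_neg_distrib, ← Finset.mul_sum, smul_neg, neg_smul, neg_neg]
  rfl

end

end MomentAngle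

namespace MomentAngle

open SingularCochains

noncomputable section

variable {m n : ℕ} {σ E : Finset (Fin m)} {i : Fin m}

theorem isCoboundary_of_contractible (h : ∀ i, i ∉ E → i ∈ σ)
    {α : (regionCochains σ E).cx.X n} (hα : (regionCochains σ E).cx.d n (n + 1) α = 0)
    (hp : period α = 0) : IsCoboundary (regionCochains σ E).cx n α := by
  let F : C((Fin m → ℂ) × ℝ, Fin m → ℂ) :=
    ⟨fun p i => (1 - (p.2 : ℂ)) * p.1 i + p.2, by fun_prop⟩
  have hF : ∀ z ∈ region σ E, ∀ t ∈ Set.Icc (0 : ℝ) 1, F (z, t) ∈ region σ E := by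
    intro z hz t ht
    refine ⟨fun i hi => ?_, fun i hi => ?_, fun i hi hi' => absurd (h i hi) hi'⟩
    · change ((1 - (t : ℂ)) * z i + t).im = 0
      simp [hz.1 i hi]
    · change ‖(1 - (t : ℂ)) * z i + t‖ ≤ 1
      have h1 : ‖(1 - (t : ℂ))‖ = 1 - t := by
        rw [← Complex.ofReal_one, ← Complex.ofReal_sub, Complex.norm_real, Real.norm_eq_abs,
          abs_of_nonneg (by linarith [ht.2])]
      have h2 : ‖(t : ℂ)‖ = t := by rw [Complex.norm_real, Real.norm_eq_abs, abs_of_nonneg ht.1]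
      refine (norm_add_le _ _).trans ?_
      rw [norm_mul, h1, h2]
      nlinarith [hz.2.1 i hi, ht.1, ht.2]
  have hone : (1 : Fin m → ℂ) ∈ region σ E :=
    ⟨fun _ _ => by simp, fun _ _ => by simp, fun _ _ _ => by simp⟩
  have hid : ∀ U ∈ ({region σ E} : Set (Set (Fin m → ℂ))), ∃ V ∈ ({region σ E} : Set (Set (Fin m → ℂ))),
      Set.MapsTo (ContinuousMap.id (Fin m → ℂ)) U V := fun U hU => ⟨U, hU, Set.mapsTo_id U⟩
  have hconst : ∀ U ∈ ({region σ E} : Set (Set (Fin m → ℂ))),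
      ∃ V ∈ ({region σ E} : Set (Set (Fin m → ℂ))),
      Set.MapsTo (ContinuousMap.const (Fin m → ℂ) (1 : Fin m → ℂ)) U V :=
    fun U _ => ⟨_, rfl, fun _ _ => hone⟩
  have key := isCoboundary_of_homotopy F (by rintro _ rfl; exact ⟨_, rfl, hF⟩) hid hconst
    (fun z => funext fun i => by change (1 - ((0 : ℝ) : ℂ)) * z i + (0 : ℝ) = z i; simp)
    (fun z => funext fun i => by change (1 - ((1 : ℝ) : ℂ)) * z i + (1 : ℝ) = 1; simp) α hα
  have e1 : (pull ℤ (smallMap (ContinuousMap.id (Fin m → ℂ)) hid)).f n α = α :=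
    toFun_injective (funext fun _ => rfl)
  have e2 : (pull ℤ (smallMap (ContinuousMap.const (Fin m → ℂ) (1 : Fin m → ℂ)) hconst)).f n α = 0 := by
    refine region_ext fun x hx => ?_
    rw [value_map _ _ _ (small_region hx), value_zero]
    obtain _ | n := n
    · have hw : ∀ w : Fin 0 → Fin m,
          (ContinuousMap.const (Fin m → ℂ) (1 : Fin m → ℂ)).comp x = wordSimplex E w := fun w =>
        ContinuousMap.ext fun τ => funext fun j =>
          (coord_of_notMem (w := w) (E := E) fun k => k.elim0).symm
      have hp' : value α (wordSimplex E (Fin.elim0 : Fin 0 → Fin m)) •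
          (1 : ExteriorAlgebra ℤ (Fin m → ℤ)) = 0 := by
        rw [← hp, period, Fintype.sum_unique, extWord_zero]
        congr 3
      rw [hw Fin.elim0]
      have := congrArg (ExteriorAlgebra.algebraMapInv (R := ℤ) (M := Fin m → ℤ)) hp'
      simpa using this
    · exact value_degenerate α 0 (ContinuousMap.ext fun _ => rfl)
  rwa [e1, e2, sub_zero] at key

/-- A cocycle without periods is a coboundary. -/
theorem isCoboundary_of_period_eq_zero {α : (regionCochains σ E).cx.X n}
    (hα : (regionCochains σ E).cx.d n (n + 1) α = 0) (hp : period α = 0) :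
    IsCoboundary (regionCochains σ E).cx n α := by
  induction hN : (σ ∪ E)ᶜ.card generalizing E n with
  | zero =>
    refine isCoboundary_of_contractible (fun i hi => ?_) hα hp
    have : i ∈ σ ∪ E := by
      by_contra h
      have h' : i ∈ (σ ∪ E)ᶜ := Finset.mem_compl.2 h
      rw [Finset.card_eq_zero.1 hN] at h'
      exact Finset.notMem_empty _ h'
    exact (Finset.mem_union.1 this).resolve_right hi
  | succ N ih =>
    obtain ⟨i, hi⟩ : (σ ∪ E)ᶜ.Nonempty := by rw [← Finset.card_pos]; omega
    rw [Finset.mem_compl, Finset.mem_union, not_or] at hi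
    obtain ⟨hσ, hE⟩ := hi
    have hmem := Finset.mem_insert_self i E
    have hN' : (σ ∪ insert i E)ᶜ.card = N := by
      have : (σ ∪ E)ᶜ = insert i (σ ∪ insert i E)ᶜ := by
        ext j
        simp only [Finset.mem_compl, Finset.mem_union, Finset.mem_insert]
        by_cases h : j = i
        · subst h; tauto
        · tauto
      rw [this, Finset.card_insert_of_notMem (by simp)] at hN
      omega
    have h1 : IsCoboundary (regionCochains σ (insert i E)).cx n ((wrapPull σ hE).f n α) := by
      refine ih ?_ ?_ hN'
      · rw [← hom_d_apply, hα, map_zero]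
      · rw [period_wrapPull, hp, map_zero]
    obtain _ | n := n
    · have h2 : α = 0 := wrapPull_injective hE hσ (by rw [isCoboundary_degree_zero h1, map_zero])
      rw [h2]
      exact isCoboundary_zero 0
    · obtain ⟨β, hβ⟩ := isCoboundary_succ h1
      have h2 : (regionCochains σ (insert i E)).cx.d n (n + 1)
          ((shiftPull σ hmem (-1)).f n β - β) = 0 := by
        rw [map_sub, ← hom_d_apply, hβ, shiftPull_wrapPull, sub_self]
      have h3 : period ((shiftPull σ hmem (-1)).f n β - β) = 0 := by
        have h4 := period_d_wrapPull hE hβ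
        rw [hp] at h4
        have h5 := congrArg (SimplicialComplexOn.extContract ℤ i) h4.symm
        rw [map_smul, SimplicialComplexOn.extContract_ι_mul, extContract_period hmem, mul_zero,
          sub_zero, Pi.single_eq_same, one_smul, map_zero] at h5
        rcases neg_one_pow_eq_or ℤ n with h | h <;> simpa [h] using h5
      obtain ⟨l, η, hη⟩ := ih h2 h3 hN'
      obtain ⟨ζ, hζ⟩ := exists_shiftPull_sub hmem η
      -- Correcting `β` by a coboundary makes it invariant under translations.
      obtain ⟨γ, hγ⟩ := exists_wrapPull_eq hE hσ
        (β := β - (regionCochains σ (insert i E)).cx.d l n ζ) (by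
          rw [← hζ, map_sub, ← hom_d_apply] at hη
          rw [map_sub, sub_eq_sub_iff_sub_eq_sub]
          exact hη.symm)
      refine ⟨n, γ, wrapPull_injective hE hσ ?_⟩
      rw [hom_d_apply, hγ, map_sub, d_d_apply, sub_zero, hβ]

/-- Every circle factor carries a cocycle whose period is the corresponding basis vector. -/
theorem exists_cocycle_period (hσ : i ∉ σ) : ∃ α : (regionCochains σ ∅).cx.X 1,
    (regionCochains σ ∅).cx.d 1 2 α = 0 ∧ period α = ExteriorAlgebra.ι ℤ (Pi.single i 1) := by
  have hE : i ∉ (∅ : Finset (Fin m)) := Finset.notMem_empty i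
  have hmem := Finset.mem_insert_self i ∅
  obtain ⟨ζ, hζ⟩ := exists_shiftPull_sub (σ := σ) hmem (regionCochains σ (insert i ∅)).one
  have h1 : (regionCochains σ (insert i ∅)).cx.d 0 1 (regionCochains σ (insert i ∅)).one = 0 := by
    refine region_ext fun x hx => ?_
    rw [value_zero, value_d _ (small_region hx)]
    have : ∀ y : C(stdSimplex ℝ (Fin 1), Fin m → ℂ), (∀ τ, y τ ∈ region σ (insert i ∅)) →
        value (regionCochains σ (insert i ∅)).one y = 1 := fun y hy => by
      rw [value_of_mem _ (small_region hy), toFun_one]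
    rw [Fin.sum_univ_two, this _ fun τ => hx _, this _ fun τ => hx _]
    simp
  obtain ⟨α, hα⟩ := exists_wrapPull_eq hE hσ (n := 1)
    (β := (regionCochains σ (insert i ∅)).cx.d 0 1 ζ) (by
      rw [hom_d_apply, ← sub_eq_zero, ← map_sub, hζ, h1])
  refine ⟨α, wrapPull_injective hE hσ ?_, ?_⟩
  · rw [hom_d_apply, hα, d_d_apply, map_zero]
  · rw [period_d_wrapPull hE hα.symm, hζ, pow_zero, one_smul]
    have : period (regionCochains σ (insert i ∅)).one = 1 := by
      rw [period, Fintype.sum_unique, extWord_zero, value_of_mem _ (small_region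
        (wordSimplex_mem_region (Function.injective_of_subsingleton _))), toFun_one, one_smul]
    rw [this, mul_one]

end

end MomentAngle

/-! ### The augmentation to the exterior algebra -/

namespace SimplicialComplexOn

noncomputable section

variable {R : Type} [CommRing R] {m n : ℕ} {K : SimplicialComplexOn m}

/-- The augmentation of the Stanley-Reisner ring, which sends all variables to `0`. -/
def srAug (R : Type) [CommRing R] (K : SimplicialComplexOn m) : K.StanleyReisnerRing R →ₐ[R] R :=
  Ideal.Quotient.liftₐ (K.stanleyReisnerIdeal R) (MvPolynomial.aeval (0 : Fin m → R)) (by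
    suffices K.stanleyReisnerIdeal R ≤ RingHom.ker (MvPolynomial.aeval (0 : Fin m → R)) from
      fun a ha => this ha
    refine Ideal.span_le.2 ?_
    rintro _ ⟨σ, hσ, rfl⟩
    rw [SetLike.mem_coe, RingHom.mem_ker, map_prod]
    obtain ⟨i, hi⟩ : σ.Nonempty := by
      rw [Finset.nonempty_iff_ne_empty]
      rintro rfl
      exact hσ K.empty_mem
    exact Finset.prod_eq_zero hi (by simp))

theorem srAug_srVar (i : Fin m) : K.srAug R (K.srVar R i) = 0 :=
  (MvPolynomial.aeval_X (0 : Fin m → R) i).trans rfl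

theorem srAug_tmon (a : Fin m →₀ ℕ) : K.srAug R (K.tmon R a) = if a = 0 then 1 else 0 := by
  change MvPolynomial.aeval (0 : Fin m → R) (MvPolynomial.monomial a (1 : R)) = _
  split_ifs with h
  · subst h
    simp
  · obtain ⟨i, hi⟩ := Finsupp.ne_iff.1 h
    rw [MvPolynomial.aeval_monomial, Finsupp.prod,
      Finset.prod_eq_zero (Finsupp.mem_support_iff.2 hi) (zero_pow hi), mul_zero]

theorem srAug_commute (f : K.StanleyReisnerRing R) (w : ExteriorAlgebra R (Fin m → R)) :
    Commute (((Algebra.ofId R (ExteriorAlgebra R (Fin m → R))).comp (K.srAug R)) f)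
      (AlgHom.id R (ExteriorAlgebra R (Fin m → R)) w) :=
  Algebra.commutes (K.srAug R f) w

/-- The homomorphism from `A(K)` to the exterior algebra that sends all `t i` to `0`. -/
def augA (R : Type) [CommRing R] (K : SimplicialComplexOn m) :
    K.ARing R →ₐ[R] ExteriorAlgebra R (Fin m → R) :=
  Algebra.TensorProduct.lift ((Algebra.ofId R _).comp (K.srAug R)) (AlgHom.id R _)
    srAug_commute

theorem augA_tmul (f : K.StanleyReisnerRing R) (w : ExteriorAlgebra R (Fin m → R)) :
    K.augA R (f ⊗ₜ w) = K.srAug R f • w := by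
  rw [augA, Algebra.TensorProduct.lift_tmul, Algebra.smul_def]
  rfl

theorem augA_t (i : Fin m) : K.augA R (K.t R i) = 0 := by rw [t, augA_tmul, srAug_srVar, zero_smul]

theorem augA_s (i : Fin m) : K.augA R (K.s R i) = extGen R i := by
  rw [s, augA_tmul, map_one, one_smul, extGen]

theorem augA_idealB {x : K.ARing R} (hx : x ∈ K.idealB R) : K.augA R x = 0 :=
  idealB_le (P := (K.augA R).toLinearMap.toAddMonoidHom.ker)
    (fun i x => by
      change K.augA R (K.t R i * (K.t R i * x)) = 0
      rw [map_mul, augA_t, zero_mul])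
    (fun i x => by
      change K.augA R (K.s R i * (K.t R i * x)) = 0
      rw [map_mul, map_mul, augA_t, zero_mul, mul_zero]) hx

theorem augA_dA (x : K.ARing R) : K.augA R (K.dA R x) = 0 := by
  rw [dA_eq_sum, map_sum]
  exact Finset.sum_eq_zero fun i _ => by rw [map_mul, augA_t, zero_mul]

/-- The homomorphism from `B(K)` to the exterior algebra that sends all `t i` to `0`. -/
def augB (R : Type) [CommRing R] (K : SimplicialComplexOn m) :
    K.BRing R →+* ExteriorAlgebra R (Fin m → R) :=
  Ideal.Quotient.lift (K.idealB R) (K.augA R).toRingHom fun _ hx => augA_idealB hx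

theorem augB_bMk (x : K.ARing R) : K.augB R (K.bMk R x) = K.augA R x := rfl

theorem augB_dB (x : K.BRing R) : K.augB R (K.dB R x) = 0 := by
  obtain ⟨x, rfl⟩ := K.bMk_surjective x
  exact augA_dA x

theorem augB_of_isCoboundary {b : (dgaB R K).cx.X n} (hb : IsCoboundary (dgaB R K).cx n b) :
    K.augB R (valB b) = 0 := by
  obtain _ | n := n
  · rw [isCoboundary_degree_zero hb, map_zero, map_zero]
  · obtain ⟨c, rfl⟩ := isCoboundary_succ hb
    rw [valB_d, augB_dB]

theorem augA_mem {x : K.ARing R} (hx : x ∈ K.gradeA R n) :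
    K.augA R x ∈ ⋀[R]^n (Fin m → R) := by
  suffices K.gradeA R n ≤ (⋀[R]^n (Fin m → R)).comap (K.augA R).toLinearMap from this hx
  rw [gradeA_eq_span]
  refine Submodule.span_le.2 ?_
  rintro _ ⟨a, j, h, w, hw, rfl⟩
  rw [SetLike.mem_coe, Submodule.mem_comap, AlgHom.toLinearMap_apply, augA_tmul, srAug_tmon]
  split_ifs with ha
  · subst ha
    obtain rfl : j = n := by simpa using h
    rwa [one_smul]
  · rw [zero_smul]
    exact Submodule.zero_mem _

/-- Setting the generators in a list to `0` in the exterior algebra. -/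
def extKill (R : Type) [CommRing R] (l : List (Fin m)) :
    ExteriorAlgebra R (Fin m → R) →ₗ[R] ExteriorAlgebra R (Fin m → R) :=
  l.foldr (fun i f => f ∘ₗ extContract R i ∘ₗ LinearMap.mulLeft R (extGen R i)) LinearMap.id

theorem extKill_nil (w : ExteriorAlgebra R (Fin m → R)) : extKill R [] w = w := rfl

theorem extKill_cons (i : Fin m) (l : List (Fin m)) (w : ExteriorAlgebra R (Fin m → R)) :
    extKill R (i :: l) w = extKill R l (extContract R i (extGen R i * w)) := rfl

theorem extKill_gen_mul_of_notMem {i : Fin m} {l : List (Fin m)} (h : i ∉ l)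
    (w : ExteriorAlgebra R (Fin m → R)) :
    extKill R l (extGen R i * w) = extGen R i * extKill R l w := by
  induction l generalizing w with
  | nil => rfl
  | cons j l ih =>
    rw [List.mem_cons, not_or] at h
    rw [extKill_cons, extGen_mul_comm, map_neg, extContract_gen_mul_of_ne (Ne.symm h.1), neg_neg,
      ih h.2, extKill_cons]

theorem extKill_gen_mul_of_mem {i : Fin m} {l : List (Fin m)} (h : i ∈ l)
    (w : ExteriorAlgebra R (Fin m → R)) : extKill R l (extGen R i * w) = 0 := by
  induction l generalizing w with
  | nil => simp at h
  | cons j l ih =>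
    rw [extKill_cons]
    by_cases hij : i = j
    · subst hij
      rw [extGen_mul_self, map_zero, map_zero]
    · rw [extGen_mul_comm, map_neg, extContract_gen_mul_of_ne (Ne.symm hij), neg_neg,
        ih ((List.mem_cons.1 h).resolve_left hij)]

theorem truncList_zero_tmon (l : List (Fin m)) (a : Fin m →₀ ℕ)
    (w : ExteriorAlgebra R (Fin m → R)) : K.truncList R 0 l (K.tmon R a ⊗ₜ w) =
      if ∀ i ∈ l, a i = 0 then K.tmon R a ⊗ₜ extKill R l w else 0 := by
  induction l generalizing w with
  | nil => simp [truncList_nil, extKill_nil]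
  | cons j l ih =>
    rw [truncList_cons, truncA_tmon, if_neg (Nat.not_lt_zero _)]
    by_cases hj : a j = 0
    · rw [if_pos hj, ih, extKill_cons]
      simp [hj]
    · rw [if_neg hj, map_zero, if_neg (by simp [hj])]

/-- The full simplex on `σ`. -/
def fullSimplex (σ : Finset (Fin m)) : SimplicialComplexOn m where
  faces := {τ | τ ⊆ σ}
  empty_mem := Finset.empty_subset σ
  down_closed h h' := h'.trans h

variable {σ : Finset (Fin m)}

theorem truncList_fullSimplex (x : (fullSimplex σ).ARing R) :
    (fullSimplex σ).truncList R 0 σ.toList x =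
      1 ⊗ₜ extKill R σ.toList ((fullSimplex σ).augA R x) := by
  suffices (fullSimplex σ).truncList R 0 σ.toList = TensorProduct.mk R _ _ 1 ∘ₗ
    extKill R σ.toList ∘ₗ ((fullSimplex σ).augA R).toLinearMap from LinearMap.congr_fun this x
  refine A_hom_ext fun a w => ?_
  simp only [LinearMap.comp_apply, AlgHom.toLinearMap_apply, TensorProduct.mk_apply, augA_tmul,
    truncList_zero_tmon, srAug_tmon, Finset.mem_toList]
  by_cases ha : a = 0
  · subst ha
    simp [tmon_zero]
  · rw [if_neg ha, zero_smul, map_zero, TensorProduct.tmul_zero]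
    split_ifs with h
    · rw [tmon_eq_zero, TensorProduct.zero_tmul]
      intro hs
      refine ha (Finsupp.ext fun i => ?_)
      by_contra hi
      exact hi (h i (hs (Finsupp.mem_support_iff.2 hi)))
    · rfl

/-- For the full simplex, a cocycle of `B` is determined up to coboundaries by its image in the exterior
algebra on the generators outside `σ`. -/
theorem isCoboundary_of_extKill_augB {b : (dgaB R (fullSimplex σ)).cx.X n}
    (hb : (dgaB R (fullSimplex σ)).cx.d n (n + 1) b = 0)
    (h : extKill R σ.toList ((fullSimplex σ).augB R (valB b)) = 0) :
    IsCoboundary (dgaB R (fullSimplex σ)).cx n b := by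
  obtain ⟨x, hx, hxb⟩ := valB_mem b
  have h1 : ∀ i ∈ List.finRange m, (fullSimplex σ).CanDivide i 1 := fun i _ => canDivide_one i
  -- `truncList` lifts the cocycle to a cocycle of `A`
  set a := (fullSimplex σ).truncList R 1 (List.finRange m) x with ha
  have hab : (fullSimplex σ).bMk R a = valB b := (bMk_truncList _ _).trans hxb
  have hd : (fullSimplex σ).dA R a = 0 := by
    rw [ha, ← truncList_dA 1 _ h1]
    refine truncList_idealB (bMk_eq_zero_iff.1 ?_)
    rw [← dB_bMk]
    have := congrArg valB hb
    rw [valB_d, map_zero, ← hxb] at this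
    exact this
  have h0 : ∀ i ∈ σ.toList, (fullSimplex σ).CanDivide i 0 := fun i hi =>
    Or.inr fun τ hτ => Finset.insert_subset (Finset.mem_toList.1 hi) hτ
  obtain ⟨H, H1, H2, H3⟩ := exists_truncList_homotopy (R := R) 0 σ.toList h0
  have h3 := H3 a
  rw [← hab, augB_bMk] at h
  rw [truncList_fullSimplex, h, TensorProduct.tmul_zero, sub_zero, hd, map_zero, add_zero] at h3
  have hmem : a ∈ (fullSimplex σ).gradeA R n := truncList_mem 1 _ h1 hx
  obtain _ | n := n
  · have : b = 0 := valB_injective (by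
      rw [← hab, h3, H2 _ hmem, map_zero, map_zero, map_zero])
    rw [this]
    exact isCoboundary_zero 0
  · obtain ⟨c, hc⟩ := exists_valB (K := fullSimplex σ) ⟨_, H1 _ _ hmem, rfl⟩
    refine ⟨n, c, valB_injective ?_⟩
    rw [valB_d, hc, ← hab]
    exact congrArg ((fullSimplex σ).bMk R) h3.symm

end

end SimplicialComplexOn

/-! ### The comparison map is a quasi-isomorphism -/

namespace MomentAngle

open SingularCochains SimplicialComplexOn

noncomputable section

variable {m n : ℕ} {K : SimplicialComplexOn m} {σ : Finset (Fin m)}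

theorem augA_listMono (w : Fin n → Fin m) :
    K.augA ℤ (K.listMono ℤ (List.ofFn w)) = extWord ∅ w := by
  induction n with
  | zero => rw [List.ofFn_zero, listMono_nil, map_one, extWord_zero]
  | succ n ih =>
    rw [List.ofFn_succ, listMono_cons, letterOp_apply, map_add, map_mul, map_mul, augA_t, zero_mul,
      add_zero, augA_s, ih]
    conv_rhs => rw [← Fin.cons_self_tail w, extWord_cons, basisVec, if_neg (Finset.notMem_empty _)]
    rfl

theorem polydiscs_fullSimplex_le : ∀ U ∈ polydiscs (fullSimplex σ),
    ∃ V ∈ ({region σ ∅} : Set (Set (Fin m → ℂ))), U ⊆ V := by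
  rintro _ ⟨τ, hτ, rfl⟩
  exact ⟨_, rfl, fun z hz => ⟨fun i hi => absurd hi (Finset.notMem_empty i),
    fun i _ => mem_closedBall_zero_iff.1 (hz.1 i),
    fun i _ hi => mem_sphere_zero_iff_norm.1 (hz.2 i fun h => hi (hτ h))⟩⟩

theorem le_polydiscs_fullSimplex : ∀ U ∈ ({region σ ∅} : Set (Set (Fin m → ℂ))),
    ∃ V ∈ polydiscs (fullSimplex σ), U ⊆ V := by
  rintro _ rfl
  exact ⟨_, ⟨σ, Finset.Subset.refl σ, rfl⟩, fun z hz =>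
    ⟨fun i => mem_closedBall_zero_iff.2 (hz.2.1 i (Finset.notMem_empty i)),
      fun i hi => mem_sphere_zero_iff_norm.2 (hz.2.2 i (Finset.notMem_empty i) hi)⟩⟩

/-- Restriction of cochains on the polydisc to the simplices lying in a smaller polydisc; this is an
isomorphism because the largest polydisc belongs to the family. -/
def polydiscPull (σ : Finset (Fin m)) :
    (regionCochains σ ∅).cx ⟶ (dga ℤ (small (polydiscs (fullSimplex σ)))).cx :=
  pull ℤ (smallIncl polydiscs_fullSimplex_le)

theorem exists_polydiscPull_eq (γ : (dga ℤ (small (polydiscs (fullSimplex σ)))).cx.X n) :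
    ∃ α, (polydiscPull σ).f n α = γ ∧
      ((dga ℤ (small (polydiscs (fullSimplex σ)))).cx.d n (n + 1) γ = 0 →
        (regionCochains σ ∅).cx.d n (n + 1) α = 0) := by
  refine ⟨(pull ℤ (smallIncl le_polydiscs_fullSimplex)).f n γ,
    toFun_injective (funext fun _ => rfl), fun h => ?_⟩
  rw [← hom_d_apply, h, map_zero]

theorem augB_wordSum_polydiscPull (α : (regionCochains σ ∅).cx.X n) :
    (fullSimplex σ).augB ℤ (wordSum (fullSimplex σ) ((polydiscPull σ).f n α)) =
      sgn n • period α := by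
  rw [wordSum, map_zsmul, map_sum, period]
  congr 1
  refine Finset.sum_congr rfl fun w _ => ?_
  rw [map_zsmul, augB_bMk, augA_listMono]
  by_cases hw : extWord ∅ w = 0
  · rw [hw, smul_zero, smul_zero]
  · have hinj := injective_of_extWord_ne_zero hw
    refine congrArg (· • extWord ∅ w) (value_incl _ _ ?_)
    obtain ⟨V, hV, h⟩ := le_polydiscs_fullSimplex (region σ ∅) rfl
    exact ⟨V, hV, fun τ => h (wordSimplex_mem_region hinj τ)⟩

/-- The elements of the exterior algebra that, up to the generators in `σ`, come from cocycles. -/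
def cocycleImage (σ : Finset (Fin m)) (n : ℕ) : AddSubgroup (ExteriorAlgebra ℤ (Fin m → ℤ)) where
  carrier := {x | ∃ γ : (dga ℤ (small (polydiscs (fullSimplex σ)))).cx.X n,
    (dga ℤ (small (polydiscs (fullSimplex σ)))).cx.d n (n + 1) γ = 0 ∧
      extKill ℤ σ.toList ((fullSimplex σ).augB ℤ (wordSum (fullSimplex σ) γ)) =
        extKill ℤ σ.toList x}
  zero_mem' := ⟨0, map_zero _, by
    have : wordSum (fullSimplex σ) (0 : (dga ℤ (small (polydiscs (fullSimplex σ)))).cx.X n) = 0 := by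
      rw [← valB_comparison, map_zero, map_zero]
    rw [this, map_zero]⟩
  add_mem' := by
    rintro x y ⟨γ, hγ, hx⟩ ⟨γ', hγ', hy⟩
    exact ⟨γ + γ', by rw [map_add, hγ, hγ', add_zero], by
      rw [wordSum_add, map_add, map_add, hx, hy, map_add]⟩
  neg_mem' := by
    rintro x ⟨γ, hγ, hx⟩
    refine ⟨-γ, by rw [map_neg, hγ, neg_zero], ?_⟩
    have : wordSum (fullSimplex σ) (-γ) = -wordSum (fullSimplex σ) γ := by
      rw [← valB_comparison, ← valB_comparison, map_neg, map_neg]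
    rw [this, map_neg, map_neg, map_neg, hx]

theorem gen_mul_mem_cocycleImage (i : Fin m) {x : ExteriorAlgebra ℤ (Fin m → ℤ)}
    (hx : x ∈ cocycleImage σ n) : extGen ℤ i * x ∈ cocycleImage σ (n + 1) := by
  by_cases hi : i ∈ σ
  · have h0 := (cocycleImage σ (n + 1)).zero_mem
    obtain ⟨γ, hγ, h⟩ := h0
    exact ⟨γ, hγ, by rw [h, extKill_gen_mul_of_mem (Finset.mem_toList.2 hi), map_zero]⟩
  · have hi' : i ∉ σ.toList := fun h => hi (Finset.mem_toList.1 h)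
    obtain ⟨γ, hγ, h⟩ := hx
    obtain ⟨α, hα, hp⟩ := exists_cocycle_period hi
    have hα' : (dga ℤ (small (polydiscs (fullSimplex σ)))).cx.d 1 2 ((polydiscPull σ).f 1 α) = 0 := by
      rw [← hom_d_apply, hα, map_zero]
    have hs : sgn 1 = -1 := by rw [sgn_succ, sgn_zero]; rfl
    rw [← neg_neg (extGen ℤ i * x)]
    refine (cocycleImage σ (n + 1)).neg_mem
      ⟨(dga ℤ (small (polydiscs (fullSimplex σ)))).mul (add_comm 1 n) ((polydiscPull σ).f 1 α) γ, ?_, ?_⟩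
    · rw [DGA.leibniz _ (add_comm 1 n) (by omega) (by omega), hα', hγ, map_zero, map_zero,
        LinearMap.zero_apply, smul_zero, add_zero]
    · rw [wordSum_mul, map_mul, augB_wordSum_polydiscPull, hp, hs, neg_smul, one_smul, neg_mul,
        map_neg, map_neg]
      congr 1
      refine (extKill_gen_mul_of_notMem hi' _).trans ?_
      rw [h, extKill_gen_mul_of_notMem hi']

theorem exteriorPower_le_cocycleImage {x : ExteriorAlgebra ℤ (Fin m → ℤ)}
    (hx : x ∈ ⋀[ℤ]^n (Fin m → ℤ)) : x ∈ cocycleImage σ n := by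
  induction n generalizing x with
  | zero =>
    rw [ExteriorAlgebra.exteriorPower, pow_zero] at hx
    obtain ⟨r, rfl⟩ := Submodule.mem_one.1 hx
    rw [Algebra.algebraMap_eq_smul_one]
    suffices h1 : 1 ∈ cocycleImage σ 0 from AddSubgroup.zsmul_mem _ h1 r
    refine ⟨(dga ℤ (small (polydiscs (fullSimplex σ)))).one, ?_, ?_⟩
    · have := (dga ℤ (small (polydiscs (fullSimplex σ)))).leibniz (add_zero 0) rfl rfl
        (dga ℤ (small (polydiscs (fullSimplex σ)))).one (dga ℤ (small (polydiscs (fullSimplex σ)))).one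
      rw [DGA.mul_one, DGA.mul_one, DGA.one_mul, pow_zero] at this
      exact left_eq_add.1 (this.trans (congrArg (_ + ·) (one_smul ℤ _)))
    · rw [wordSum_one, map_one]
  | succ n ih =>
    rw [ExteriorAlgebra.exteriorPower, pow_succ'] at hx
    induction hx using Submodule.mul_induction_on' with
    | mem_mul_mem v hv y hy =>
      obtain ⟨v, rfl⟩ := hv
      have hv : v = ∑ i, v i • (Pi.single i 1 : Fin m → ℤ) := by
        funext j
        simp [Finset.sum_apply, Pi.single_apply]
      rw [hv, map_sum, Finset.sum_mul]
      refine AddSubgroup.sum_mem _ fun i _ => ?_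
      rw [map_smul, smul_mul_assoc]
      exact AddSubgroup.zsmul_mem _ (gen_mul_mem_cocycleImage i (ih hy)) _
    | add x _ y _ hx hy => exact AddSubgroup.add_mem _ hx hy

/-- The comparison map for a full simplex. -/
theorem comparison_fullSimplex (σ : Finset (Fin m)) :
    InducesIso (comparison (fullSimplex σ)).toHom where
  inj n γ hγ hc := by
    obtain ⟨α, rfl, hα⟩ := exists_polydiscPull_eq γ
    have h1 := augB_of_isCoboundary hc
    rw [valB_comparison, augB_wordSum_polydiscPull] at h1
    have h2 : sgn n * sgn n = 1 := by
      rw [sgn, ← Finset.prod_mul_distrib]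
      exact Finset.prod_eq_one fun i _ => by rw [← mul_pow]; simp
    have h3 : period α = 0 := by
      rw [← one_smul ℤ (period α), ← h2, mul_smul, h1, smul_zero]
    exact (isCoboundary_of_period_eq_zero (hα hγ) h3).map (polydiscPull σ)
  surj n b hb := by
    have h1 : (fullSimplex σ).augB ℤ (valB b) ∈ ⋀[ℤ]^n (Fin m → ℤ) := by
      obtain ⟨x, hx, hxb⟩ := valB_mem b
      rw [← hxb]
      exact augA_mem hx
    obtain ⟨γ, hγ, h⟩ := exteriorPower_le_cocycleImage (σ := σ) h1
    refine ⟨γ, hγ, isCoboundary_of_extKill_augB ?_ ?_⟩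
    · rw [map_sub, ← hom_d_apply, hγ, map_zero, hb, sub_zero]
    · rw [map_sub, map_sub, map_sub, valB_comparison, h, sub_self]

theorem comparison_comm {K L : SimplicialComplexOn m} (h : L ≤ K) :
    pull ℤ (smallIncl (polydiscs_mono h)) ≫ (comparison L).toHom =
      (comparison K).toHom ≫ ((functorB ℤ m).map (homOfLE h).op).toHom :=
  HomologicalComplex.hom_ext _ _ fun _ => ModuleCat.hom_ext (LinearMap.ext fun γ =>
    Subtype.ext (bRestrict_wordSum h γ))

/-- The general case follows from that of full simplices by removing a maximal face: this writes a
complex as the union of two smaller ones, with a smaller intersection. -/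
theorem comparison_inducesIso (K : SimplicialComplexOn m) : InducesIso (comparison K).toHom := by
  induction hN : K.faces.ncard using Nat.strong_induction_on generalizing K with
  | _ N ih =>
    subst hN
    obtain ⟨σ, hσ, hmax⟩ := (Set.toFinite K.faces).exists_maximal ⟨∅, K.empty_mem⟩
    by_cases hK : K = fullSimplex σ
    · rw [hK]
      exact comparison_fullSimplex σ
    have hM : fullSimplex σ ≤ K := fun τ hτ => K.down_closed hσ hτ
    have hne : σ ≠ ∅ := by
      rintro rfl
      refine hK (le_antisymm (fun τ hτ => ?_) hM)
      exact hmax hτ (Finset.empty_subset τ)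
    let L : SimplicialComplexOn m :=
      { faces := K.faces \ {σ}
        empty_mem := ⟨K.empty_mem, fun h => hne h.symm⟩
        down_closed := fun {ρ τ} hρ hτ => ⟨K.down_closed hρ.1 hτ, by
          rintro rfl
          exact hρ.2 (Finset.Subset.antisymm (hmax hρ.1 hτ) hτ)⟩ }
    have hL : L ≤ K := Set.sdiff_subset
    let N : SimplicialComplexOn m :=
      { faces := L.faces ∩ (fullSimplex σ).faces
        empty_mem := ⟨L.empty_mem, (fullSimplex σ).empty_mem⟩
        down_closed := fun h h' => ⟨L.down_closed h.1 h', (fullSimplex σ).down_closed h.2 h'⟩ }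
    have hNL : N ≤ L := Set.inter_subset_left
    have hNM : N ≤ fullSimplex σ := Set.inter_subset_right
    have hLM : K.faces ⊆ L.faces ∪ (fullSimplex σ).faces := fun τ hτ => by
      by_cases h : τ = σ
      · exact Or.inr h.le
      · exact Or.inl ⟨hτ, h⟩
    have cL : L.faces.ncard < K.faces.ncard :=
      Set.ncard_lt_ncard (Set.sdiff_singleton_ssubset.2 hσ) (Set.toFinite _)
    have cM : (fullSimplex σ).faces.ncard < K.faces.ncard :=
      Set.ncard_lt_ncard (lt_of_le_of_ne (α := SimplicialComplexOn m) hM (Ne.symm hK)) (Set.toFinite _)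
    have cN : N.faces.ncard < K.faces.ncard :=
      (Set.ncard_le_ncard hNL (Set.toFinite _)).trans_lt cL
    exact (small_isMayerVietoris hL hM hNL hNM hLM rfl).inducesIso
      (functorB_isMayerVietoris hL hM hNL hNM hLM rfl) _ _ _ _
      (comparison_comm hL) (comparison_comm hM) (comparison_comm hNL) (comparison_comm hNM)
      (ih _ cL L rfl) (comparison_fullSimplex σ) (ih _ cN N rfl)

/-- The projections `A(K) → B(K)` are natural. -/
def projNat (m : ℕ) : functorA ℤ m ⟶ functorB ℤ m where
  app K := projAB ℤ K.unop
  naturality _ _ _ := DGA.hom_ext fun _ _ => rfl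

end

end MomentAngle

theorem theorem1 (m : ℕ) :
    DGA.NaturallyQuasiIsomorphic (SimplicialComplexOn.functorCochains ℤ m)
      (SimplicialComplexOn.functorA ℤ m) ∧
    DGA.NaturallyQuasiIsomorphic (SimplicialComplexOn.functorCochains ℤ m)
      (SimplicialComplexOn.functorB ℤ m) := by
  have hB : DGA.NaturallyQuasiIsomorphic (SimplicialComplexOn.functorCochains ℤ m)
      (SimplicialComplexOn.functorB ℤ m) :=
    .trans _ _ _ (.rel _ _ ⟨MomentAngle.restrictToSmall m, MomentAngle.restrictToSmall_isQuasiIso⟩)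
      (.rel _ _ ⟨MomentAngle.comparisonNat m,
        fun K => (MomentAngle.comparison_inducesIso K.unop).quasiIso⟩)
  exact ⟨.trans _ _ _ hB (.symm _ _ (.rel _ _ ⟨MomentAngle.projNat m,
    fun K => SimplicialComplexOn.projAB_isQuasiIso ℤ K.unop⟩)), hB⟩
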